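/- Let $G$ be a finite-dimensional complex Lie group with Lie algebra $\mathfrak g$ (defined by left-invariant vector fields), let $X$ be a compact connected Riemann surface, and let $\alpha$ be a meromorphic $\mathfrak g$-valued 1-form on $X$ with no zeros: for a local coordinate $z$ centred at any $x\in X$, the coefficient $\alpha(\partial_z)$ has order $\le 0$ at $z=0$ (it has a pole, or is holomorphic and non-zero there). Let $k(x)\ge 0$ be the order of the pole of $\alpha$ at $x$ ($k(x)=0$ if $x$ is not a pole). Then the system $\mathrm dy+\alpha y=0$ has a twistor space, i.e. there are a (Hausdorff, second countable) complex manifold $\mathcal Z$ with $\dim\mathcal Z=\dim\mathfrak g$, a Lie algebra homomorphism $\phi$ from $\mathfrak g$ to the holomorphic vector fields on $\mathcal Z$, and a holomorphic embedding $\iota:X\to\mathcal Z$ such that $\phi_z:\mathfrak g\to T_z\mathcal Z$ is an isomorphism for some $z\in\iota(X)$, and such that, with $S=\{z:\phi_z\text{ is not an isomorphism}\}$ and the Maurer–Cartan form $\theta_z=\phi_z^{-1}$ on $\mathcal Z\setminus S$, one has $\iota^*\theta=\alpha$ on $X\setminus\iota^{-1}(S)$ and $\iota^{-1}(S)$ is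 the set of poles of $\alpha$. Moreover $\mathcal Z$ can be chosen so that the following hold. (a) The poles of $\alpha$ are finite in number, and $S$ is the disjoint union of closed connected smooth complex hypersurfaces $S_a$, one for each pole $a$; $\iota(X)$ meets $S_a$ only at $\iota(a)$, and transversally there; and $\Delta=\det\phi$ vanishes along $S_a$ to order exactly $k(a)$. (b) $\mathcal Z$ is the "minimal" twistor space $N/F$. Here $F$ is the rank-one holomorphic distribution on $X\times G$ spanned near $(x,g)$ by the vector field $z^{k(x)}(\partial_z-R_{\alpha(\partial_z)})$, where $z$ is a local coordinate centred at $x$ and $R_v$ is the right-invariant vector field on $G$ with value $v$ at the identity $e$. That is, there are an open neighbourhood $N$ of $X\times\{e\}$ in $X\times G$ and a surjective holomorphic submersion $\pi:N\to\mathcal Z$ whose fibres are connected with tangent spaces $\ker \mathrm d\pi=F$ (so they are the leaves of $F$ in $N$), such that $\pi(x,e)=\iota(x)$ for all $x\in X$, and for every $v\in\mathfrak g$ the left-invariant vector field on the factor $G$ generated by $v$ projects under $\pi$ to the vector field $\phi(v)$ on $\mathcal Z$. -/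

import Mathlib

open scoped Manifold ContDiff Topology
open VectorField

universe uE uG uX uL uZ

noncomputable section

/-- A meromorphic 1-form on a Riemann surface `X` with values in a complex normed space `V`.
The form is a covector at every point; its coefficient in a local coordinate is meromorphic, and it
is normalised so that it is holomorphic away from the poles and carries the conventional value `0`
at the poles (every meromorphic form has exactly one such representative). -/
structure MeromorphicOneForm (X : Type*) [TopologicalSpace X] [ChartedSpace ℂ X]
    (V : Type*) [NormedAddCommGroup V] [NormedSpace ℂ V] where
  /-- the value of the form at a point -/
  form : ∀ x : X, TangentSpace 𝓘(ℂ, ℂ) x →ₗ[ℂ] V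
  meromorphic' : ∀ x₀ : X,
    MeromorphicNFAt
      (fun z : ℂ => form ((chartAt ℂ x₀).symm z)
        (mfderiv 𝓘(ℂ, ℂ) 𝓘(ℂ, ℂ) (chartAt ℂ x₀).symm z (1 : ℂ)))
      (chartAt ℂ x₀ x₀)

namespace MeromorphicOneForm

variable {X : Type*} [TopologicalSpace X] [ChartedSpace ℂ X]
  {V : Type*} [NormedAddCommGroup V] [NormedSpace ℂ V]

/-- The coefficient `α(∂_z)` of `α` in the preferred coordinate `z` at `x₀`, as a function of `z`. -/
def coeff (α : MeromorphicOneForm X V) (x₀ : X) (z : ℂ) : V :=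
  α.form ((chartAt ℂ x₀).symm z) (mfderiv 𝓘(ℂ, ℂ) 𝓘(ℂ, ℂ) (chartAt ℂ x₀).symm z (1 : ℂ))

/-- The order of `α` at `x`: positive at a zero, negative at a pole, `⊤` if `α` vanishes
identically near `x`. -/
def order (α : MeromorphicOneForm X V) (x : X) : WithTop ℤ :=
  meromorphicOrderAt (α.coeff x) (chartAt ℂ x x)

/-- `x` is a pole of `α`. -/
def IsPole (α : MeromorphicOneForm X V) (x : X) : Prop := α.order x < 0

/-- `x` is a zero of `α` (this includes the case where `α` vanishes identically near `x`). -/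
def IsZero (α : MeromorphicOneForm X V) (x : X) : Prop := 0 < α.order x

/-- The order of the pole of `α` at `x`, as a natural number (`0` if `x` is not a pole). A pole of
order `r + 1` is a singularity of rank `r`. -/
def poleOrder (α : MeromorphicOneForm X V) (x : X) : ℕ := (-(α.order x).untopD 0).toNat

/-- The value at `x` of `z ^ k • α(∂_z)`, with `z` the preferred coordinate, translated so as to
vanish at `x`, and `k` the order of the pole at `x`. -/
def leadingCoeff (α : MeromorphicOneForm X V) (x : X) : V :=
  Filter.limUnder (𝓝[≠] (chartAt ℂ x x))
    (fun z : ℂ => (z - chartAt ℂ x x) ^ (α.poleOrder x) • α.coeff x z)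

end MeromorphicOneForm

/-- A twistor space for the complex Lie algebra `𝔤` and the compact Riemann surface `X`: a complex
manifold `Z` (modelled on `E`) with a homomorphism `φ` from `𝔤` into the Lie algebra of holomorphic
vector fields on `Z`, and a copy `ι(X)` of `X` embedded in `Z` as a smooth complex curve, such that
`φ_z : 𝔤 → T_z Z` is an isomorphism for some `z` on the curve. -/
structure TwistorSpace (E : Type uE) [NormedAddCommGroup E] [NormedSpace ℂ E]
    (𝔤 : Type uL) [LieRing 𝔤] [LieAlgebra ℂ 𝔤]
    (X : Type uX) [TopologicalSpace X] [ChartedSpace ℂ X] where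
  /-- the underlying complex manifold -/
  Z : Type uZ
  [top : TopologicalSpace Z]
  [t2 : T2Space Z]
  [secondCountable : SecondCountableTopology Z]
  [charted : ChartedSpace E Z]
  [manifold : IsManifold 𝓘(ℂ, E) ω Z]
  /-- the vector field on `Z` given by an element of the Lie algebra -/
  φ : 𝔤 →ₗ[ℂ] (∀ z : Z, TangentSpace 𝓘(ℂ, E) z)
  holomorphic_φ : ∀ v : 𝔤, ContMDiff 𝓘(ℂ, E) 𝓘(ℂ, E).tangent ω
    (fun z : Z => (⟨z, φ v z⟩ : TangentBundle 𝓘(ℂ, E) Z))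
  map_lie : ∀ (v w : 𝔤) (z : Z), φ ⁅v, w⁆ z = mlieBracket 𝓘(ℂ, E) (φ v) (φ w) z
  /-- the inclusion of the curve -/
  ι : X → Z
  holomorphic_ι : ContMDiff 𝓘(ℂ, ℂ) 𝓘(ℂ, E) ω ι
  embedding_ι : Topology.IsEmbedding ι
  immersion_ι : ∀ x : X, Function.Injective (mfderiv 𝓘(ℂ, ℂ) 𝓘(ℂ, E) ι x)
  exists_bijective : ∃ x : X, Function.Bijective (fun v : 𝔤 => φ v (ι x))

namespace TwistorSpace

attribute [instance] TwistorSpace.top TwistorSpace.t2 TwistorSpace.secondCountable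
  TwistorSpace.charted TwistorSpace.manifold

section General

variable {E : Type*} [NormedAddCommGroup E] [NormedSpace ℂ E]
  {𝔤 : Type*} [LieRing 𝔤] [LieAlgebra ℂ 𝔤]
  {X : Type*} [TopologicalSpace X] [ChartedSpace ℂ X]

/-- The linear map `φ_z : 𝔤 → T_z Z`. -/
def φAt (T : TwistorSpace E 𝔤 X) (z : T.Z) : 𝔤 →ₗ[ℂ] TangentSpace 𝓘(ℂ, E) z :=
  (LinearMap.proj z) ∘ₗ T.φ

/-- The set `S` where `φ_z` fails to be an isomorphism. -/
def singularSet (T : TwistorSpace E 𝔤 X) : Set T.Z :=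
  {z | ¬ Function.Bijective (T.φAt z)}

open Classical in
/-- The Maurer-Cartan form `θ_z = φ_z⁻¹` on `Z \ S` (with the conventional value `0` on `S`). -/
def maurerCartan (T : TwistorSpace E 𝔤 X) (z : T.Z) : TangentSpace 𝓘(ℂ, E) z →ₗ[ℂ] 𝔤 :=
  if h : Function.Bijective (T.φAt z) then
    ((LinearEquiv.ofBijective (T.φAt z) h).symm : TangentSpace 𝓘(ℂ, E) z →ₗ[ℂ] 𝔤)
  else 0

/-- The section `Δ = det φ` of the top exterior power of `TZ`, expressed through a basis `b` of `𝔤`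
and through the trivialisation given by the preferred chart at `z₀` and a basis `e` of the model
space; meaningful at points `w` near `z₀`. -/
def Δ {J : Type*} [Fintype J] [DecidableEq J] (T : TwistorSpace E 𝔤 X)
    (b : Module.Basis J ℂ 𝔤) (e : Module.Basis J ℂ E) (z₀ w : T.Z) : ℂ :=
  e.det (fun j => (mfderiv 𝓘(ℂ, E) 𝓘(ℂ, E) (chartAt E z₀) w (T.φ (b j) w) : E))

/-- `f` is a local equation, near `z`, of the set `S` as a smooth complex hypersurface. -/
def IsLocalEquation (T : TwistorSpace E 𝔤 X) (S : Set T.Z) (z : T.Z) (f : T.Z → ℂ) : Prop :=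
  ContMDiffAt 𝓘(ℂ, E) 𝓘(ℂ, ℂ) ω f z ∧ mfderiv 𝓘(ℂ, E) 𝓘(ℂ, ℂ) f z ≠ 0 ∧
    ∀ᶠ w in 𝓝 z, (w ∈ S ↔ f w = 0)

end General

variable {E : Type*} [NormedAddCommGroup E] [NormedSpace ℂ E] [CompleteSpace E]
  {G : Type*} [TopologicalSpace G] [ChartedSpace E G] [Group G] [LieGroup 𝓘(ℂ, E) ω G]
  {X : Type*} [TopologicalSpace X] [ChartedSpace ℂ X]

/-! Below, the Lie algebra of `G` is the tangent space of `G` at `1`, which is by definition the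
model space `E`; so an `E`-valued form is the same as a form with values in the Lie algebra. -/

/-- `T` is a twistor space for the system `dy + α y = 0`: the Maurer-Cartan form restricts to `α` on
the curve, and the poles of `α` are the points where the curve meets the singular set. -/
def IsTwistorSpaceFor (T : TwistorSpace E (GroupLieAlgebra 𝓘(ℂ, E) G) X)
    (α : MeromorphicOneForm X E) : Prop :=
  (∀ x : X, T.ι x ∈ T.singularSet ↔ α.IsPole x) ∧
  ∀ x : X, T.ι x ∉ T.singularSet → ∀ ξ : TangentSpace 𝓘(ℂ, ℂ) x,
    T.maurerCartan (T.ι x) (mfderiv 𝓘(ℂ, ℂ) 𝓘(ℂ, E) T.ι x ξ) = α.form x ξ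

/-- The regularity conditions on a twistor space for `dy + α y = 0`: the singular set is the union
of finitely many (disjoint, closed, connected, smooth) complex hypersurfaces `S a`, one for each
pole `a` of `α`; the curve meets `S a` at `a` only, and transversally; and `Δ = det φ` has a zero
along `S a` of order exactly the order of the pole of `α` at `a`. -/
def IsRegularFor (T : TwistorSpace E (GroupLieAlgebra 𝓘(ℂ, E) G) X)
    (α : MeromorphicOneForm X E) : Prop :=
  {a : X | α.IsPole a}.Finite ∧
  ∃ S : X → Set T.Z,
    T.singularSet = ⋃ a ∈ {a : X | α.IsPole a}, S a ∧
    {a : X | α.IsPole a}.PairwiseDisjoint S ∧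
    ∀ a : X, α.IsPole a →
      IsClosed (S a) ∧ IsConnected (S a) ∧ T.ι ⁻¹' (S a) = {a} ∧
      (∃ f : T.Z → ℂ, T.IsLocalEquation (S a) (T.ι a) f ∧
        ∃ ξ : TangentSpace 𝓘(ℂ, ℂ) a,
          mfderiv 𝓘(ℂ, E) 𝓘(ℂ, ℂ) f (T.ι a) (mfderiv 𝓘(ℂ, ℂ) 𝓘(ℂ, E) T.ι a ξ) ≠ 0) ∧
      ∀ z ∈ S a, ∃ f : T.Z → ℂ, T.IsLocalEquation (S a) z f ∧
        ∀ (b : Module.Basis (Fin (Module.finrank ℂ E)) ℂ (GroupLieAlgebra 𝓘(ℂ, E) G))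
          (e : Module.Basis (Fin (Module.finrank ℂ E)) ℂ E),
          ∃ u : T.Z → ℂ, ContMDiffAt 𝓘(ℂ, E) 𝓘(ℂ, ℂ) ω u z ∧ u z ≠ 0 ∧
            ∀ᶠ w in 𝓝 z, T.Δ b e z w = f w ^ (α.poleOrder a) * u w

end TwistorSpace

section Distribution

variable {E : Type*} [NormedAddCommGroup E] [NormedSpace ℂ E]
  {G : Type*} [TopologicalSpace G] [ChartedSpace E G] [Group G]
  {X : Type*} [TopologicalSpace X] [ChartedSpace ℂ X]

/-- The right-invariant vector field on `G` with value `v` at the identity. -/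
def rightInvariantField (v : GroupLieAlgebra 𝓘(ℂ, E) G) (g : G) : TangentSpace 𝓘(ℂ, E) g :=
  mfderiv 𝓘(ℂ, E) 𝓘(ℂ, E) (fun h : G => h * g) (1 : G) v

/-- The value at `(x, g)` of the vector field `z ^ k (∂_z - R)` on `X × G`, where `z` is the
preferred coordinate at `x`, translated so as to vanish there, `k` is the order of the pole of `α`
at `x`, and `R` is the right-invariant vector field on `G` generated by `α(∂_z)`. -/
def systemField (α : MeromorphicOneForm X E) (p : X × G) :
    TangentSpace (𝓘(ℂ, ℂ).prod 𝓘(ℂ, E)) p :=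
  (((0 : ℂ) ^ α.poleOrder p.1, -(rightInvariantField (G := G) (α.leadingCoeff p.1) p.2 : E)) :
    ℂ × E)

/-- The rank-one distribution `F` on `X × G` determined by the system `dy + α y = 0`: its leaves
away from the poles are locally the graphs of the solutions. -/
def systemDistribution (α : MeromorphicOneForm X E) (p : X × G) :
    Submodule ℂ (TangentSpace (𝓘(ℂ, ℂ).prod 𝓘(ℂ, E)) p) :=
  Submodule.span ℂ {systemField α p}

end Distribution

namespace TwistorSpace

variable {E : Type*} [NormedAddCommGroup E] [NormedSpace ℂ E] [CompleteSpace E]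
  {G : Type*} [TopologicalSpace G] [ChartedSpace E G] [Group G] [LieGroup 𝓘(ℂ, E) ω G]
  {X : Type*} [TopologicalSpace X] [ChartedSpace ℂ X]

/-- `T` is minimal for `dy + α y = 0`: it is the quotient `N / F` of an open neighbourhood `N` of
the identity section in `X × G` by the distribution `F` of the system, with the curve the image of
the identity section and the Lie algebra action the projection of the left-invariant vector fields
on `G`. That is, there is a surjective holomorphic submersion `π` of `N` onto `Z` whose fibres are
the leaves of `F` in `N` (they are tangent to `F` and connected). -/
def IsMinimalFor (T : TwistorSpace E (GroupLieAlgebra 𝓘(ℂ, E) G) X)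
    (α : MeromorphicOneForm X E) : Prop :=
  ∃ (N : Set (X × G)) (π : X × G → T.Z),
    IsOpen N ∧ (∀ x : X, (x, (1 : G)) ∈ N) ∧
    ContMDiffOn (𝓘(ℂ, ℂ).prod 𝓘(ℂ, E)) 𝓘(ℂ, E) ω π N ∧
    π '' N = Set.univ ∧
    (∀ p ∈ N, Function.Surjective (mfderiv (𝓘(ℂ, ℂ).prod 𝓘(ℂ, E)) 𝓘(ℂ, E) π p) ∧
      LinearMap.ker (mfderiv (𝓘(ℂ, ℂ).prod 𝓘(ℂ, E)) 𝓘(ℂ, E) π p).toLinearMap =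
        systemDistribution α p) ∧
    (∀ z : T.Z, IsConnected (N ∩ π ⁻¹' {z})) ∧
    (∀ x : X, π (x, 1) = T.ι x) ∧
    ∀ (v : GroupLieAlgebra 𝓘(ℂ, E) G), ∀ p ∈ N,
      mfderiv (𝓘(ℂ, ℂ).prod 𝓘(ℂ, E)) 𝓘(ℂ, E) π p
        (((0 : ℂ), (mulInvariantVectorField v p.2 : E)) : ℂ × E) = T.φ v (π p)

end TwistorSpace

end

/-!
# The space of leaves of a meromorphic linear system as a twistor space

The system `dy + α y = 0` is the rank-one distribution `F` on `X × G` spanned, near `(x₀, g)`, by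
the analytic field `ζ ^ k (∂_ζ - R)`, where `ζ` is a coordinate centred at `x₀`, `k` is the order of
the pole and `R` is the right-invariant field generated by `α(∂_ζ)`. Since `α` has no zeros,
`ζ ^ k α(∂_ζ)` does not vanish at `x₀`, so that this field vanishes nowhere and is transverse to the
identity section `X × {1}`, above the poles as well. The twistor space is the space of leaves of `F`
in a suitable neighbourhood of the compact curve `X × {1}`, and the curve is the image of that
section.

*The quotient.* The complex flow of an analytic vector field, obtained from the inverse function
theorem on a space of continuous curves (`exists_complex_flow`), gives charts in which `F` is
spanned by a coordinate field (`exists_flowBox`, `exists_isFoliatedChart`). Near a compact set that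
the charts of `F` separate, finitely many of them define a closed relation "same plaque", which is
transitive on a small neighbourhood; shrinking this to the plaques that meet a smaller tube
`X × B` around the section makes the classes connected (`exists_leafRelation`,
`exists_leafRelation_system`). The quotient by such a relation is a Hausdorff complex manifold whose
coordinates are the transverse coordinates of the foliated charts (`LeafRelation.LeafSpace`).

*The action.* Right translations of `G` preserve `F`, hence their infinitesimal generators, the
left-invariant fields, descend to the space of leaves, with their brackets (`LeafRelation.action`,
`LeafRelation.action_lie`). As `F` is the kernel of the projection, the field `ζ ^ k ∂_ζ` and the
left-invariant field generated by `Ad(g⁻¹) (ζ ^ k α(∂_ζ))` have the same projection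
(`LeafRelation.mfderiv_proj_horizontal`). Off the poles this says that the Maurer-Cartan form pulls
back to `α`; above a pole it says that the action has a kernel.

*The singular hypersurfaces.* By uniqueness for a linear differential equation, a leaf meeting
`{a} × G`, where `a` is a pole, stays in it (`LeafRelation.fst_eq_iff_of_rel`). So the coordinate `ζ`
at `a`, composed with a local section of the projection, is a local equation of the set of leaves
above `a`, and these sets are disjoint, closed, connected and transverse to the curve. The equation
of the system reads `ζ ^ k C = φ(y)` with `y` nowhere zero and `C`, the projection of `∂_ζ`,
completing the image of `φ` to the whole tangent space; replacing a basis vector by `y` shows that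
`det φ` is `ζ ^ k` times a unit (`exists_det_eq_mul`, `LeafRelation.exists_det_action_eq`).
-/

noncomputable section

/-! ### Composition with an analytic map on a space of continuous functions -/

section Superposition

variable {T : Type*} [TopologicalSpace T] [CompactSpace T]
  {W W' : Type*} [NormedAddCommGroup W] [NormedSpace ℂ W] [NormedAddCommGroup W'] [NormedSpace ℂ W']

/-- A formal multilinear series acts pointwise on continuous functions on a compact space. -/
def FormalMultilinearSeries.pointwise (T : Type*) [TopologicalSpace T] [CompactSpace T]
    (p : FormalMultilinearSeries ℂ W W') : FormalMultilinearSeries ℂ C(T, W) C(T, W') := fun n =>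
  MultilinearMap.mkContinuous
    { toFun := fun u => ⟨fun s => p n (fun i => u i s), by fun_prop⟩
      map_update_add' := by
        intro _ m i x y
        ext s
        have h : ∀ z : C(T, W), (fun j => (Function.update m i z) j s) =
            Function.update (fun j => m j s) i (z s) := by
          intro z; ext j; by_cases hj : j = i
          · subst hj; simp
          · simp [hj]
        simp only [ContinuousMap.coe_mk, ContinuousMap.add_apply]
        rw [h, h, h]
        simp
      map_update_smul' := by
        intro _ m i c x
        ext s
        have h : ∀ z : C(T, W), (fun j => (Function.update m i z) j s) =
            Function.update (fun j => m j s) i (z s) := by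
          intro z; ext j; by_cases hj : j = i
          · subst hj; simp
          · simp [hj]
        simp only [ContinuousMap.coe_mk, ContinuousMap.smul_apply]
        rw [h, h]
        simp }
    ‖p n‖ (by
      intro m
      rw [ContinuousMap.norm_le _ (by positivity)]
      intro s
      refine ((p n).le_opNorm _).trans ?_
      gcongr with i
      exact (m i).norm_coe_le_norm s)

theorem FormalMultilinearSeries.radius_le_radius_pointwise (p : FormalMultilinearSeries ℂ W W') :
    p.radius ≤ (p.pointwise T).radius := by
  refine ENNReal.le_of_forall_nnreal_lt fun r hr => ?_
  obtain ⟨C, -, hC⟩ := p.norm_mul_pow_le_of_lt_radius hr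
  refine FormalMultilinearSeries.le_radius_of_bound _ C fun n => le_trans ?_ (hC n)
  gcongr
  exact MultilinearMap.mkContinuous_norm_le _ (norm_nonneg _) _

/-- Composition with an analytic map is analytic on the space of continuous functions, near a
constant function. -/
theorem exists_analyticAt_superposition [CompleteSpace W'] {V : W → W'} {w₀ : W}
    (hV : AnalyticAt ℂ V w₀) :
    ∃ N : C(T, W) → C(T, W'), AnalyticAt ℂ N (ContinuousMap.const T w₀) ∧
      ∀ᶠ u in 𝓝 (ContinuousMap.const T w₀), ∀ s, N u s = V (u s) := by
  obtain ⟨p, r, hp⟩ := hV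
  have hpos : 0 < (p.pointwise T).radius :=
    hp.r_pos.trans_le (hp.r_le.trans p.radius_le_radius_pointwise)
  have hsum := (p.pointwise T).hasFPowerSeriesOnBall hpos
  refine ⟨fun u => (p.pointwise T).sum (u - ContinuousMap.const T w₀), ?_, ?_⟩
  · have h0 : AnalyticAt ℂ (p.pointwise T).sum
        (ContinuousMap.const T w₀ - ContinuousMap.const T w₀) := by
      rw [sub_self]; exact hsum.analyticAt
    exact h0.comp_of_eq (analyticAt_id.sub analyticAt_const) rfl
  · have hr : ∀ᶠ u : C(T, W) in 𝓝 (ContinuousMap.const T w₀),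
        u ∈ Metric.eball (ContinuousMap.const T w₀) r := Metric.eball_mem_nhds _ hp.r_pos
    filter_upwards [hr] with u hu s
    have hu' : u - ContinuousMap.const T w₀ ∈ Metric.eball (0 : C(T, W)) (p.pointwise T).radius := by
      have : u - ContinuousMap.const T w₀ ∈ Metric.eball (0 : C(T, W)) r := by
        simpa [edist_eq_enorm_sub] using hu
      exact Metric.eball_subset_eball (hp.r_le.trans p.radius_le_radius_pointwise) this
    have hus : u s - w₀ ∈ Metric.eball (0 : W) r := by
      have hu2 : edist u (ContinuousMap.const T w₀) < r := hu
      have : edist (u s) w₀ ≤ edist u (ContinuousMap.const T w₀) := by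
        rw [edist_dist, edist_dist]
        exact ENNReal.ofReal_le_ofReal (ContinuousMap.dist_apply_le_dist (f := u)
          (g := ContinuousMap.const T w₀) s)
      simpa [edist_eq_enorm_sub] using this.trans_lt hu2
    have h1 := hsum.hasSum hu'
    rw [zero_add] at h1
    have h2 : HasSum (fun n => (p.pointwise T n fun _ => u - ContinuousMap.const T w₀) s)
        ((p.pointwise T).sum (u - ContinuousMap.const T w₀) s) :=
      h1.map (ContinuousMap.evalCLM ℂ s).toLinearMap.toAddMonoidHom
        (ContinuousMap.evalCLM ℂ s).continuous
    have h3 := hp.hasSum hus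
    rw [add_sub_cancel] at h3
    exact h2.unique h3

end Superposition

/-! ### Complex flows and flow boxes of analytic vector fields -/

section Flow

variable {W : Type*} [NormedAddCommGroup W] [NormedSpace ℂ W]

/-- The primitive, vanishing at `0`, of a continuous function on the unit interval. -/
def primitiveCLM [CompleteSpace W] : C(unitInterval, W) →L[ℂ] C(unitInterval, W) :=
  LinearMap.mkContinuous
    { toFun := fun u => ⟨fun s => ∫ r in (0 : ℝ)..s, Set.IccExtend zero_le_one u r, by
        have hc : Continuous (Set.IccExtend (zero_le_one' ℝ) u) := u.continuous.Icc_extend'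
        exact (intervalIntegral.continuous_primitive
          (fun a b => hc.intervalIntegrable a b) 0).comp continuous_subtype_val⟩
      map_add' := by
        intro u v
        ext s
        have hc : ∀ u : C(unitInterval, W), Continuous (Set.IccExtend (zero_le_one' ℝ) u) :=
          fun u => u.continuous.Icc_extend'
        simp only [ContinuousMap.coe_mk, ContinuousMap.add_apply]
        rw [← intervalIntegral.integral_add ((hc u).intervalIntegrable _ _)
          ((hc v).intervalIntegrable _ _)]
        rfl
      map_smul' := by
        intro c u
        ext s
        simp only [ContinuousMap.coe_mk, ContinuousMap.smul_apply, RingHom.id_apply]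
        rw [← intervalIntegral.integral_smul]
        rfl }
    1 (by
      intro u
      rw [ContinuousMap.norm_le _ (by positivity)]
      intro s
      have h := intervalIntegral.norm_integral_le_of_norm_le_const (a := 0) (b := (s : ℝ))
        (f := Set.IccExtend (zero_le_one' ℝ) u) (C := ‖u‖)
        (fun x _ => u.norm_coe_le_norm _)
      refine h.trans ?_
      rw [sub_zero, abs_of_nonneg s.2.1, one_mul]
      exact mul_le_of_le_one_right (norm_nonneg _) s.2.2)

theorem primitiveCLM_apply [CompleteSpace W] (u : C(unitInterval, W)) (s : unitInterval) :
    primitiveCLM u s = ∫ r in (0 : ℝ)..s, Set.IccExtend zero_le_one u r := rfl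

/-- Constant functions on the unit interval, as a continuous linear map. -/
def constCLM : W →L[ℂ] C(unitInterval, W) :=
  LinearMap.mkContinuous
    { toFun := fun w => ContinuousMap.const _ w
      map_add' := fun _ _ => rfl
      map_smul' := fun _ _ => rfl } 1 (fun w => by
        rw [one_mul, ContinuousMap.norm_le _ (norm_nonneg _)]
        exact fun _ => le_rfl)

@[simp] theorem constCLM_apply (w : W) (s : unitInterval) : constCLM w s = w := rfl

/-- The curves solving `u' = t V(u)`, `u(0) = b` on the unit interval depend analytically on
`(t, b)` and are compatible with rescaling of time. -/
theorem exists_solution_curves [CompleteSpace W] {V : W → W} {w₀ : W}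
    (hV : AnalyticAt ℂ V w₀) :
    ∃ g : ℂ × W → C(unitInterval, W), ContDiffAt ℂ ω g (0, w₀) ∧ g (0, w₀) = constCLM w₀ ∧
      ∃ δ > 0, ∀ q ∈ Metric.ball ((0, w₀) : ℂ × W) δ, ∃ v : C(unitInterval, W),
        (∀ s, v s = V (g q s)) ∧ g q = constCLM q.2 + q.1 • primitiveCLM v ∧
        ∀ s r : unitInterval, g ((s : ℝ) * q.1, q.2) r = g q (r * s) := by
  obtain ⟨N, hN, hNV⟩ := exists_analyticAt_superposition (T := unitInterval) hV
  set c₀ : C(unitInterval, W) := constCLM w₀ with hc₀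
  change AnalyticAt ℂ N c₀ at hN
  change ∀ᶠ u in 𝓝 c₀, _ at hNV
  -- the solutions are the zeros of an analytic map on a space of curves; since the equation is
  -- trivial for `t = 0`, its derivative there is unipotent, and the inverse function theorem applies
  let H : (ℂ × W) × C(unitInterval, W) → (ℂ × W) × C(unitInterval, W) :=
    fun p => (p.1, p.2 - constCLM p.1.2 - p.1.1 • primitiveCLM (N p.2))
  have hHc : ContDiffAt ℂ ω H (((0 : ℂ), w₀), c₀) := by
    have h1 : ContDiffAt ℂ ω (fun p : (ℂ × W) × C(unitInterval, W) => N p.2) (((0 : ℂ), w₀), c₀) :=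
      ContDiffAt.comp ((0, w₀), c₀) (g := N) hN.contDiffAt contDiffAt_snd
    have h2 : ContDiffAt ℂ ω (fun p : (ℂ × W) × C(unitInterval, W) => primitiveCLM (N p.2))
        (((0 : ℂ), w₀), c₀) := (primitiveCLM (W := W)).contDiff.contDiffAt.comp _ h1
    have h3 : ContDiffAt ℂ ω (fun p : (ℂ × W) × C(unitInterval, W) =>
        (constCLM p.1.2 : C(unitInterval, W))) (((0 : ℂ), w₀), c₀) :=
      ContDiffAt.comp _ (g := fun w : W => (constCLM w : C(unitInterval, W)))
        (constCLM (W := W)).contDiff.contDiffAt contDiffAt_fst.snd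
    have h4 : ContDiffAt ℂ ω (fun p : (ℂ × W) × C(unitInterval, W) => p.1.1)
        (((0 : ℂ), w₀), c₀) := contDiffAt_fst.fst
    exact contDiffAt_fst.prodMk ((contDiffAt_snd.sub h3).sub (h4.smul h2))
  let L : ((ℂ × W) × C(unitInterval, W)) ≃L[ℂ] ((ℂ × W) × C(unitInterval, W)) :=
    (ContinuousLinearEquiv.refl ℂ (ℂ × W)).skewProd (ContinuousLinearEquiv.refl ℂ _)
      (-(constCLM.comp (ContinuousLinearMap.snd ℂ ℂ W)) -
        (ContinuousLinearMap.fst ℂ ℂ W).smulRight (primitiveCLM (N c₀)))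
  have hH' : HasFDerivAt H (L : _ →L[ℂ] _) (((0 : ℂ), w₀), c₀) := by
    have hN' : HasFDerivAt (fun p : (ℂ × W) × C(unitInterval, W) => primitiveCLM (N p.2))
        (primitiveCLM.comp ((fderiv ℂ N c₀).comp (ContinuousLinearMap.snd ℂ _ _)))
        (((0 : ℂ), w₀), c₀) :=
      HasFDerivAt.comp (((0 : ℂ), w₀), c₀) (g := fun u => primitiveCLM (W := W) u)
        (primitiveCLM (W := W)).hasFDerivAt
        (HasFDerivAt.comp (((0 : ℂ), w₀), c₀) (g := N) hN.differentiableAt.hasFDerivAt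
          hasFDerivAt_snd)
    have h11 : HasFDerivAt (fun p : (ℂ × W) × C(unitInterval, W) => p.1.1)
        ((ContinuousLinearMap.fst ℂ ℂ W).comp (ContinuousLinearMap.fst ℂ _ _)) (((0 : ℂ), w₀), c₀) :=
      HasFDerivAt.fst hasFDerivAt_fst
    have h12 : HasFDerivAt (fun p : (ℂ × W) × C(unitInterval, W) =>
        (constCLM p.1.2 : C(unitInterval, W)))
        (constCLM.comp ((ContinuousLinearMap.snd ℂ ℂ W).comp (ContinuousLinearMap.fst ℂ _ _)))
        (((0 : ℂ), w₀), c₀) :=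
      HasFDerivAt.comp (((0 : ℂ), w₀), c₀) (g := fun w => constCLM (W := W) w)
        (constCLM (W := W)).hasFDerivAt (HasFDerivAt.snd hasFDerivAt_fst)
    refine (hasFDerivAt_fst.prodMk ((hasFDerivAt_snd.sub h12).sub (h11.smul hN'))).congr_fderiv ?_
    ext x <;> simp [L]
  let e := hHc.toOpenPartialHomeomorph H hH' (by simp)
  have hsrc : ((0, w₀), c₀) ∈ e.source := hHc.mem_toOpenPartialHomeomorph_source hH' (by simp)
  have hH0 : H ((0, w₀), c₀) = ((0, w₀), 0) := by simp [H, hc₀]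
  have heH : ∀ p, e p = H p := fun _ => rfl
  have htgt : ((0, w₀), (0 : C(unitInterval, W))) ∈ e.target := by
    rw [← hH0]; exact e.map_source hsrc
  have hsym0 : e.symm ((0, w₀), 0) = ((0, w₀), c₀) := by
    rw [← hH0]; exact e.left_inv hsrc
  let g : ℂ × W → C(unitInterval, W) := fun q => (e.symm (q, 0)).2
  have hsymc : ContDiffAt ℂ ω e.symm ((0, w₀), 0) := by
    refine e.contDiffAt_symm (f₀' := L) htgt ?_ ?_
    · rw [hsym0]; exact hH'
    · rw [hsym0]; exact hHc
  have hincl : ContDiffAt ℂ ω (fun q : ℂ × W => (q, (0 : C(unitInterval, W)))) (0, w₀) :=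
    contDiffAt_id.prodMk contDiffAt_const
  have hg2 : ContDiffAt ℂ ω (fun q : ℂ × W => e.symm (q, 0)) (0, w₀) :=
    ContDiffAt.comp (0, w₀) hsymc hincl
  have hg : ContDiffAt ℂ ω g (0, w₀) := contDiffAt_snd.comp _ hg2
  have hg0 : g (0, w₀) = c₀ := by simp only [g]; rw [hsym0]
  -- a ball on which both the inverse function theorem and the formula for `N` apply
  obtain ⟨ε, hε, hball⟩ : ∃ ε > 0, ∀ p ∈ Metric.ball ((0, w₀), c₀) ε,
      p ∈ e.source ∧ ∀ s, N p.2 s = V (p.2 s) := by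
    have : ∀ᶠ p in 𝓝 ((0, w₀), c₀), p ∈ e.source ∧ ∀ s, N p.2 s = V (p.2 s) :=
      Filter.Eventually.and (e.open_source.mem_nhds hsrc)
        ((continuous_snd.tendsto ((0, w₀), c₀)).eventually hNV)
    exact Metric.eventually_nhds_iff_ball.1 this
  have hev : ∀ᶠ q in 𝓝 ((0 : ℂ), w₀), (q, (0 : C(unitInterval, W))) ∈ e.target ∧
      e.symm (q, 0) ∈ Metric.ball ((0, w₀), c₀) ε := by
    refine Filter.Eventually.and (hincl.continuousAt (e.open_target.mem_nhds htgt)) ?_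
    refine hg2.continuousAt ?_
    rw [hsym0]
    exact Metric.ball_mem_nhds _ hε
  obtain ⟨δ, hδ, hδb⟩ := Metric.eventually_nhds_iff_ball.1 hev
  have key : ∀ q ∈ Metric.ball ((0 : ℂ), w₀) δ, e.symm (q, 0) = (q, g q) ∧
      (q, g q) ∈ Metric.ball ((0, w₀), c₀) ε ∧
      g q = constCLM q.2 + q.1 • primitiveCLM (N (g q)) := by
    intro q hq
    obtain ⟨h1, h2⟩ := hδb q hq
    have h3 : H (e.symm (q, 0)) = (q, 0) := e.right_inv h1
    have h3' : (e.symm (q, 0)).1 = q := congrArg Prod.fst h3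
    have h4 : e.symm (q, 0) = (q, g q) := Prod.ext h3' rfl
    refine ⟨h4, h4 ▸ h2, ?_⟩
    rw [h4] at h3
    have h5 : g q - constCLM q.2 - q.1 • primitiveCLM (N (g q)) = 0 := congrArg Prod.snd h3
    rw [sub_sub, sub_eq_zero] at h5
    exact h5
  refine ⟨g, hg, hg0, δ, hδ, fun q hq => ⟨N (g q), ?_, (key q hq).2.2, ?_⟩⟩
  · exact (hball _ (key q hq).2.1).2
  intro s r
  -- the rescaled curve solves the equation for the rescaled time, so uniqueness applies
  have hq' : (((s : ℝ) : ℂ) * q.1, q.2) ∈ Metric.ball ((0 : ℂ), w₀) δ := by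
    rw [mem_ball_iff_norm, Prod.norm_def] at hq ⊢
    refine lt_of_le_of_lt (max_le_max ?_ le_rfl) hq
    simp only [Prod.fst_sub, sub_zero, norm_mul, Complex.norm_real, Real.norm_eq_abs,
      abs_of_nonneg s.2.1]
    exact mul_le_of_le_one_left (norm_nonneg _) s.2.2
  let v : C(unitInterval, W) := (g q).comp ⟨fun r => r * s, by fun_prop⟩
  have hv : ∀ r, v r = g q (r * s) := fun _ => rfl
  have hvball : ((((s : ℝ) : ℂ) * q.1, q.2), v) ∈ Metric.ball ((0, w₀), c₀) ε := by
    have h1 := (key _ hq').2.1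
    have h2 := (key _ hq).2.1
    rw [Metric.mem_ball, Prod.dist_eq, max_lt_iff] at h1 h2 ⊢
    refine ⟨h1.1, lt_of_le_of_lt ?_ h2.2⟩
    refine (ContinuousMap.dist_le dist_nonneg).2 fun r => ?_
    exact ContinuousMap.dist_apply_le_dist (f := g q) (g := c₀) (r * s)
  have hvN : ∀ r, N v r = N (g q) (r * s) := by
    intro r
    rw [(hball _ hvball).2, (hball _ (key q hq).2.1).2, hv]
  have hveq : v = constCLM q.2 + (((s : ℝ) : ℂ) * q.1) • primitiveCLM (N v) := by
    ext r
    have h0 : g q (r * s) = q.2 + q.1 • primitiveCLM (N (g q)) (r * s) :=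
      congrArg (fun u : C(unitInterval, W) => u (r * s)) (key q hq).2.2
    rw [hv, h0]
    change _ = q.2 + (((s : ℝ) : ℂ) * q.1) • primitiveCLM (N v) r
    rw [mul_comm ((s : ℝ) : ℂ) q.1, mul_smul]
    refine congrArg (fun w => q.2 + q.1 • w) ?_
    rw [primitiveCLM_apply, primitiveCLM_apply]
    rw [Complex.coe_smul]
    have h1 := intervalIntegral.smul_integral_comp_mul_right
      (f := Set.IccExtend (zero_le_one' ℝ) (N (g q))) (a := 0) (b := (r : ℝ)) (s : ℝ)
    rw [zero_mul] at h1
    rw [Set.Icc.coe_mul, ← h1]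
    congr 1
    refine intervalIntegral.integral_congr fun x hx => ?_
    rw [Set.uIcc_of_le r.2.1] at hx
    have hx1 : x ∈ Set.Icc (0 : ℝ) 1 := ⟨hx.1, hx.2.trans r.2.2⟩
    have hx2 : x * s ∈ Set.Icc (0 : ℝ) 1 :=
      ⟨mul_nonneg hx1.1 s.2.1, mul_le_one₀ hx1.2 s.2.1 s.2.2⟩
    rw [Set.IccExtend_of_mem _ _ hx2, Set.IccExtend_of_mem _ _ hx1, hvN]
    rfl
  have hinj := e.injOn (hball _ hvball).1 (hball _ (key _ hq').2.1).1 (by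
    rw [heH, heH]
    refine Prod.ext rfl ?_
    have h1 : v - constCLM q.2 - (((s : ℝ) : ℂ) * q.1) • primitiveCLM (N v) = 0 := by
      rw [sub_sub, sub_eq_zero]; exact hveq
    have h2 := (key _ hq').2.2
    change v - constCLM q.2 - (((s : ℝ) : ℂ) * q.1) • primitiveCLM (N v) = _ - _ - _
    rw [h1, eq_comm, sub_sub, sub_eq_zero]
    exact h2)
  have := congrArg Prod.snd hinj
  exact (congrArg (fun u : C(unitInterval, W) => u r) this).symm

/-- An analytic vector field has a local complex flow, jointly analytic in time and initial
value. -/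
theorem exists_complex_flow [CompleteSpace W] {V : W → W} {w₀ : W} (hV : AnalyticAt ℂ V w₀) :
    ∃ Φ : ℂ × W → W, ContDiffAt ℂ ω Φ (0, w₀) ∧ (∀ᶠ b in 𝓝 w₀, Φ (0, b) = b) ∧
      ∀ᶠ q in 𝓝 ((0 : ℂ), w₀), fderiv ℂ Φ q (1, 0) = V (Φ q) := by
  obtain ⟨g, hg, hg0, δ, hδ, hgδ⟩ := exists_solution_curves hV
  -- the rescaling of time turns the values at `1` of the curves into a flow
  let Φ : ℂ × W → W := fun q => g q 1
  have hΦ : ContDiffAt ℂ ω Φ (0, w₀) :=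
    ContDiffAt.comp (0, w₀) (g := fun u : C(unitInterval, W) => u 1)
      (ContinuousMap.evalCLM ℂ (1 : unitInterval) : C(unitInterval, W) →L[ℂ] W).contDiff.contDiffAt hg
  have hΦ0 : Φ (0, w₀) = w₀ := by simp only [Φ, hg0]; rfl
  refine ⟨Φ, hΦ, ?_, ?_⟩
  · filter_upwards [Metric.ball_mem_nhds w₀ hδ] with b hb
    obtain ⟨v, -, h, -⟩ := hgδ (0, b) (by simpa [Prod.dist_eq, hδ] using hb)
    simp only [Φ]
    rw [h]; simp
  -- the equation away from time zero, read on the curve of parameter `2 t` at its interior point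
  -- `1 / 2`
  have hne : ∀ᶠ q in 𝓝 ((0 : ℂ), w₀), q.1 ≠ 0 → fderiv ℂ Φ q (1, 0) = V (Φ q) := by
    filter_upwards [Metric.ball_mem_nhds ((0 : ℂ), w₀) (half_pos hδ), hΦ.eventually (by simp)]
      with q hq hΦq hq0
    obtain ⟨t, b⟩ := q
    have hq2 : (2 * t, b) ∈ Metric.ball ((0 : ℂ), w₀) δ := by
      rw [Metric.mem_ball, Prod.dist_eq, max_lt_iff] at hq ⊢
      refine ⟨?_, hq.2.trans (half_lt_self hδ)⟩
      have := hq.1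
      simp only [dist_zero_right, norm_mul, Complex.norm_ofNat] at this ⊢
      linarith
    obtain ⟨v, hv, hgv, hgs⟩ := hgδ _ hq2
    have hhalf : (1 / 2 : ℝ) ∈ Set.Icc (0 : ℝ) 1 := by constructor <;> norm_num
    have e1 : ∀ s : unitInterval, Φ (((s : ℝ) : ℂ) * (2 * t), b) = g (2 * t, b) s := by
      intro s
      have := hgs s 1
      simpa [Φ] using this
    have d1 : HasDerivAt (fun s : ℝ => Φ ((s : ℂ) * (2 * t), b))
        ((2 * t) • fderiv ℂ Φ (t, b) (1, 0)) (1 / 2) := by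
      have hline : HasDerivAt (fun s : ℝ => (((s : ℂ) * (2 * t), b) : ℂ × W))
          (2 * t, 0) (1 / 2) := by
        have h0 : HasDerivAt (fun s : ℝ => (s : ℂ) * (2 * t)) (1 * (2 * t)) (1 / 2) :=
          (Complex.ofRealCLM.hasDerivAt (x := (1 / 2 : ℝ))).mul_const (2 * t)
        rw [one_mul] at h0
        exact h0.prodMk (hasDerivAt_const _ _)
      have hF : HasFDerivAt Φ (fderiv ℂ Φ (t, b)) ((((1 / 2 : ℝ) : ℂ) * (2 * t), b)) := by
        have : ((1 / 2 : ℝ) : ℂ) * (2 * t) = t := by push_cast; ring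
        rw [this]
        exact (hΦq.differentiableAt (by simp)).hasFDerivAt
      have := (hF.restrictScalars ℝ).comp_hasDerivAt (1 / 2 : ℝ) hline
      convert! this using 1
      simp only [ContinuousLinearMap.coe_restrictScalars']
      rw [← map_smul]
      simp
    have d2 : HasDerivAt (fun s : ℝ => b + (2 * t) • ∫ r in (0 : ℝ)..s,
        Set.IccExtend (zero_le_one' ℝ) v r)
        ((2 * t) • V (Φ (t, b))) (1 / 2) := by
      have hc : Continuous (Set.IccExtend (zero_le_one' ℝ) v) := v.continuous.Icc_extend'
      have h1 := intervalIntegral.integral_hasDerivAt_right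
        (hc.intervalIntegrable 0 (1 / 2)) (hc.stronglyMeasurableAtFilter _ _) hc.continuousAt
      have h2 := (h1.const_smul (2 * t)).const_add b
      rw [Set.IccExtend_of_mem _ _ hhalf, hv] at h2
      have h3 : Φ (t, b) = g (2 * t, b) ⟨1 / 2, hhalf⟩ := by
        rw [← e1]
        congr 2
        push_cast; ring
      rw [h3]
      exact h2
    have hee : (fun s : ℝ => Φ ((s : ℂ) * (2 * t), b)) =ᶠ[𝓝 (1 / 2)]
        (fun s : ℝ => b + (2 * t) • ∫ r in (0 : ℝ)..s, Set.IccExtend (zero_le_one' ℝ) v r) := by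
      filter_upwards [Icc_mem_nhds (show (0 : ℝ) < 1 / 2 by norm_num)
        (show (1 / 2 : ℝ) < 1 by norm_num)] with s hs
      have := e1 ⟨s, hs⟩
      simp only at this
      rw [this, hgv]
      rfl
    have h := d1.unique (d2.congr_of_eventuallyEq hee)
    exact smul_right_injective W (mul_ne_zero two_ne_zero hq0) h
  -- at time zero, by continuity
  have hVev : ∀ᶠ q in 𝓝 ((0 : ℂ), w₀), AnalyticAt ℂ V (Φ q) := by
    have : Filter.Tendsto Φ (𝓝 (0, w₀)) (𝓝 w₀) := by
      simpa [hΦ0] using hΦ.continuousAt.tendsto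
    exact this.eventually hV.eventually_analyticAt
  filter_upwards [hne.eventually_nhds, hVev, hΦ.eventually (by simp)] with q hq hVq hΦq
  have c1 : ContinuousAt (fun q => fderiv ℂ Φ q (1, 0)) q :=
    (hΦq.continuousAt_fderiv (by simp)).clm_apply continuousAt_const
  have c2 : ContinuousAt (fun q => V (Φ q)) q :=
    ContinuousAt.comp (g := V) hVq.continuousAt hΦq.continuousAt
  have hin : Filter.Tendsto (fun t : ℂ => (t, q.2)) (𝓝[≠] q.1) (𝓝 q) := by
    have : Continuous (fun t : ℂ => (t, q.2)) := by fun_prop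
    exact (this.tendsto q.1).mono_left nhdsWithin_le_nhds
  refine tendsto_nhds_unique_of_eventuallyEq (c1.tendsto.comp hin) (c2.tendsto.comp hin) ?_
  have hn0 : ∀ᶠ t in 𝓝[≠] q.1, t ≠ 0 := by
    by_cases h0 : q.1 = 0
    · rw [h0]; exact self_mem_nhdsWithin
    · exact nhdsWithin_le_nhds (isOpen_ne.mem_nhds h0)
  filter_upwards [hin.eventually hq, hn0] with t ht ht0
  exact ht ht0

end Flow

section FlowBox

variable {E : Type*} [NormedAddCommGroup E] [NormedSpace ℂ E] [FiniteDimensional ℂ E]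

/-- A nonvanishing analytic vector field is `∂/∂t` in suitable local analytic coordinates
`(t, b)`. -/
theorem exists_flowBox {V : ℂ × E → ℂ × E} {w₀ : ℂ × E} (hV : AnalyticAt ℂ V w₀) (hV0 : V w₀ ≠ 0)
    {U : Set (ℂ × E)} (hU : U ∈ 𝓝 w₀) :
    ∃ Θ : OpenPartialHomeomorph (ℂ × E) (ℂ × E), w₀ ∈ Θ.source ∧ Θ.source ⊆ U ∧
      ContDiffOn ℂ ω Θ Θ.source ∧ ContDiffOn ℂ ω Θ.symm Θ.target ∧
      ∀ p ∈ Θ.source, fderiv ℂ Θ p (V p) = (1, 0) := by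
  have : CompleteSpace E := FiniteDimensional.complete ℂ E
  obtain ⟨Φ, hΦ, hΦ0, hΦV⟩ := exists_complex_flow hV
  obtain ⟨Λ, hΛ⟩ := SeparatingDual.exists_continuousLinearEquiv_apply_eq (R := ℂ)
    (x := ((1 : ℂ), (0 : E))) (y := V w₀) (by simp) hV0
  -- flow out of the hyperplane `Λ ({0} × E)`, which is transverse to `V` at `w₀`
  let A : ℂ × E → ℂ × (ℂ × E) := fun q => (q.1, w₀ + Λ (0, q.2))
  have hA : ContDiff ℂ ω A := by
    refine contDiff_fst.prodMk (contDiff_const.add ?_)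
    exact Λ.contDiff.comp (contDiff_const.prodMk contDiff_snd)
  have hA0 : A (0, 0) = (0, w₀) := by
    have : Λ (0, 0) = 0 := Λ.map_zero
    simp [A, this]
  have hA' : ∀ q, HasFDerivAt A ((ContinuousLinearMap.fst ℂ ℂ E).prod
      ((Λ : ℂ × E →L[ℂ] ℂ × E).comp ((ContinuousLinearMap.inr ℂ ℂ E).comp
        (ContinuousLinearMap.snd ℂ ℂ E)))) q := by
    intro q
    refine hasFDerivAt_fst.prodMk (HasFDerivAt.const_add _ ?_)
    exact ((Λ : ℂ × E →L[ℂ] ℂ × E).comp ((ContinuousLinearMap.inr ℂ ℂ E).comp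
        (ContinuousLinearMap.snd ℂ ℂ E))).hasFDerivAt
  let Ψ : ℂ × E → ℂ × E := fun q => Φ (A q)
  have hΨ : ContDiffAt ℂ ω Ψ (0, 0) := by
    refine ContDiffAt.comp (g := Φ) (0, 0) ?_ hA.contDiffAt
    rw [hA0]; exact hΦ
  have hΦw : Φ (0, w₀) = w₀ := hΦ0.self_of_nhds
  have hΨ0 : Ψ (0, 0) = w₀ := by simp only [Ψ]; rw [hA0, hΦw]
  -- the derivative of the flow at time zero
  have hΦ' : ∀ (t : ℂ) (w : ℂ × E), fderiv ℂ Φ (0, w₀) (t, w) = t • V w₀ + w := by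
    intro t w
    have h1 : fderiv ℂ Φ (0, w₀) (1, 0) = V w₀ := by
      rw [hΦV.self_of_nhds, hΦw]
    have h2 : fderiv ℂ Φ (0, w₀) (0, w) = w := by
      have hF := (hΦ.differentiableAt (by simp)).hasFDerivAt
      have hc : HasFDerivAt (fun b : ℂ × E => Φ (0, b))
          ((fderiv ℂ Φ (0, w₀)).comp (ContinuousLinearMap.inr ℂ ℂ (ℂ × E))) w₀ :=
        HasFDerivAt.comp w₀ (g := Φ) hF (hasFDerivAt_prodMk_right 0 w₀)
      have := hc.unique ((hasFDerivAt_id w₀).congr_of_eventuallyEq hΦ0)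
      exact congrArg (fun L : ℂ × E →L[ℂ] ℂ × E => L w) this
    have : ((t, w) : ℂ × (ℂ × E)) = t • (1, 0) + (0, w) := by simp
    rw [this, map_add, map_smul, h1, h2]
  have hΨ' : HasFDerivAt Ψ (Λ : ℂ × E →L[ℂ] ℂ × E) (0, 0) := by
    have hF : HasFDerivAt Φ (fderiv ℂ Φ (0, w₀)) (A (0, 0)) := by
      rw [hA0]; exact (hΦ.differentiableAt (by simp)).hasFDerivAt
    refine (HasFDerivAt.comp (g := Φ) (0, 0) hF (hA' (0, 0))).congr_fderiv ?_
    refine ContinuousLinearMap.ext fun x => ?_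
    have hx : x = x.1 • ((1 : ℂ), (0 : E)) + (0, x.2) := by ext <;> simp
    have hΛx : Λ x = x.1 • V w₀ + Λ (0, x.2) := by
      conv_lhs => rw [hx, map_add, map_smul, hΛ]
    change fderiv ℂ Φ (0, w₀) (x.1, Λ (0, x.2)) = Λ x
    rw [hΦ', hΛx]
  let e := hΨ.toOpenPartialHomeomorph Ψ hΨ' (by simp)
  have hsrc : ((0 : ℂ), (0 : E)) ∈ e.source :=
    hΨ.mem_toOpenPartialHomeomorph_source hΨ' (by simp)
  have heΨ : ∀ q, e q = Ψ q := fun _ => rfl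
  have hsymc : ContDiffAt ℂ ω e.symm w₀ := by
    have htgt : w₀ ∈ e.target := by
      have := e.map_source hsrc
      rwa [heΨ, hΨ0] at this
    have h0 : e.symm w₀ = (0, 0) := by
      have := e.left_inv hsrc
      rwa [heΨ, hΨ0] at this
    refine e.contDiffAt_symm (f₀' := Λ) htgt ?_ ?_
    · rw [h0]; exact hΨ'
    · rw [h0]; exact hΨ
  have hAc : Filter.Tendsto A (𝓝 (0, 0)) (𝓝 (0, w₀)) := by
    simpa [hA0] using hA.continuous.tendsto (0, 0)
  have hΨc : Filter.Tendsto Ψ (𝓝 (0, 0)) (𝓝 w₀) := by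
    simpa [hΨ0] using hΨ.continuousAt.tendsto
  have hev : ∀ᶠ q in 𝓝 ((0 : ℂ), (0 : E)), ContDiffAt ℂ ω Ψ q ∧ ContDiffAt ℂ ω e.symm (Ψ q) ∧
      Ψ q ∈ U ∧ fderiv ℂ Ψ q (1, 0) = V (Ψ q) := by
    filter_upwards [hΨ.eventually (by simp), hΨc.eventually (hsymc.eventually (by simp)),
      hΨc.eventually hU, hAc.eventually hΦV, hAc.eventually (hΦ.eventually (by simp))]
      with q h1 h2 h3 h4 h5
    refine ⟨h1, h2, h3, ?_⟩
    have hc := (HasFDerivAt.comp (g := Φ) q (h5.differentiableAt (by simp)).hasFDerivAt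
      (hA' q)).fderiv
    change fderiv ℂ (Φ ∘ A) q (1, 0) = _
    rw [hc]
    change fderiv ℂ Φ (A q) (1, Λ (0, 0)) = V (Φ (A q))
    have : Λ (0, 0) = 0 := Λ.map_zero
    rw [this, h4]
  obtain ⟨O, hO, hOo, hO0⟩ := eventually_nhds_iff.1 hev
  let e₁ := e.restrOpen O hOo
  have hs₁ : e₁.source = e.source ∩ O := e.restrOpen_source O hOo
  have hmem : ∀ p ∈ e₁.target, e.symm p ∈ e.source ∩ O ∧ Ψ (e.symm p) = p := fun p hp =>
    ⟨hs₁ ▸ e₁.map_target hp, e₁.right_inv hp⟩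
  refine ⟨e₁.symm, ?_, ?_, ?_, ?_, ?_⟩
  · have : e₁ (0, 0) ∈ e₁.target := e₁.map_source (by rw [hs₁]; exact ⟨hsrc, hO0⟩)
    have h2 : e₁ (0, 0) = w₀ := hΨ0
    rwa [h2] at this
  · intro p hp
    have h := hmem p hp
    rw [← h.2]
    exact (hO _ h.1.2).2.2.1
  · intro p hp
    have h := hmem p hp
    have := (hO _ h.1.2).2.1
    rw [h.2] at this
    exact this.contDiffWithinAt
  · intro q hq
    have hq' : q ∈ e.source ∩ O := hs₁ ▸ hq
    exact (hO _ hq'.2).1.contDiffWithinAt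
  · intro p hp
    have h := hmem p hp
    obtain ⟨h1, h2, -, h4⟩ := hO _ h.1.2
    have hcomp : fderiv ℂ (e.symm ∘ Ψ) (e.symm p) =
        (fderiv ℂ e.symm (Ψ (e.symm p))).comp (fderiv ℂ Ψ (e.symm p)) :=
      fderiv_comp _ (h2.differentiableAt (by simp)) (h1.differentiableAt (by simp))
    have hid : e.symm ∘ Ψ =ᶠ[𝓝 (e.symm p)] id := by
      filter_upwards [e.open_source.mem_nhds h.1.1] with q hq
      exact e.left_inv hq
    rw [hid.fderiv_eq, fderiv_id] at hcomp
    have h5 := congrArg (fun L : ℂ × E →L[ℂ] ℂ × E => L (1, 0)) hcomp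
    simp only [ContinuousLinearMap.comp_apply, ContinuousLinearMap.id_apply] at h5
    rw [h4, h.2] at h5
    exact h5.symm

end FlowBox

/-! ### Foliated charts -/

/-- The second coordinate of a chart with values in a product is an open map. -/
theorem OpenPartialHomeomorph.isOpen_image_snd {M A B : Type*} [TopologicalSpace M]
    [TopologicalSpace A] [TopologicalSpace B] (β : OpenPartialHomeomorph M (A × B)) {O : Set M}
    (hO : IsOpen O) (hOβ : O ⊆ β.source) : IsOpen ((fun p => (β p).2) '' O) := by
  have h := isOpenMap_snd _ (β.isOpen_image_of_subset_source hO hOβ)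
  rwa [Set.image_image] at h

/-- A property holding near a point holds on the inverse image of a small ball in a chart. -/
theorem OpenPartialHomeomorph.exists_ball {E M : Type*} [NormedAddCommGroup E]
    [TopologicalSpace M] (β : OpenPartialHomeomorph M E) {v : M} (hv : v ∈ β.source) {P : M → Prop}
    (hP : ∀ᶠ p in 𝓝 v, P p) :
    ∃ r > 0, Metric.ball (β v) r ⊆ β.target ∧ ∀ q ∈ Metric.ball (β v) r, P (β.symm q) := by
  have h1 : ∀ᶠ q in 𝓝 (β v), q ∈ β.target := β.open_target.mem_nhds (β.map_source hv)
  have h2 : ∀ᶠ q in 𝓝 (β v), P (β.symm q) := by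
    have := β.continuousAt_symm (β.map_source hv)
    rw [ContinuousAt, β.left_inv hv] at this
    exact this.eventually hP
  obtain ⟨r, hr, h⟩ := Metric.eventually_nhds_iff_ball.1 (h1.and h2)
  exact ⟨r, hr, fun q hq => (h q hq).1, fun q hq => (h q hq).2⟩

section FoliatedChart

variable {E : Type*} [NormedAddCommGroup E] [NormedSpace ℂ E]
  {M : Type*} [TopologicalSpace M] [ChartedSpace (ModelProd ℂ E) M]
  {V : Type*} [NormedAddCommGroup V] [NormedSpace ℂ V]

/-- `β` is a foliated chart for the distribution `F`: an analytic coordinate system `(t, b)` in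
which `F` is spanned by `∂/∂t`, so that the plaques of `F` are the sets where `b` is constant. -/
structure IsFoliatedChart (F : ∀ p : M, Submodule ℂ (TangentSpace (𝓘(ℂ, ℂ).prod 𝓘(ℂ, E)) p))
    (β : OpenPartialHomeomorph M (ℂ × E)) : Prop where
  contMDiffOn : ContMDiffOn (𝓘(ℂ, ℂ).prod 𝓘(ℂ, E)) 𝓘(ℂ, ℂ × E) ω β β.source
  contMDiffOn_symm : ContMDiffOn 𝓘(ℂ, ℂ × E) (𝓘(ℂ, ℂ).prod 𝓘(ℂ, E)) ω β.symm β.target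
  mem_iff : ∀ p ∈ β.source, ∀ ζ : TangentSpace (𝓘(ℂ, ℂ).prod 𝓘(ℂ, E)) p,
    ζ ∈ F p ↔ (mfderiv (𝓘(ℂ, ℂ).prod 𝓘(ℂ, E)) 𝓘(ℂ, ℂ × E) β p ζ : ℂ × E).2 = 0

namespace IsFoliatedChart

variable {F : ∀ p : M, Submodule ℂ (TangentSpace (𝓘(ℂ, ℂ).prod 𝓘(ℂ, E)) p)}
  {β β' : OpenPartialHomeomorph M (ℂ × E)}

theorem contMDiffAt (hβ : IsFoliatedChart F β) {p : M} (hp : p ∈ β.source) :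
    ContMDiffAt (𝓘(ℂ, ℂ).prod 𝓘(ℂ, E)) 𝓘(ℂ, ℂ × E) ω β p :=
  hβ.contMDiffOn.contMDiffAt (β.open_source.mem_nhds hp)

theorem contMDiffAt_symm (hβ : IsFoliatedChart F β) {q : ℂ × E} (hq : q ∈ β.target) :
    ContMDiffAt 𝓘(ℂ, ℂ × E) (𝓘(ℂ, ℂ).prod 𝓘(ℂ, E)) ω β.symm q :=
  hβ.contMDiffOn_symm.contMDiffAt (β.open_target.mem_nhds hq)

theorem contMDiffAt_snd (hβ : IsFoliatedChart F β) {p : M} (hp : p ∈ β.source) :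
    ContMDiffAt (𝓘(ℂ, ℂ).prod 𝓘(ℂ, E)) 𝓘(ℂ, E) ω (fun p => (β p).2) p :=
  ContMDiffAt.comp (g := fun q : ℂ × E => q.2) p contDiff_snd.contMDiff.contMDiffAt
    (hβ.contMDiffAt hp)

theorem mfderiv_snd (hβ : IsFoliatedChart F β) {p : M} (hp : p ∈ β.source)
    (ζ : TangentSpace (𝓘(ℂ, ℂ).prod 𝓘(ℂ, E)) p) :
    (mfderiv (𝓘(ℂ, ℂ).prod 𝓘(ℂ, E)) 𝓘(ℂ, E) (fun p => (β p).2) p ζ : E) =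
      (mfderiv (𝓘(ℂ, ℂ).prod 𝓘(ℂ, E)) 𝓘(ℂ, ℂ × E) β p ζ : ℂ × E).2 := by
  have h := HasMFDerivAt.comp p (g := fun q : ℂ × E => q.2)
    (ContinuousLinearMap.snd ℂ ℂ E).hasMFDerivAt
    ((hβ.contMDiffAt hp).mdifferentiableAt (by simp)).hasMFDerivAt
  exact congrArg (fun L : ℂ × E →L[ℂ] E => L ζ) h.mfderiv

theorem contMDiffAt_plaque (hβ : IsFoliatedChart F β) {t : ℂ} {b : E} (h : (t, b) ∈ β.target) :
    ContMDiffAt 𝓘(ℂ, ℂ) (𝓘(ℂ, ℂ).prod 𝓘(ℂ, E)) ω (fun t => β.symm (t, b)) t :=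
  ContMDiffAt.comp (g := β.symm) t (hβ.contMDiffAt_symm h)
    ((contDiff_id.prodMk contDiff_const).contMDiff.contMDiffAt)

theorem mfderiv_mfderiv_plaque (hβ : IsFoliatedChart F β) {t : ℂ} {b : E}
    (h : (t, b) ∈ β.target) :
    (mfderiv (𝓘(ℂ, ℂ).prod 𝓘(ℂ, E)) 𝓘(ℂ, ℂ × E) β (β.symm (t, b))
      (mfderiv 𝓘(ℂ, ℂ) (𝓘(ℂ, ℂ).prod 𝓘(ℂ, E)) (fun t => β.symm (t, b)) t (1 : ℂ)) : ℂ × E) =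
        (1, 0) := by
  have hc := mfderiv_comp (I' := 𝓘(ℂ, ℂ).prod 𝓘(ℂ, E)) t (g := β) (f := fun t => β.symm (t, b))
    ((hβ.contMDiffAt (β.map_target h)).mdifferentiableAt (by simp))
    ((hβ.contMDiffAt_plaque h).mdifferentiableAt (by simp))
  have he : β ∘ (fun t => β.symm (t, b)) =ᶠ[𝓝 t] fun t => (t, b) := by
    have hcont : Continuous fun t : ℂ => (t, b) := by fun_prop
    filter_upwards [hcont.continuousAt (β.open_target.mem_nhds h)] with s hs
    exact β.right_inv hs
  rw [he.mfderiv_eq, mfderiv_eq_fderiv] at hc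
  have hd : fderiv ℂ (fun t : ℂ => (t, b)) t 1 = (1, 0) := by
    rw [(hasFDerivAt_prodMk_left t b).fderiv]; rfl
  rw [← hd, hc]
  rfl

theorem mfderiv_plaque_mem (hβ : IsFoliatedChart F β) {t : ℂ} {b : E} (h : (t, b) ∈ β.target) :
    mfderiv 𝓘(ℂ, ℂ) (𝓘(ℂ, ℂ).prod 𝓘(ℂ, E)) (fun t => β.symm (t, b)) t (1 : ℂ) ∈
      F (β.symm (t, b)) := by
  rw [hβ.mem_iff _ (β.map_target h), hβ.mfderiv_mfderiv_plaque h]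

/-- The plaque of a foliated chart, moved by a map, has the expected velocity. -/
theorem hasDerivAt_comp_plaque (hβ : IsFoliatedChart F β) {t : ℂ} {b : E}
    (h : (t, b) ∈ β.target) {f : M → V}
    (hf : MDifferentiableAt (𝓘(ℂ, ℂ).prod 𝓘(ℂ, E)) 𝓘(ℂ, V) f (β.symm (t, b))) :
    HasDerivAt (fun t => f (β.symm (t, b)))
      (mfderiv (𝓘(ℂ, ℂ).prod 𝓘(ℂ, E)) 𝓘(ℂ, V) f (β.symm (t, b))
        (mfderiv 𝓘(ℂ, ℂ) (𝓘(ℂ, ℂ).prod 𝓘(ℂ, E)) (fun t => β.symm (t, b)) t (1 : ℂ)) : V) t := by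
  have hc := HasMFDerivAt.comp t (g := f) (f := fun t => β.symm (t, b)) hf.hasMFDerivAt
    ((hβ.contMDiffAt_plaque h).mdifferentiableAt (by simp)).hasMFDerivAt
  have h1 : HasFDerivAt (fun t => f (β.symm (t, b))) (_ : ℂ →L[ℂ] V) t := hc.hasFDerivAt
  exact h1.hasDerivAt

/-- A function whose differential kills `F` is constant along the plaques of a small box. -/
theorem eq_of_snd_eq (hβ : IsFoliatedChart F β) {f : M → V} {c : ℂ × E} {r : ℝ}
    (hr : Metric.ball c r ⊆ β.target)
    (hf : ∀ q ∈ Metric.ball c r,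
      MDifferentiableAt (𝓘(ℂ, ℂ).prod 𝓘(ℂ, E)) 𝓘(ℂ, V) f (β.symm q) ∧
      ∀ ζ ∈ F (β.symm q), mfderiv (𝓘(ℂ, ℂ).prod 𝓘(ℂ, E)) 𝓘(ℂ, V) f (β.symm q) ζ = 0)
    {p p' : M} (hp : p ∈ β.source) (hp' : p' ∈ β.source) (hpc : β p ∈ Metric.ball c r)
    (hpc' : β p' ∈ Metric.ball c r) (h : (β p).2 = (β p').2) : f p = f p' := by
  obtain ⟨c₁, c₂⟩ := c
  rw [← ball_prod_same] at *
  have hb : ∀ t ∈ Metric.ball c₁ r, (t, (β p).2) ∈ Metric.ball c₁ r ×ˢ Metric.ball c₂ r :=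
    fun t ht => ⟨ht, hpc.2⟩
  have hd : ∀ t ∈ Metric.ball c₁ r, HasDerivAt (fun t => f (β.symm (t, (β p).2))) 0 t := by
    intro t ht
    have h1 := hβ.hasDerivAt_comp_plaque (hr (hb t ht)) (hf _ (hb t ht)).1
    rwa [(hf _ (hb t ht)).2 _ (hβ.mfderiv_plaque_mem (hr (hb t ht)))] at h1
  have := Metric.isOpen_ball.is_const_of_deriv_eq_zero (convex_ball c₁ r).isPreconnected
    (fun t ht => (hd t ht).differentiableAt.differentiableWithinAt)
    (fun t ht => (hd t ht).deriv) hpc.1 hpc'.1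
  have e : ((β p').1, (β p).2) = β p' := by rw [h]
  simp only [e, Prod.mk.eta] at this
  rwa [β.left_inv hp', β.left_inv hp] at this

/-- Near a point, a function whose differential kills `F` only depends on the plaque. -/
theorem eventually_eq_of_snd_eq (hβ : IsFoliatedChart F β) {v : M} (hv : v ∈ β.source)
    {f : M → V} (hf : ∀ᶠ p in 𝓝 v, MDifferentiableAt (𝓘(ℂ, ℂ).prod 𝓘(ℂ, E)) 𝓘(ℂ, V) f p ∧
      ∀ ζ ∈ F p, mfderiv (𝓘(ℂ, ℂ).prod 𝓘(ℂ, E)) 𝓘(ℂ, V) f p ζ = 0) :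
    ∀ᶠ z in 𝓝 (v, v), (β z.1).2 = (β z.2).2 → f z.1 = f z.2 := by
  obtain ⟨r, hr, h1, h2⟩ := β.exists_ball hv hf
  have h3 : ∀ᶠ p in 𝓝 v, p ∈ β.source ∧ β p ∈ Metric.ball (β v) r :=
    Filter.Eventually.and (β.open_source.mem_nhds hv)
      (β.continuousAt hv (Metric.ball_mem_nhds _ hr))
  rw [nhds_prod_eq]
  filter_upwards [h3.prod_mk h3] with z hz h
  exact hβ.eq_of_snd_eq h1 h2 hz.1.1 hz.2.1 hz.1.2 hz.2.2 h

/-- Two foliated charts have the same plaques near a common point. -/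
theorem eventually_snd_eq_iff (hβ : IsFoliatedChart F β) (hβ' : IsFoliatedChart F β') {v : M}
    (hv : v ∈ β.source) (hv' : v ∈ β'.source) :
    ∀ᶠ z in 𝓝 (v, v), (β z.1).2 = (β z.2).2 ↔ (β' z.1).2 = (β' z.2).2 := by
  have key : ∀ {β β' : OpenPartialHomeomorph M (ℂ × E)}, IsFoliatedChart F β →
      IsFoliatedChart F β' → v ∈ β.source → v ∈ β'.source →
      ∀ᶠ z in 𝓝 (v, v), (β z.1).2 = (β z.2).2 → (β' z.1).2 = (β' z.2).2 := by
    intro β β' hβ hβ' hv hv'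
    refine hβ.eventually_eq_of_snd_eq hv (f := fun p => (β' p).2) ?_
    filter_upwards [β'.open_source.mem_nhds hv'] with p hp
    refine ⟨(hβ'.contMDiffAt_snd hp).mdifferentiableAt (by simp), fun ζ hζ => ?_⟩
    have := hβ'.mfderiv_snd hp ζ
    rw [(hβ'.mem_iff p hp ζ).1 hζ] at this
    exact this
  filter_upwards [key hβ hβ' hv hv', key hβ' hβ hv' hv] with z h1 h2
  exact ⟨h1, h2⟩

end IsFoliatedChart

end FoliatedChart

/-! ### The leaves of a foliation near a compact transversal -/

section LeafRelation

variable {E : Type*} [NormedAddCommGroup E] [NormedSpace ℂ E]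
  {M : Type*} [TopologicalSpace M] [ChartedSpace (ModelProd ℂ E) M]

/-- An open set `carrier` on which the leaves of `F` are the classes of a closed equivalence
relation `rel`, together with finitely many foliated charts that compute it: `dom i` is a union of
leaves, on which the second coordinate of the chart `β i` separates the leaves. -/
structure LeafRelation (F : ∀ p : M, Submodule ℂ (TangentSpace (𝓘(ℂ, ℂ).prod 𝓘(ℂ, E)) p)) where
  /-- the open set that is foliated -/
  carrier : Set M
  isOpen_carrier : IsOpen carrier
  nonempty_carrier : carrier.Nonempty
  /-- the relation of lying on the same leaf -/
  rel : M → M → Prop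
  /-- the index set of the charts -/
  index : Type
  finite_index : Finite index
  /-- the foliated charts -/
  β : index → OpenPartialHomeomorph M (ℂ × E)
  foliated : ∀ i, IsFoliatedChart F (β i)
  /-- the saturated open sets on which the charts separate the leaves -/
  dom : index → Set M
  isOpen_dom : ∀ i, IsOpen (dom i)
  dom_subset_carrier : ∀ i, dom i ⊆ carrier
  dom_subset_source : ∀ i, dom i ⊆ (β i).source
  exists_mem_dom : ∀ p ∈ carrier, ∃ i, p ∈ dom i
  rel_iff : ∀ i, ∀ p ∈ dom i, ∀ q ∈ carrier, rel p q ↔ q ∈ dom i ∧ (β i p).2 = (β i q).2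
  isClosed_rel : IsClosed {z : M × M | rel z.1 z.2}
  isPreconnected_leaf : ∀ p ∈ carrier, IsPreconnected {q | q ∈ carrier ∧ rel p q}

namespace LeafRelation

variable {F : ∀ p : M, Submodule ℂ (TangentSpace (𝓘(ℂ, ℂ).prod 𝓘(ℂ, E)) p)} (D : LeafRelation F)

theorem refl {p : M} (hp : p ∈ D.carrier) : D.rel p p := by
  obtain ⟨i, hi⟩ := D.exists_mem_dom p hp
  exact (D.rel_iff i p hi p hp).2 ⟨hi, rfl⟩

theorem symm {p q : M} (hp : p ∈ D.carrier) (hq : q ∈ D.carrier) (h : D.rel p q) : D.rel q p := by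
  obtain ⟨i, hi⟩ := D.exists_mem_dom p hp
  obtain ⟨hqi, he⟩ := (D.rel_iff i p hi q hq).1 h
  exact (D.rel_iff i q hqi p hp).2 ⟨hi, he.symm⟩

theorem trans {p q r : M} (hp : p ∈ D.carrier) (hq : q ∈ D.carrier) (hr : r ∈ D.carrier)
    (h : D.rel p q) (h' : D.rel q r) : D.rel p r := by
  obtain ⟨i, hi⟩ := D.exists_mem_dom p hp
  obtain ⟨hqi, he⟩ := (D.rel_iff i p hi q hq).1 h
  obtain ⟨hri, he'⟩ := (D.rel_iff i q hqi r hr).1 h'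
  exact (D.rel_iff i p hi r hr).2 ⟨hri, he.trans he'⟩

/-- The saturation of an open set is open. -/
theorem isOpen_saturation {O : Set M} (hO : IsOpen O) (hOc : O ⊆ D.carrier) :
    IsOpen {q | q ∈ D.carrier ∧ ∃ p ∈ O, D.rel p q} := by
  have : {q | q ∈ D.carrier ∧ ∃ p ∈ O, D.rel p q} = ⋃ i, (D.dom i ∩ ((fun q => (D.β i q).2) ⁻¹'
      ((fun p => (D.β i p).2) '' (O ∩ D.dom i)))) := by
    ext q
    simp only [Set.mem_ofPred_eq, Set.mem_iUnion, Set.mem_inter_iff, Set.mem_preimage, Set.mem_image]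
    constructor
    · rintro ⟨hq, p, hp, hpq⟩
      obtain ⟨i, hi⟩ := D.exists_mem_dom p (hOc hp)
      obtain ⟨hqi, he⟩ := (D.rel_iff i p hi q hq).1 hpq
      exact ⟨i, hqi, p, ⟨hp, hi⟩, he⟩
    · rintro ⟨i, hq, p, ⟨hp, hpi⟩, he⟩
      have hqc := D.dom_subset_carrier i hq
      exact ⟨hqc, p, hp, (D.rel_iff i p hpi q hqc).2 ⟨hq, he⟩⟩
  rw [this]
  refine isOpen_iUnion fun i => ?_
  have hc : ContinuousOn (fun q => (D.β i q).2) (D.dom i) :=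
    continuous_snd.comp_continuousOn ((D.β i).continuousOn.mono (D.dom_subset_source i))
  exact hc.isOpen_inter_preimage (D.isOpen_dom i) ((D.β i).isOpen_image_snd
    (hO.inter (D.isOpen_dom i)) (Set.inter_subset_right.trans (D.dom_subset_source i)))

end LeafRelation

/-- If a closed relation only relates a point of a compact set `K` to itself, then near `K` it
only relates points that are close to each other. -/
theorem IsCompact.exists_open_rel_subset {M : Type*} [TopologicalSpace M] {K : Set M}
    (hK : IsCompact K) {R : Set (M × M)} (hR : IsClosed R)
    (hRK : ∀ p ∈ K, ∀ q ∈ K, (p, q) ∈ R → p = q) {P : M × M → Prop}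
    (hP : ∀ w ∈ K, ∀ᶠ z in 𝓝 (w, w), P z) :
    ∃ U, IsOpen U ∧ K ⊆ U ∧ ∀ p ∈ U, ∀ q ∈ U, (p, q) ∈ R → P (p, q) := by
  have hsub : K ×ˢ K ⊆ interior {z | P z} ∪ Rᶜ := by
    rintro ⟨p, q⟩ ⟨hp, hq⟩
    by_cases h : (p, q) ∈ R
    · left
      have := hRK p hp q hq h
      subst this
      exact mem_interior_iff_mem_nhds.2 (hP p hp)
    · exact Or.inr h
  obtain ⟨u, v, hu, hv, hKu, hKv, huv⟩ :=
    generalized_tube_lemma hK hK (isOpen_interior.union hR.isOpen_compl) hsub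
  refine ⟨u ∩ v, hu.inter hv, Set.subset_inter hKu hKv, fun p hp q hq h => ?_⟩
  rcases huv (Set.mk_mem_prod hp.1 hq.2) with h' | h'
  · exact interior_subset h'
  · exact absurd h h'

variable {F : ∀ p : M, Submodule ℂ (TangentSpace (𝓘(ℂ, ℂ).prod 𝓘(ℂ, E)) p)}

/-- Near a compact set which is transverse to `F` (in the sense that foliated charts separate its
points locally), there is a closed relation between points, given by finitely many foliated
charts, which locally is the relation of lying on the same plaque. -/
theorem exists_plaque_relation [T2Space M] [LocallyCompactSpace M] {K : Set M} (hK : IsCompact K)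
    (hKne : K.Nonempty)
    (hKF : ∀ w ∈ K, ∃ β, IsFoliatedChart F β ∧ w ∈ β.source ∧
      Set.InjOn (fun p => (β p).2) (K ∩ β.source)) :
    ∃ (n : ℕ) (β : Fin n → OpenPartialHomeomorph M (ℂ × E)) (C C' : Fin n → Set M)
      (R : M → M → Prop) (U : Set M), IsOpen U ∧ K ⊆ U ∧ (∀ i, IsFoliatedChart F (β i)) ∧
      (∀ i, C i ⊆ C' i) ∧ (∀ i, IsOpen (C' i)) ∧ (∀ i, IsOpen (C i)) ∧
      (∀ i, C' i ⊆ (β i).source) ∧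
      (U ⊆ ⋃ i, C i) ∧ IsClosed {z : M × M | R z.1 z.2} ∧ (∀ p ∈ K, ∀ q ∈ K, R p q → p = q) ∧
      (∀ p q, R p q → R q p) ∧
      (∀ i, ∀ p ∈ C' i, ∀ q ∈ C' i, (β i p).2 = (β i q).2 → R p q) ∧
      ∀ i, ∀ p ∈ U, ∀ q ∈ U, p ∈ C i → (R p q ↔ q ∈ C' i ∧ (β i p).2 = (β i q).2) := by
  have : Nonempty (OpenPartialHomeomorph M (ℂ × E)) :=
    ⟨(hKF _ hKne.some_mem).choose⟩
  choose! β hβ hwβ hinj using hKF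
  have h1 : ∀ w ∈ K, ∃ C', IsCompact C' ∧ w ∈ interior C' ∧ C' ⊆ (β w).source := fun w hw =>
    exists_compact_subset (β w).open_source (hwβ w hw)
  choose! C' hC' hwC' hC's using h1
  have h2 : ∀ w ∈ K, ∃ C, IsCompact C ∧ w ∈ interior C ∧ C ⊆ interior (C' w) := fun w hw =>
    exists_compact_subset isOpen_interior (hwC' w hw)
  choose! C hC hwC hCs using h2
  obtain ⟨t, htK, htc⟩ := hK.elim_nhds_subcover (fun w => interior (C w))
    (fun w hw => isOpen_interior.mem_nhds (hwC w hw))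
  let σ : Fin t.card → M := fun i => (t.equivFin.symm i : M)
  have hσ : ∀ i, σ i ∈ K := fun i => htK _ (t.equivFin.symm i).2
  have hσs : ∀ w ∈ t, ∃ i, σ i = w := fun w hw => ⟨t.equivFin ⟨w, hw⟩, by simp [σ]⟩
  let R : M → M → Prop := fun p q => ∃ i, p ∈ C' (σ i) ∧ q ∈ C' (σ i) ∧
    (β (σ i) p).2 = (β (σ i) q).2
  have hRc : IsClosed {z : M × M | R z.1 z.2} := by
    have : {z : M × M | R z.1 z.2} = ⋃ i, ((C' (σ i) ×ˢ C' (σ i)) ∩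
        (fun z : M × M => ((β (σ i) z.1).2, (β (σ i) z.2).2)) ⁻¹' Set.diagonal E) := by
      ext z
      simp only [R, Set.mem_ofPred_eq, Set.mem_iUnion, Set.mem_inter_iff, Set.mem_prod,
        Set.mem_preimage, Set.mem_diagonal_iff, and_assoc]
    rw [this]
    refine isClosed_iUnion_of_finite fun i => ?_
    have hc : ContinuousOn (fun q => (β (σ i) q).2) (C' (σ i)) :=
      continuous_snd.comp_continuousOn ((β (σ i)).continuousOn.mono (hC's _ (hσ i)))
    have hcl : IsClosed (C' (σ i)) := (hC' _ (hσ i)).isClosed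
    refine ContinuousOn.preimage_isClosed_of_isClosed ?_ (hcl.prod hcl) isClosed_diagonal
    exact (hc.comp continuousOn_fst fun z hz => hz.1).prodMk
      (hc.comp continuousOn_snd fun z hz => hz.2)
  have hRK : ∀ p ∈ K, ∀ q ∈ K, R p q → p = q := by
    rintro p hp q hq ⟨i, hpi, hqi, he⟩
    exact hinj _ (hσ i) ⟨hp, hC's _ (hσ i) hpi⟩ ⟨hq, hC's _ (hσ i) hqi⟩ he
  have hloc : ∀ w ∈ K, ∀ᶠ z in 𝓝 (w, w), ∀ i j, z.1 ∈ C (σ i) → z.2 ∈ interior (C' (σ i)) ∧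
      (z.1 ∈ C' (σ j) → z.2 ∈ C' (σ j) →
        ((β (σ i) z.1).2 = (β (σ i) z.2).2 ↔ (β (σ j) z.1).2 = (β (σ j) z.2).2)) := by
    intro w _
    refine Filter.eventually_all.2 fun i => Filter.eventually_all.2 fun j => ?_
    have hfst : Filter.Tendsto Prod.fst (𝓝 (w, w)) (𝓝 w) := continuous_fst.tendsto (w, w)
    have hsnd : Filter.Tendsto Prod.snd (𝓝 (w, w)) (𝓝 w) := continuous_snd.tendsto (w, w)
    by_cases hwi : w ∈ C (σ i)
    · have hwi' := hCs _ (hσ i) hwi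
      have a1 : ∀ᶠ z in 𝓝 (w, w), z.2 ∈ interior (C' (σ i)) :=
        hsnd.eventually (isOpen_interior.mem_nhds hwi')
      by_cases hwj : w ∈ C' (σ j)
      · filter_upwards [a1, (hβ _ (hσ i)).eventually_snd_eq_iff (hβ _ (hσ j))
          (hC's _ (hσ i) (interior_subset hwi')) (hC's _ (hσ j) hwj)] with z hz1 hz2 _
        exact ⟨hz1, fun _ _ => hz2⟩
      · have a2 : ∀ᶠ z in 𝓝 (w, w), z.1 ∉ C' (σ j) :=
          hfst.eventually ((hC' _ (hσ j)).isClosed.isOpen_compl.mem_nhds hwj)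
        filter_upwards [a1, a2] with z hz1 hz2 _
        exact ⟨hz1, fun h => absurd h hz2⟩
    · have a2 : ∀ᶠ z in 𝓝 (w, w), z.1 ∉ C (σ i) :=
        hfst.eventually ((hC _ (hσ i)).isClosed.isOpen_compl.mem_nhds hwi)
      filter_upwards [a2] with z hz h
      exact absurd h hz
  obtain ⟨U, hU, hKU, hUR⟩ := hK.exists_open_rel_subset hRc hRK hloc
  refine ⟨t.card, fun i => β (σ i), fun i => interior (C (σ i)), fun i => interior (C' (σ i)), R,
    U ∩ ⋃ i, interior (C (σ i)), hU.inter (isOpen_iUnion fun i => isOpen_interior), ?_,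
    fun i => hβ _ (hσ i), fun i => interior_subset.trans (hCs _ (hσ i)),
    fun i => isOpen_interior, fun i => isOpen_interior,
    fun i => interior_subset.trans (hC's _ (hσ i)), Set.inter_subset_right, hRc, hRK,
    fun p q ⟨i, hp, hq, he⟩ => ⟨i, hq, hp, he.symm⟩,
    fun i p hp q hq he => ⟨i, interior_subset hp, interior_subset hq, he⟩, ?_⟩
  · refine Set.subset_inter hKU fun w hw => ?_
    obtain ⟨x, hx, hwx⟩ := Set.mem_iUnion₂.1 (htc hw)
    obtain ⟨i, rfl⟩ := hσs x hx
    exact Set.mem_iUnion.2 ⟨i, hwx⟩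
  · intro i p hp q hq hpi
    have hpi' : p ∈ C (σ i) := interior_subset hpi
    constructor
    · intro hR
      have h := hUR p hp.1 q hq.1 hR
      refine ⟨(h i i hpi').1, ?_⟩
      obtain ⟨j, hpj, hqj, he⟩ := hR
      exact ((h i j hpi').2 hpj hqj).2 he
    · rintro ⟨hqi, he⟩
      exact ⟨i, interior_subset (hCs _ (hσ i) hpi'), interior_subset hqi, he⟩

/-- A compact set `K` which is transverse to `F` has a neighbourhood in which the leaves of `F` are
the classes of a closed equivalence relation. Moreover each leaf meets an open neighbourhood `A` of `K`, which may be taken from any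
given basis of neighbourhoods of `K`. -/
theorem exists_leafRelation [T2Space M] [LocallyCompactSpace M] {K : Set M} (hK : IsCompact K)
    (hKne : K.Nonempty)
    (hKF : ∀ w ∈ K, ∃ β, IsFoliatedChart F β ∧ w ∈ β.source ∧
      Set.InjOn (fun p => (β p).2) (K ∩ β.source)) {P : Set M → Prop}
    (hP : ∀ U, IsOpen U → K ⊆ U → ∃ A, P A ∧ IsOpen A ∧ K ⊆ A ∧ A ⊆ U) :
    ∃ (D : LeafRelation F) (A : Set M), P A ∧ IsOpen A ∧ K ⊆ A ∧ A ⊆ D.carrier ∧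
      (∀ p ∈ D.carrier, ∃ a ∈ A, D.rel p a) ∧ ∀ p ∈ K, ∀ q ∈ K, D.rel p q → p = q := by
  obtain ⟨n, β, C, C', R, U, hU, hKU, hβ, hCC', hC'o, hCo, hC's, hUC, hRc, hRK, Rsymm, hR', hR⟩ :=
    exists_plaque_relation hK hKne hKF
  have Rtrans : ∀ {p q r}, p ∈ U → q ∈ U → r ∈ U → R p q → R q r → R p r := by
    intro p q r hp hq hr h h'
    obtain ⟨i, hi⟩ := Set.mem_iUnion.1 (hUC hq)
    obtain ⟨hpi, he⟩ := (hR i q hq p hp hi).1 (Rsymm _ _ h)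
    obtain ⟨hri, he'⟩ := (hR i q hq r hr hi).1 h'
    exact hR' i p hpi r hri (he.symm.trans he')
  -- small boxes `Q w` around the points of `K`
  have hbox : ∀ w : K, ∃ (i : Fin n) (r : ℝ), 0 < r ∧ (w : M) ∈ (β i).source ∧
      Metric.ball (β i w) r ⊆ (β i).target ∧
      ∀ q ∈ Metric.ball (β i w) r, (β i).symm q ∈ U ∩ C i := by
    intro w
    obtain ⟨i, hi⟩ := Set.mem_iUnion.1 (hUC (hKU w.2))
    have hs := hC's i (hCC' i hi)
    obtain ⟨r, hr, h1, h2⟩ := (β i).exists_ball hs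
      ((hU.inter (hCo i)).mem_nhds ⟨hKU w.2, hi⟩)
    exact ⟨i, r, hr, hs, h1, h2⟩
  choose i r hr hws hrt hrU using hbox
  let Q : K → Set M := fun w => (β (i w)).source ∩ β (i w) ⁻¹' Metric.ball (β (i w) w) (r w)
  have hQo : ∀ w, IsOpen (Q w) := fun w => (β (i w)).isOpen_inter_preimage Metric.isOpen_ball
  have hwQ : ∀ w : K, (w : M) ∈ Q w := fun w => ⟨hws w, Metric.mem_ball_self (hr w)⟩
  have hQU : ∀ w, ∀ p ∈ Q w, p ∈ U ∧ p ∈ C (i w) := by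
    intro w p hp
    have := hrU w _ hp.2
    rwa [(β (i w)).left_inv hp.1] at this
  have hplaque : ∀ w, ∀ p ∈ Q w,
      IsPreconnected {q | q ∈ Q w ∧ (β (i w) p).2 = (β (i w) q).2} := by
    intro w p hp
    have he : {q | q ∈ Q w ∧ (β (i w) p).2 = (β (i w) q).2} = (fun t => (β (i w)).symm
        (t, (β (i w) p).2)) '' Metric.ball (β (i w) w).1 (r w) := by
      have hmem : ∀ t, t ∈ Metric.ball (β (i w) w).1 (r w) →
          (t, (β (i w) p).2) ∈ Metric.ball (β (i w) w) (r w) := by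
        intro t ht
        have := hp.2
        rw [Set.mem_preimage, Metric.mem_ball, Prod.dist_eq, max_lt_iff] at this
        rw [Metric.mem_ball, Prod.dist_eq, max_lt_iff]
        exact ⟨ht, this.2⟩
      ext q
      constructor
      · rintro ⟨hq, he⟩
        have := hq.2
        rw [Set.mem_preimage, Metric.mem_ball, Prod.dist_eq, max_lt_iff] at this
        refine ⟨(β (i w) q).1, this.1, ?_⟩
        simp only [he, Prod.mk.eta]
        exact (β (i w)).left_inv hq.1
      · rintro ⟨t, ht, rfl⟩
        have h1 := hmem t ht
        have h2 := hrt w h1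
        have h3 := (β (i w)).right_inv h2
        refine ⟨⟨(β (i w)).map_target h2, ?_⟩, ?_⟩
        · rw [Set.mem_preimage, h3]; exact h1
        · rw [h3]
    rw [he]
    refine (convex_ball _ _).isPreconnected.image _ ?_
    intro t ht
    have h1 : (t, (β (i w) p).2) ∈ (β (i w)).target := by
      refine hrt w ?_
      have := hp.2
      rw [Set.mem_preimage, Metric.mem_ball, Prod.dist_eq, max_lt_iff] at this
      rw [Metric.mem_ball, Prod.dist_eq, max_lt_iff]
      exact ⟨ht, this.2⟩
    have h2 := (β (i w)).continuousAt_symm h1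
    exact (ContinuousAt.comp (g := (β (i w)).symm) (f := fun t : ℂ => (t, (β (i w) p).2)) h2
      (by fun_prop)).continuousWithinAt
  -- an anchoring neighbourhood `A` of `K`, small with respect to the boxes
  obtain ⟨U₁, hU₁, hKU₁, hU₁R⟩ := hK.exists_open_rel_subset hRc hRK
    (P := fun z => ∃ w, z.1 ∈ Q w ∧ z.2 ∈ Q w) (fun w hw => by
      filter_upwards [((hQo ⟨w, hw⟩).prod (hQo ⟨w, hw⟩)).mem_nhds
        (Set.mk_mem_prod (hwQ ⟨w, hw⟩) (hwQ ⟨w, hw⟩))] with z hz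
      exact ⟨⟨w, hw⟩, hz.1, hz.2⟩)
  obtain ⟨A, hPA, hAo, hKA, hAU⟩ := hP (U₁ ∩ ⋃ w, Q w) (hU₁.inter (isOpen_iUnion hQo))
    (Set.subset_inter hKU₁ fun w hw => Set.mem_iUnion.2 ⟨⟨w, hw⟩, hwQ ⟨w, hw⟩⟩)
  let N : Set M := ⋃ w, (Q w ∩ ((fun p => (β (i w) p).2) ⁻¹'
    ((fun p => (β (i w) p).2) '' (A ∩ Q w))))
  have hNo : IsOpen N := by
    refine isOpen_iUnion fun w => ?_
    have hc : ContinuousOn (fun q => (β (i w) q).2) (Q w) :=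
      continuous_snd.comp_continuousOn ((β (i w)).continuousOn.mono Set.inter_subset_left)
    exact hc.isOpen_inter_preimage (hQo w) ((β (i w)).isOpen_image_snd (hAo.inter (hQo w))
      (Set.inter_subset_right.trans Set.inter_subset_left))
  have hNU : N ⊆ U := by
    intro p hp
    obtain ⟨w, hw⟩ := Set.mem_iUnion.1 hp
    exact (hQU w p hw.1).1
  have hAN : A ⊆ N := by
    intro a ha
    obtain ⟨w, hw⟩ := Set.mem_iUnion.1 (hAU ha).2
    exact Set.mem_iUnion.2 ⟨w, hw, a, ⟨ha, hw⟩, rfl⟩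
  -- every point of `N` lies on the plaque of a point of `A`
  have hanchor : ∀ p ∈ N, ∃ w, ∃ a ∈ A, a ∈ Q w ∧ p ∈ Q w ∧ (β (i w) a).2 = (β (i w) p).2 := by
    intro p hp
    obtain ⟨w, hp, a, ⟨ha, haQ⟩, he⟩ := Set.mem_iUnion.1 hp
    exact ⟨w, a, ha, haQ, hp, he⟩
  have hQR : ∀ w, ∀ p ∈ Q w, ∀ q ∈ Q w, (β (i w) p).2 = (β (i w) q).2 → R p q := fun w p hp q hq =>
    hR' (i w) p (hCC' _ (hQU w p hp).2) q (hCC' _ (hQU w q hq).2)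
  have hsub : ∀ w, ∀ a ∈ A, a ∈ Q w → {q | q ∈ Q w ∧ (β (i w) a).2 = (β (i w) q).2} ⊆ N := by
    rintro w a ha haw q ⟨hq, he⟩
    exact Set.mem_iUnion.2 ⟨w, hq, a, ⟨ha, haw⟩, he⟩
  have hsat : ∀ i, IsOpen {q | q ∈ N ∧ ∃ p ∈ N ∩ C i, R p q} := by
    intro k
    rw [isOpen_iff_mem_nhds]
    rintro q ⟨hq, p, ⟨hp, hpk⟩, hpq⟩
    obtain ⟨j, hj⟩ := Set.mem_iUnion.1 (hUC (hNU hq))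
    obtain ⟨hpj, he⟩ := (hR j q (hNU hq) p (hNU hp) hj).1 (Rsymm _ _ hpq)
    have ho : IsOpen ((fun p => (β j p).2) '' ((N ∩ C k) ∩ C' j)) :=
      (β j).isOpen_image_snd ((hNo.inter (hCo k)).inter (hC'o j))
        (Set.inter_subset_right.trans (hC's j))
    have hc : ContinuousAt (fun q => (β j q).2) q :=
      continuous_snd.continuousAt.comp ((β j).continuousAt (hC's j (hCC' j hj)))
    filter_upwards [hNo.mem_nhds hq, (hCo j).mem_nhds hj,
      hc (ho.mem_nhds ⟨p, ⟨⟨hp, hpk⟩, hpj⟩, he.symm⟩)] with x hxN hxj hx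
    obtain ⟨y, ⟨hyN, hyj⟩, hye⟩ := hx
    exact ⟨hxN, y, hyN, hR' j y hyj x (hCC' j hxj) hye⟩
  let D : LeafRelation F :=
    { carrier := N
      isOpen_carrier := hNo
      nonempty_carrier := hKne.mono (hKA.trans hAN)
      rel := R
      index := Fin n
      finite_index := inferInstance
      β := β
      foliated := hβ
      dom := fun i => {q | q ∈ N ∧ ∃ p ∈ N ∩ C i, R p q}
      isOpen_dom := hsat
      dom_subset_carrier := fun i q hq => hq.1
      dom_subset_source := by
        rintro i q ⟨hq, p, ⟨hp, hpi⟩, hpq⟩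
        exact hC's i ((hR i p (hNU hp) q (hNU hq) hpi).1 hpq).1
      exists_mem_dom := by
        intro p hp
        obtain ⟨i, hi⟩ := Set.mem_iUnion.1 (hUC (hNU hp))
        exact ⟨i, hp, p, ⟨hp, hi⟩, hR' i p (hCC' i hi) p (hCC' i hi) rfl⟩
      rel_iff := by
        rintro i p ⟨hp, x, ⟨hx, hxi⟩, hxp⟩ q hq
        have e1 := ((hR i x (hNU hx) p (hNU hp) hxi).1 hxp).2
        constructor
        · intro h
          have hxq := Rtrans (hNU hx) (hNU hp) (hNU hq) hxp h
          exact ⟨⟨hq, x, ⟨hx, hxi⟩, hxq⟩,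
            e1.symm.trans ((hR i x (hNU hx) q (hNU hq) hxi).1 hxq).2⟩
        · rintro ⟨⟨-, y, ⟨hy, hyi⟩, hyq⟩, he⟩
          have e2 := ((hR i y (hNU hy) q (hNU hq) hyi).1 hyq).2
          have hxy : R x y := hR' i x (hCC' i hxi) y (hCC' i hyi) (e1.trans (he.trans e2.symm))
          exact Rtrans (hNU hp) (hNU hx) (hNU hq) (Rsymm _ _ hxp)
            (Rtrans (hNU hx) (hNU hy) (hNU hq) hxy hyq)
      isClosed_rel := hRc
      isPreconnected_leaf := by
        intro p hp
        refine isPreconnected_of_forall p ?_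
        rintro q ⟨hq, hpq⟩
        obtain ⟨w, a, ha, haw, hpw, he⟩ := hanchor p hp
        obtain ⟨w', a', ha', haw', hqw', he'⟩ := hanchor q hq
        have hap := hQR w a haw p hpw he
        have ha'q := hQR w' a' haw' q hqw' he'
        have haq := Rtrans (hNU (hAN ha)) (hNU hp) (hNU hq) hap hpq
        have haa' := Rtrans (hNU (hAN ha)) (hNU hq) (hNU (hAN ha')) haq (Rsymm _ _ ha'q)
        obtain ⟨k, hak, hak'⟩ := hU₁R a (hAU ha).1 a' (hAU ha').1 haa'
        have hek := ((hR (i k) a (hNU (hAN ha)) a' (hNU (hAN ha')) (hQU k a hak).2).1 haa').2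
        -- the plaques through `a` and `a'` are linked by the plaque of the box `Q k`
        refine ⟨({x | x ∈ Q w ∧ (β (i w) a).2 = (β (i w) x).2} ∪
          {x | x ∈ Q k ∧ (β (i k) a).2 = (β (i k) x).2}) ∪
          {x | x ∈ Q w' ∧ (β (i w') a').2 = (β (i w') x).2}, ?_, Or.inl (Or.inl ⟨hpw, he⟩),
          Or.inr ⟨hqw', he'⟩, ?_⟩
        · rintro x ((hx | hx) | hx)
          · have hxN := hsub w a ha haw hx
            exact ⟨hxN, Rtrans (hNU hp) (hNU (hAN ha)) (hNU hxN) (Rsymm _ _ hap)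
              (hQR w a haw x hx.1 hx.2)⟩
          · have hxN := hsub k a ha hak hx
            exact ⟨hxN, Rtrans (hNU hp) (hNU (hAN ha)) (hNU hxN) (Rsymm _ _ hap)
              (hQR k a hak x hx.1 hx.2)⟩
          · have hxN := hsub w' a' ha' haw' hx
            exact ⟨hxN, Rtrans (hNU hp) (hNU hq) (hNU hxN) hpq (Rtrans (hNU hq) (hNU (hAN ha'))
              (hNU hxN) (Rsymm _ _ ha'q) (hQR w' a' haw' x hx.1 hx.2))⟩
        · refine IsPreconnected.union a' (Or.inr ⟨hak', hek⟩) ⟨haw', rfl⟩ ?_ (hplaque w' a' haw')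
          exact IsPreconnected.union a ⟨haw, rfl⟩ ⟨hak, rfl⟩ (hplaque w a haw) (hplaque k a hak) }
  refine ⟨D, A, hPA, hAo, hKA, hAN, fun p hp => ?_, hRK⟩
  obtain ⟨w, a, ha, haw, hpw, he⟩ := hanchor p hp
  exact ⟨a, ha, hQR w p hpw a haw he.symm⟩

end LeafRelation

/-! ### The leaf space as a complex manifold -/

section LeafSpace

variable {E : Type*} [NormedAddCommGroup E] [NormedSpace ℂ E]
  {M : Type*} [TopologicalSpace M] [ChartedSpace (ModelProd ℂ E) M]
  {F : ∀ p : M, Submodule ℂ (TangentSpace (𝓘(ℂ, ℂ).prod 𝓘(ℂ, E)) p)}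

namespace LeafRelation

variable (D : LeafRelation F)

/-- The relation of lying on the same leaf, as an equivalence relation. -/
def setoid : Setoid D.carrier where
  r p q := D.rel p q
  iseqv := ⟨fun p => D.refl p.2, fun {p q} h => D.symm p.2 q.2 h,
    fun {p q r} h h' => D.trans p.2 q.2 r.2 h h'⟩

/-- The space of leaves. -/
def LeafSpace : Type _ := Quotient D.setoid

instance : TopologicalSpace D.LeafSpace := inferInstanceAs (TopologicalSpace (Quotient D.setoid))

open Classical in
/-- The projection onto the space of leaves (with a junk value off the open set `D.carrier`). -/
def proj (p : M) : D.LeafSpace :=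
  if h : p ∈ D.carrier then Quotient.mk D.setoid ⟨p, h⟩
  else Quotient.mk D.setoid ⟨_, D.nonempty_carrier.some_mem⟩

theorem proj_of_mem {p : M} (hp : p ∈ D.carrier) : D.proj p = Quotient.mk D.setoid ⟨p, hp⟩ :=
  dif_pos hp

theorem proj_eq_proj_iff {p q : M} (hp : p ∈ D.carrier) (hq : q ∈ D.carrier) :
    D.proj p = D.proj q ↔ D.rel p q := by
  rw [D.proj_of_mem hp, D.proj_of_mem hq]
  exact Quotient.eq (r := D.setoid)

theorem exists_proj_eq (z : D.LeafSpace) : ∃ p ∈ D.carrier, D.proj p = z := by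
  obtain ⟨⟨p, hp⟩, rfl⟩ := Quotient.exists_rep z
  exact ⟨p, hp, D.proj_of_mem hp⟩

theorem isOpen_iff_preimage {O : Set D.LeafSpace} :
    IsOpen O ↔ IsOpen (D.carrier ∩ D.proj ⁻¹' O) := by
  have h : IsOpen O ↔ IsOpen ((fun p : D.carrier => D.proj p) ⁻¹' O) := by
    have he : (fun p : D.carrier => D.proj p) = Quotient.mk D.setoid := by
      ext p; exact D.proj_of_mem p.2
    rw [he]
    exact (isQuotientMap_quotient_mk' (s := D.setoid)).isOpen_preimage.symm
  rw [h]
  constructor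
  · intro ho
    have := D.isOpen_carrier.isOpenMap_subtype_val _ ho
    convert this using 1
    ext p
    simp
    tauto
  · intro ho
    convert ho.preimage continuous_subtype_val using 1
    ext p
    simp

theorem continuousOn_proj : ContinuousOn D.proj D.carrier :=
  (continuousOn_open_iff D.isOpen_carrier).2 fun _ hO => D.isOpen_iff_preimage.1 hO

theorem continuousAt_proj {p : M} (hp : p ∈ D.carrier) : ContinuousAt D.proj p :=
  D.continuousOn_proj.continuousAt (D.isOpen_carrier.mem_nhds hp)

theorem isOpen_image_proj {O : Set M} (hO : IsOpen O) (hOc : O ⊆ D.carrier) :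
    IsOpen (D.proj '' O) := by
  rw [D.isOpen_iff_preimage]
  convert D.isOpen_saturation hO hOc using 1
  ext q
  simp only [Set.mem_inter_iff, Set.mem_preimage, Set.mem_image, Set.mem_ofPred_eq]
  refine and_congr_right fun hq => exists_congr fun p => and_congr_right fun hp => ?_
  exact D.proj_eq_proj_iff (hOc hp) hq

theorem image_proj_mem_nhds {p : M} (hp : p ∈ D.carrier) {O : Set M} (hO : O ∈ 𝓝 p) :
    D.proj '' O ∈ 𝓝 (D.proj p) := by
  obtain ⟨O', hO', ho, hpO'⟩ := mem_nhds_iff.1 (Filter.inter_mem hO (D.isOpen_carrier.mem_nhds hp))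
  exact Filter.mem_of_superset
    ((D.isOpen_image_proj ho (hO'.trans Set.inter_subset_right)).mem_nhds ⟨p, hpO', rfl⟩)
    (Set.image_mono (hO'.trans Set.inter_subset_left))

instance : T2Space D.LeafSpace := by
  refine ⟨fun z w hzw => ?_⟩
  obtain ⟨p, hp, rfl⟩ := D.exists_proj_eq z
  obtain ⟨q, hq, rfl⟩ := D.exists_proj_eq w
  have hn : (p, q) ∈ {z : M × M | D.rel z.1 z.2}ᶜ := fun h => hzw ((D.proj_eq_proj_iff hp hq).2 h)
  have hnhds := D.isClosed_rel.isOpen_compl.mem_nhds hn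
  rw [mem_nhds_prod_iff'] at hnhds
  obtain ⟨u, v, hu, hpu, hv, hqv, huv⟩ := hnhds
  refine ⟨D.proj '' (u ∩ D.carrier), D.proj '' (v ∩ D.carrier),
    D.isOpen_image_proj (hu.inter D.isOpen_carrier) Set.inter_subset_right,
    D.isOpen_image_proj (hv.inter D.isOpen_carrier) Set.inter_subset_right,
    ⟨p, ⟨hpu, hp⟩, rfl⟩, ⟨q, ⟨hqv, hq⟩, rfl⟩, ?_⟩
  rw [Set.disjoint_left]
  rintro _ ⟨x, hx, rfl⟩ ⟨y, hy, hxy⟩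
  exact huv (Set.mk_mem_prod hx.1 hy.1) ((D.proj_eq_proj_iff hx.2 hy.2).1 hxy.symm)

/-- A representative of a leaf. -/
def rep (z : D.LeafSpace) : M := (D.exists_proj_eq z).choose

theorem rep_mem (z : D.LeafSpace) : D.rep z ∈ D.carrier := (D.exists_proj_eq z).choose_spec.1

theorem proj_rep (z : D.LeafSpace) : D.proj (D.rep z) = z := (D.exists_proj_eq z).choose_spec.2

theorem proj_mem_image_dom_iff {i : D.index} {p : M} (hp : p ∈ D.carrier) :
    D.proj p ∈ D.proj '' D.dom i ↔ p ∈ D.dom i := by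
  constructor
  · rintro ⟨q, hq, he⟩
    have hqc := D.dom_subset_carrier i hq
    exact ((D.rel_iff i q hq p hp).1 ((D.proj_eq_proj_iff hqc hp).1 he)).1
  · exact fun h => ⟨p, h, rfl⟩

/-- The function on the space of leaves induced by the second coordinate of a foliated chart. -/
def chartFun (i : D.index) (z : D.LeafSpace) : E := (D.β i (D.rep z)).2

theorem chartFun_proj {i : D.index} {p : M} (hp : p ∈ D.dom i) :
    D.chartFun i (D.proj p) = (D.β i p).2 := by
  have hpc := D.dom_subset_carrier i hp
  have h := (D.proj_eq_proj_iff hpc (D.rep_mem (D.proj p))).1 (D.proj_rep _).symm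
  exact ((D.rel_iff i p hp _ (D.rep_mem _)).1 h).2.symm

theorem injOn_chartFun (i : D.index) : Set.InjOn (D.chartFun i) (D.proj '' D.dom i) := by
  rintro _ ⟨p, hp, rfl⟩ _ ⟨q, hq, rfl⟩ h
  rw [D.chartFun_proj hp, D.chartFun_proj hq] at h
  have hpc := D.dom_subset_carrier i hp
  have hqc := D.dom_subset_carrier i hq
  exact (D.proj_eq_proj_iff hpc hqc).2 ((D.rel_iff i p hp q hqc).2 ⟨hq, h⟩)

theorem continuousOn_snd (i : D.index) : ContinuousOn (fun p => (D.β i p).2) (D.dom i) :=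
  continuous_snd.comp_continuousOn ((D.β i).continuousOn.mono (D.dom_subset_source i))

theorem continuousOn_chartFun (i : D.index) :
    ContinuousOn (D.chartFun i) (D.proj '' D.dom i) := by
  rintro _ ⟨p, hp, rfl⟩
  refine ContinuousAt.continuousWithinAt fun O hO => ?_
  rw [D.chartFun_proj hp] at hO
  have h1 : D.dom i ∩ (fun p => (D.β i p).2) ⁻¹' O ∈ 𝓝 p :=
    Filter.inter_mem ((D.isOpen_dom i).mem_nhds hp)
      ((D.continuousOn_snd i).continuousAt ((D.isOpen_dom i).mem_nhds hp) hO)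
  refine Filter.mem_map.2
    (Filter.mem_of_superset (D.image_proj_mem_nhds (D.dom_subset_carrier i hp) h1) ?_)
  rintro _ ⟨q, ⟨hq, hqO⟩, rfl⟩
  rw [Set.mem_preimage, D.chartFun_proj hq]
  exact hqO

theorem isOpen_image_chartFun (i : D.index) {O : Set D.LeafSpace} (hO : IsOpen O)
    (hOi : O ⊆ D.proj '' D.dom i) : IsOpen (D.chartFun i '' O) := by
  have h := (D.β i).isOpen_image_snd (((D.isOpen_iff_preimage.1 hO)).inter (D.isOpen_dom i))
    (Set.inter_subset_right.trans (D.dom_subset_source i))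
  convert h using 1
  ext e
  constructor
  · rintro ⟨z, hz, rfl⟩
    obtain ⟨p, hp, rfl⟩ := hOi hz
    exact ⟨p, ⟨⟨D.dom_subset_carrier i hp, hz⟩, hp⟩, (D.chartFun_proj hp).symm⟩
  · rintro ⟨p, ⟨⟨-, hpO⟩, hp⟩, rfl⟩
    exact ⟨_, hpO, D.chartFun_proj hp⟩

theorem isOpenMap_domRestrict_chartFun (i : D.index) :
    IsOpenMap ((D.proj '' D.dom i).domRestrict (D.chartFun i)) := by
  intro O hO
  have h1 : IsOpen (D.proj '' D.dom i) :=
    D.isOpen_image_proj (D.isOpen_dom i) (D.dom_subset_carrier i)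
  have h := D.isOpen_image_chartFun i (h1.isOpenMap_subtype_val O hO) (by
    rintro _ ⟨z, -, rfl⟩; exact z.2)
  rwa [Set.image_image] at h

/-- The coordinate system on the space of leaves given by a foliated chart. -/
def leafChart (i : D.index) : OpenPartialHomeomorph D.LeafSpace E :=
  have : Nonempty D.LeafSpace := ⟨D.proj D.nonempty_carrier.some⟩
  OpenPartialHomeomorph.ofContinuousOpenRestrict
    (Set.InjOn.toPartialEquiv (D.chartFun i) (D.proj '' D.dom i) (D.injOn_chartFun i))
    (D.continuousOn_chartFun i)
    (D.isOpenMap_domRestrict_chartFun i)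
    (D.isOpen_image_proj (D.isOpen_dom i) (D.dom_subset_carrier i))

theorem leafChart_source (i : D.index) : (D.leafChart i).source = D.proj '' D.dom i := rfl

theorem leafChart_proj {i : D.index} {p : M} (hp : p ∈ D.dom i) :
    D.leafChart i (D.proj p) = (D.β i p).2 := D.chartFun_proj hp

theorem exists_mem_leafChart_source (z : D.LeafSpace) : ∃ i, z ∈ (D.leafChart i).source := by
  obtain ⟨p, hp, rfl⟩ := D.exists_proj_eq z
  obtain ⟨i, hi⟩ := D.exists_mem_dom p hp
  exact ⟨i, p, hi, rfl⟩

instance : ChartedSpace E D.LeafSpace where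
  atlas := Set.range D.leafChart
  chartAt z := D.leafChart (D.exists_mem_leafChart_source z).choose
  mem_chart_source z := (D.exists_mem_leafChart_source z).choose_spec
  chart_mem_atlas _ := ⟨_, rfl⟩

theorem mem_atlas_iff {e : OpenPartialHomeomorph D.LeafSpace E} :
    e ∈ atlas E D.LeafSpace ↔ ∃ i, D.leafChart i = e := Iff.rfl

/-- The point at which the plaque with parameter `e`, in the `i`-th foliated chart, meets the
transversal through `p`. -/
def slice (i : D.index) (p : M) (e : E) : M := (D.β i).symm ((D.β i p).1, e)

variable {D} in
theorem slice_self {i : D.index} {p : M} (hp : p ∈ D.dom i) :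
    D.slice i p (D.β i p).2 = p := (D.β i).left_inv (D.dom_subset_source i hp)

variable {D} in
theorem contMDiffAt_slice {i : D.index} {p : M} (hp : p ∈ D.dom i) :
    ContMDiffAt 𝓘(ℂ, E) (𝓘(ℂ, ℂ).prod 𝓘(ℂ, E)) ω (D.slice i p) (D.β i p).2 := by
  refine ContMDiffAt.comp (g := (D.β i).symm) (f := fun e : E => ((D.β i p).1, e))
    (I' := 𝓘(ℂ, ℂ × E)) (D.β i p).2 ?_ ((contDiff_const.prodMk contDiff_id).contMDiff.contMDiffAt)
  exact (D.foliated i).contMDiffAt_symm ((D.β i).map_source (D.dom_subset_source i hp))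

variable {D} in
theorem eventually_slice {i : D.index} {p : M} (hp : p ∈ D.dom i) :
    ∀ᶠ e in 𝓝 (D.β i p).2, D.slice i p e ∈ D.dom i ∧ (D.β i (D.slice i p e)).2 = e := by
  have h1 := (contMDiffAt_slice hp).continuousAt
  have h2 : ∀ᶠ e in 𝓝 (D.β i p).2, D.slice i p e ∈ D.dom i :=
    h1 (by rw [slice_self hp]; exact (D.isOpen_dom i).mem_nhds hp)
  have hc : Continuous fun e : E => ((D.β i p).1, e) := by fun_prop
  have h3 : ∀ᶠ e in 𝓝 (D.β i p).2, ((D.β i p).1, e) ∈ (D.β i).target :=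
    hc.continuousAt ((D.β i).open_target.mem_nhds
      ((D.β i).map_source (D.dom_subset_source i hp)))
  filter_upwards [h2, h3] with e he he'
  refine ⟨he, ?_⟩
  rw [slice, (D.β i).right_inv he']

instance : IsManifold 𝓘(ℂ, E) ω D.LeafSpace := by
  have h : HasGroupoid D.LeafSpace (contDiffGroupoid ω 𝓘(ℂ, E)) := by
    refine hasGroupoid_of_pregroupoid _ ?_
    rintro e e' ⟨i, rfl⟩ ⟨j, rfl⟩
    change ContDiffOn ℂ ω ((D.leafChart i).symm ≫ₕ D.leafChart j) _
    rintro x hx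
    replace hx : x ∈ ((D.leafChart i).symm ≫ₕ D.leafChart j).source := by simpa using hx
    rw [OpenPartialHomeomorph.trans_source, OpenPartialHomeomorph.symm_source] at hx
    obtain ⟨hx1, hx2⟩ := hx
    obtain ⟨_, ⟨p, hp, rfl⟩, rfl⟩ := hx1
    change D.leafChart i (D.proj p) ∈ _ at hx2
    change ContDiffWithinAt ℂ ω _ _ (D.leafChart i (D.proj p))
    have hps : D.proj p ∈ (D.leafChart i).source := ⟨p, hp, rfl⟩
    have hpj : p ∈ D.dom j := by
      rw [Set.mem_preimage, (D.leafChart i).left_inv hps, leafChart_source,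
        D.proj_mem_image_dom_iff (D.dom_subset_carrier i hp)] at hx2
      exact hx2
    refine ContDiffAt.contDiffWithinAt ?_
    rw [D.leafChart_proj hp]
    -- the transition map is `e ↦ (β j (slice i p e)).2`
    have hc : ContMDiffAt 𝓘(ℂ, E) 𝓘(ℂ, E) ω (fun e => (D.β j (D.slice i p e)).2) (D.β i p).2 := by
      refine ContMDiffAt.comp (g := fun q => (D.β j q).2) (D.β i p).2 ?_ (contMDiffAt_slice hp)
      rw [slice_self hp]
      exact (D.foliated j).contMDiffAt_snd (D.dom_subset_source j hpj)
    have hsj : ∀ᶠ e in 𝓝 (D.β i p).2, D.slice i p e ∈ D.dom j :=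
      (contMDiffAt_slice hp).continuousAt
        (by rw [slice_self hp]; exact (D.isOpen_dom j).mem_nhds hpj)
    refine (contMDiffAt_iff_contDiffAt.1 hc).congr_of_eventuallyEq ?_
    filter_upwards [eventually_slice hp, hsj] with e he hej
    have hs : D.proj (D.slice i p e) ∈ (D.leafChart i).source := ⟨_, he.1, rfl⟩
    have h1 : (D.leafChart i).symm e = D.proj (D.slice i p e) := by
      rw [← (D.leafChart i).left_inv hs, D.leafChart_proj he.1, he.2]
    rw [OpenPartialHomeomorph.coe_trans, Function.comp_apply, h1, D.leafChart_proj hej]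
  exact { compatible := h.compatible }

theorem secondCountableTopology_leafSpace [SecondCountableTopology E] :
    SecondCountableTopology D.LeafSpace := by
  have := D.finite_index
  have h : ∀ i, SecondCountableTopology (D.leafChart i).source := fun i =>
    (D.leafChart i).secondCountableTopology_source
  refine TopologicalSpace.secondCountableTopology_of_countable_cover
    (fun i => (D.leafChart i).open_source) ?_
  exact Set.eq_univ_of_forall fun z => Set.mem_iUnion.2 (D.exists_mem_leafChart_source z)

theorem leafChart_mem_atlas (i : D.index) : D.leafChart i ∈ atlas E D.LeafSpace := ⟨i, rfl⟩

theorem exists_chartAt_proj_eq {p : M} (hp : p ∈ D.carrier) :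
    ∃ i, p ∈ D.dom i ∧ chartAt E (D.proj p) = D.leafChart i := by
  have h := mem_chart_source E (D.proj p)
  obtain ⟨i, hi⟩ := D.mem_atlas_iff.1 (chart_mem_atlas E (D.proj p))
  refine ⟨i, ?_, hi.symm⟩
  rw [← hi, leafChart_source, D.proj_mem_image_dom_iff hp] at h
  exact h

theorem leafChart_comp_proj_eventuallyEq {i : D.index} {p : M} (hp : p ∈ D.dom i) :
    (fun q => D.leafChart i (D.proj q)) =ᶠ[𝓝 p] fun q => (D.β i q).2 := by
  filter_upwards [(D.isOpen_dom i).mem_nhds hp] with q hq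
  exact D.leafChart_proj hq

theorem contMDiffAt_proj {p : M} (hp : p ∈ D.carrier) :
    ContMDiffAt (𝓘(ℂ, ℂ).prod 𝓘(ℂ, E)) 𝓘(ℂ, E) ω D.proj p := by
  obtain ⟨i, hi, hc⟩ := D.exists_chartAt_proj_eq hp
  refine contMDiffAt_iff_target.2 ⟨D.continuousAt_proj hp, ?_⟩
  have h : extChartAt 𝓘(ℂ, E) (D.proj p) ∘ D.proj = fun q => D.leafChart i (D.proj q) := by
    ext q; simp [extChartAt, hc]
  rw [h]
  exact ((D.foliated i).contMDiffAt_snd (D.dom_subset_source i hi)).congr_of_eventuallyEq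
    (D.leafChart_comp_proj_eventuallyEq hi)

theorem mfderiv_leafChart_comp_proj {i : D.index} {p : M} (hp : p ∈ D.dom i)
    (ζ : TangentSpace (𝓘(ℂ, ℂ).prod 𝓘(ℂ, E)) p) :
    (mfderiv 𝓘(ℂ, E) 𝓘(ℂ, E) (D.leafChart i) (D.proj p)
      (mfderiv (𝓘(ℂ, ℂ).prod 𝓘(ℂ, E)) 𝓘(ℂ, E) D.proj p ζ) : E) =
    (mfderiv (𝓘(ℂ, ℂ).prod 𝓘(ℂ, E)) 𝓘(ℂ, ℂ × E) (D.β i) p ζ : ℂ × E).2 := by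
  have hc := mfderiv_comp (I' := 𝓘(ℂ, E)) p (g := D.leafChart i)
    (mdifferentiableAt_atlas (D.leafChart_mem_atlas i) ⟨p, hp, rfl⟩)
    ((D.contMDiffAt_proj (D.dom_subset_carrier i hp)).mdifferentiableAt (by simp))
  rw [← (D.foliated i).mfderiv_snd (D.dom_subset_source i hp),
    ← (D.leafChart_comp_proj_eventuallyEq hp).mfderiv_eq]
  change _ = (mfderiv _ _ (D.leafChart i ∘ D.proj) p ζ : E)
  rw [hc]
  rfl

theorem mfderiv_leafChart_bijective {i : D.index} {p : M} (hp : p ∈ D.dom i) :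
    Function.Bijective (mfderiv 𝓘(ℂ, E) 𝓘(ℂ, E) (D.leafChart i) (D.proj p)) :=
  (mdifferentiable_of_mem_atlas (D.leafChart_mem_atlas i)).mfderiv_bijective ⟨p, hp, rfl⟩

theorem mfderiv_proj_eq_zero_iff {p : M} (hp : p ∈ D.carrier)
    (ζ : TangentSpace (𝓘(ℂ, ℂ).prod 𝓘(ℂ, E)) p) :
    mfderiv (𝓘(ℂ, ℂ).prod 𝓘(ℂ, E)) 𝓘(ℂ, E) D.proj p ζ = 0 ↔ ζ ∈ F p := by
  obtain ⟨i, hi⟩ := D.exists_mem_dom p hp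
  rw [(D.foliated i).mem_iff p (D.dom_subset_source i hi), ← D.mfderiv_leafChart_comp_proj hi]
  exact (map_eq_zero_iff _ (D.mfderiv_leafChart_bijective hi).1).symm

/-- The projection onto the space of leaves has analytic local sections. -/
theorem exists_section {p : M} (hp : p ∈ D.carrier) :
    ∃ s : D.LeafSpace → M, ContMDiffAt 𝓘(ℂ, E) (𝓘(ℂ, ℂ).prod 𝓘(ℂ, E)) ω s (D.proj p) ∧
      s (D.proj p) = p ∧ ∀ᶠ z in 𝓝 (D.proj p), s z ∈ D.carrier ∧ D.proj (s z) = z := by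
  obtain ⟨i, hi, hc⟩ := D.exists_chartAt_proj_eq hp
  have hs : D.proj p ∈ (D.leafChart i).source := ⟨p, hi, rfl⟩
  have hchart : ContMDiffAt 𝓘(ℂ, E) 𝓘(ℂ, E) ω (D.leafChart i) (D.proj p) := by
    rw [← hc]
    exact contMDiffAt_of_mem_maximalAtlas (IsManifold.chart_mem_maximalAtlas _)
      (mem_chart_source E _)
  refine ⟨fun z => D.slice i p (D.leafChart i z), ?_, ?_, ?_⟩
  · refine ContMDiffAt.comp (g := D.slice i p) (D.proj p) ?_ hchart
    rw [D.leafChart_proj hi]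
    exact contMDiffAt_slice hi
  · simp only [D.leafChart_proj hi, slice_self hi]
  · have h1 := hchart.continuousAt
    rw [ContinuousAt, D.leafChart_proj hi] at h1
    filter_upwards [h1.eventually (eventually_slice hi), (D.leafChart i).open_source.mem_nhds hs]
      with z hz hzs
    refine ⟨D.dom_subset_carrier i hz.1, ?_⟩
    refine (D.leafChart i).injOn ⟨_, hz.1, rfl⟩ hzs ?_
    rw [D.leafChart_proj hz.1, hz.2]

theorem mfderiv_proj_surjective {p : M} (hp : p ∈ D.carrier) :
    Function.Surjective (mfderiv (𝓘(ℂ, ℂ).prod 𝓘(ℂ, E)) 𝓘(ℂ, E) D.proj p) := by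
  obtain ⟨s, hs, hsp, hps⟩ := D.exists_section hp
  intro η
  have hp' : s (D.proj p) ∈ D.carrier := hsp.symm ▸ hp
  have hc := mfderiv_comp (I' := 𝓘(ℂ, ℂ).prod 𝓘(ℂ, E)) (D.proj p) (g := D.proj) (f := s)
    ((D.contMDiffAt_proj hp').mdifferentiableAt (by simp)) (hs.mdifferentiableAt (by simp))
  have he : D.proj ∘ s =ᶠ[𝓝 (D.proj p)] id := by
    filter_upwards [hps] with z hz using hz.2
  rw [he.mfderiv_eq, mfderiv_id] at hc
  rw [hsp] at hc
  exact ⟨mfderiv 𝓘(ℂ, E) (𝓘(ℂ, ℂ).prod 𝓘(ℂ, E)) s (D.proj p) η,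
    (congrArg (fun L : E →L[ℂ] E => L η) hc).symm⟩

end LeafRelation

end LeafSpace

/-! ### Meromorphic one-forms without zeros -/

section OneForm

/-- The derivative of a preferred chart of a manifold modelled on a vector space is the identity at
its centre. -/
theorem mfderiv_chartAt_self {E : Type*} [NormedAddCommGroup E] [NormedSpace ℂ E]
    {M : Type*} [TopologicalSpace M] [ChartedSpace E M] [IsManifold 𝓘(ℂ, E) ω M] (x : M)
    (v : TangentSpace 𝓘(ℂ, E) x) : (mfderiv 𝓘(ℂ, E) 𝓘(ℂ, E) (chartAt E x) x v : E) = v := by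
  have hd : MDifferentiableAt 𝓘(ℂ, E) 𝓘(ℂ, E) (chartAt E x) x :=
    mdifferentiableAt_atlas (chart_mem_atlas E x) (mem_chart_source E x)
  have h : writtenInExtChartAt 𝓘(ℂ, E) 𝓘(ℂ, E) x (chartAt E x) =ᶠ[𝓝 (chartAt E x x)] id := by
    filter_upwards [(chartAt E x).open_target.mem_nhds (mem_chart_target E x)] with y hy
    simp [writtenInExtChartAt, extChartAt, (chartAt E x).right_inv hy, chartAt_self_eq]
  have h2 : fderivWithin ℂ (writtenInExtChartAt 𝓘(ℂ, E) 𝓘(ℂ, E) x (chartAt E x))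
      (Set.range 𝓘(ℂ, E)) (extChartAt 𝓘(ℂ, E) x x) = ContinuousLinearMap.id ℂ E := by
    rw [modelWithCornersSelf_coe, Set.range_id, fderivWithin_univ]
    exact h.fderiv_eq.trans fderiv_id
  have h3 : (mfderiv 𝓘(ℂ, E) 𝓘(ℂ, E) (chartAt E x) x : E →L[ℂ] E) =
      fderivWithin ℂ (writtenInExtChartAt 𝓘(ℂ, E) 𝓘(ℂ, E) x (chartAt E x))
      (Set.range 𝓘(ℂ, E)) (extChartAt 𝓘(ℂ, E) x x) := if_pos hd
  exact congrArg (fun L : E →L[ℂ] E => L v) (h3.trans h2)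

theorem mfderiv_chartAt_mfderiv_symm {E : Type*} [NormedAddCommGroup E] [NormedSpace ℂ E]
    {M : Type*} [TopologicalSpace M] [ChartedSpace E M] [IsManifold 𝓘(ℂ, E) ω M] {x y : M}
    (hy : y ∈ (chartAt E x).source) (v : E) :
    (mfderiv 𝓘(ℂ, E) 𝓘(ℂ, E) (chartAt E x) y
      (mfderiv 𝓘(ℂ, E) 𝓘(ℂ, E) (chartAt E x).symm (chartAt E x y) v) : E) = v := by
  have h := (mdifferentiable_chart (I := 𝓘(ℂ, E)) x).comp_symm_deriv ((chartAt E x).map_source hy)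
  rw [(chartAt E x).left_inv hy] at h
  exact congrArg (fun L : E →L[ℂ] E => L v) h

theorem ContinuousLinearMap.apply_eq_mul_apply_one (L : ℂ →L[ℂ] ℂ) (a : ℂ) : L a = a * L 1 := by
  rw [← smul_eq_mul, ← map_smul, smul_eq_mul, mul_one]

namespace MeromorphicOneForm

variable {X : Type*} [TopologicalSpace X] [ChartedSpace ℂ X]
  {V : Type*} [NormedAddCommGroup V] [NormedSpace ℂ V]

/-- The value `α(∂)` of a form on the unit vector of the tangent space at `x`, in the
identification of that space with `ℂ` given by the preferred coordinate at `x`. -/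
def value (α : MeromorphicOneForm X V) (x : X) : V :=
  let f : ℂ →ₗ[ℂ] V := α.form x
  f 1

theorem form_apply (α : MeromorphicOneForm X V) (x : X) (c : ℂ) :
    α.form x c = c • α.value x := by
  let f : ℂ →ₗ[ℂ] V := α.form x
  have h : f (c • 1) = c • f 1 := map_smul f c 1
  rw [smul_eq_mul, mul_one] at h
  exact h

/-- In the preferred coordinate at `x`, a form without zero at `x` is `(z - z(x)) ^ (-k)` times an
analytic function which does not vanish at `x`, with `k` the order of the pole. -/
theorem exists_analytic_leadingCoeff (α : MeromorphicOneForm X V) {x : X} (hα : ¬ α.IsZero x) :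
    ∃ A : ℂ → V, AnalyticAt ℂ A (chartAt ℂ x x) ∧ A (chartAt ℂ x x) = α.leadingCoeff x ∧
      α.leadingCoeff x ≠ 0 ∧
      (∀ᶠ z in 𝓝[≠] (chartAt ℂ x x), A z = (z - chartAt ℂ x x) ^ α.poleOrder x • α.coeff x z) ∧
      (α.IsPole x ↔ α.poleOrder x ≠ 0) := by
  have hm : MeromorphicAt (α.coeff x) (chartAt ℂ x x) := (α.meromorphic' x).meromorphicAt
  have htop : α.order x ≠ ⊤ := fun h => hα (by rw [IsZero, h]; exact WithTop.coe_lt_top 0)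
  obtain ⟨n, hn⟩ := WithTop.ne_top_iff_exists.1 htop
  have hn0 : n ≤ 0 := by
    have h : ¬ (0 : WithTop ℤ) < α.order x := hα
    rw [← hn, not_lt] at h
    exact_mod_cast h
  obtain ⟨A, hA, hA0, hAe⟩ := (meromorphicOrderAt_eq_int_iff hm).1 hn.symm
  have hk : (α.poleOrder x : ℤ) = -n := by
    rw [poleOrder, ← hn, WithTop.untopD_coe, Int.toNat_of_nonneg (by lia)]
  have hev : ∀ᶠ z in 𝓝[≠] (chartAt ℂ x x),
      A z = (z - chartAt ℂ x x) ^ α.poleOrder x • α.coeff x z := by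
    filter_upwards [hAe, self_mem_nhdsWithin] with z hz hne
    have hz0 : z - chartAt ℂ x x ≠ 0 := sub_ne_zero.2 hne
    rw [hz, smul_smul, ← zpow_natCast, ← zpow_add₀ hz0, hk, neg_add_cancel, zpow_zero, one_smul]
  have hlim : α.leadingCoeff x = A (chartAt ℂ x x) := by
    refine Filter.Tendsto.limUnder_eq ?_
    exact (hA.continuousAt.tendsto.mono_left nhdsWithin_le_nhds).congr' hev
  refine ⟨A, hA, hlim.symm, hlim ▸ hA0, hev, ?_⟩
  rw [IsPole, ← hn]
  constructor
  · intro h hk0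
    have : n < 0 := by exact_mod_cast h
    lia
  · intro h
    have : n < 0 := by lia
    exact_mod_cast this

theorem isPole_iff (α : MeromorphicOneForm X V) {x : X} (hα : ¬ α.IsZero x) :
    α.IsPole x ↔ α.poleOrder x ≠ 0 := (α.exists_analytic_leadingCoeff hα).choose_spec.2.2.2.2

theorem leadingCoeff_ne_zero (α : MeromorphicOneForm X V) {x : X} (hα : ¬ α.IsZero x) :
    α.leadingCoeff x ≠ 0 := (α.exists_analytic_leadingCoeff hα).choose_spec.2.2.1

variable [IsManifold 𝓘(ℂ, ℂ) ω X]

/-- The derivative at `y` of the preferred coordinate at `x`. -/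
def chartDeriv (x y : X) : ℂ →L[ℂ] ℂ := mfderiv 𝓘(ℂ, ℂ) 𝓘(ℂ, ℂ) (chartAt ℂ x) y

/-- The derivative of the inverse of the preferred coordinate at `x`. -/
def chartSymmDeriv (x : X) (z : ℂ) : ℂ →L[ℂ] ℂ := mfderiv 𝓘(ℂ, ℂ) 𝓘(ℂ, ℂ) (chartAt ℂ x).symm z

theorem chartDeriv_self (x : X) : chartDeriv x x 1 = 1 := mfderiv_chartAt_self x (1 : ℂ)

theorem chartDeriv_mul_chartSymmDeriv {x y : X} (hy : y ∈ (chartAt ℂ x).source) :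
    chartDeriv x y 1 * chartSymmDeriv x (chartAt ℂ x y) 1 = 1 := by
  have h : chartDeriv x y (chartSymmDeriv x (chartAt ℂ x y) 1) = 1 :=
    mfderiv_chartAt_mfderiv_symm hy (1 : ℂ)
  rwa [ContinuousLinearMap.apply_eq_mul_apply_one, mul_comm] at h

theorem chartDeriv_ne_zero {x y : X} (hy : y ∈ (chartAt ℂ x).source) : chartDeriv x y 1 ≠ 0 :=
  left_ne_zero_of_mul_eq_one (chartDeriv_mul_chartSymmDeriv hy)

theorem chartDeriv_smul_coeff (α : MeromorphicOneForm X V) {x y : X}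
    (hy : y ∈ (chartAt ℂ x).source) :
    chartDeriv x y 1 • α.coeff x (chartAt ℂ x y) = α.value y := by
  have h4 : α.coeff x (chartAt ℂ x y) = chartSymmDeriv x (chartAt ℂ x y) 1 • α.value y := by
    have h : α.coeff x (chartAt ℂ x y) = chartSymmDeriv x (chartAt ℂ x y) 1 •
        α.value ((chartAt ℂ x).symm (chartAt ℂ x y)) := α.form_apply _ _
    rwa [(chartAt ℂ x).left_inv hy] at h
  rw [h4, smul_smul, chartDeriv_mul_chartSymmDeriv hy, one_smul]

theorem leadingCoeff_of_not_isPole (α : MeromorphicOneForm X V) {x : X} (hα : ¬ α.IsZero x)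
    (hx : ¬ α.IsPole x) : α.leadingCoeff x = α.value x := by
  obtain ⟨A, hA, hAx, -, hev, hp⟩ := α.exists_analytic_leadingCoeff hα
  have hk : α.poleOrder x = 0 := by
    by_contra h; exact hx (hp.2 h)
  have hc : AnalyticAt ℂ (α.coeff x) (chartAt ℂ x x) :=
    (α.meromorphic' x).meromorphicOrderAt_nonneg_iff_analyticAt.1 (not_lt.1 hx)
  have h1 : A =ᶠ[𝓝[≠] (chartAt ℂ x x)] α.coeff x := by
    filter_upwards [hev] with z hz
    rw [hz, hk, pow_zero, one_smul]
  have h2 : A (chartAt ℂ x x) = α.coeff x (chartAt ℂ x x) :=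
    tendsto_nhds_unique_of_eventuallyEq
      (hA.continuousAt.tendsto.mono_left nhdsWithin_le_nhds)
      (hc.continuousAt.tendsto.mono_left nhdsWithin_le_nhds) h1
  rw [← hAx, h2, ← α.chartDeriv_smul_coeff (mem_chart_source ℂ x), chartDeriv_self, one_smul]

/-- Change of coordinates for the coefficient of a form. -/
theorem coeff_eq_deriv_smul (α : MeromorphicOneForm X V) {x y : X} {w : ℂ}
    (hw : w ∈ (chartAt ℂ y).target) (hx : (chartAt ℂ y).symm w ∈ (chartAt ℂ x).source) :
    α.coeff y w = deriv (fun w => chartAt ℂ x ((chartAt ℂ y).symm w)) w •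
      α.coeff x (chartAt ℂ x ((chartAt ℂ y).symm w)) := by
  have hy := (chartAt ℂ y).map_target hw
  have e1 := α.chartDeriv_smul_coeff hx
  have e2 := α.chartDeriv_smul_coeff hy
  have hi := chartDeriv_mul_chartSymmDeriv hy
  rw [(chartAt ℂ y).right_inv hw] at e2 hi
  have hc : fderiv ℂ (fun w => chartAt ℂ x ((chartAt ℂ y).symm w)) w =
      (chartDeriv x ((chartAt ℂ y).symm w)).comp (chartSymmDeriv y w) := by
    have h := mfderiv_comp (I' := 𝓘(ℂ, ℂ)) w (g := chartAt ℂ x) (f := (chartAt ℂ y).symm)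
      (mdifferentiableAt_atlas (I := 𝓘(ℂ, ℂ)) (chart_mem_atlas ℂ x) hx)
      (mdifferentiableAt_atlas_symm (I := 𝓘(ℂ, ℂ)) (chart_mem_atlas ℂ y) hw)
    rw [mfderiv_eq_fderiv] at h
    exact h
  rw [← fderiv_apply_one_eq_deriv, hc, ContinuousLinearMap.comp_apply,
    ContinuousLinearMap.apply_eq_mul_apply_one, mul_smul, e1, ← e2, smul_smul, mul_comm, hi,
    one_smul]

/-- The poles of a meromorphic form are isolated. -/
theorem eventually_not_isPole [CompleteSpace V] (α : MeromorphicOneForm X V) (x : X) :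
    ∀ᶠ y in 𝓝 x, y ≠ x → ¬ α.IsPole y := by
  have hm : MeromorphicAt (α.coeff x) (chartAt ℂ x x) := (α.meromorphic' x).meromorphicAt
  have h1 := eventually_nhdsWithin_iff.1 hm.eventually_analyticAt
  filter_upwards [(chartAt ℂ x).continuousAt (mem_chart_source ℂ x) |>.eventually h1,
    (chartAt ℂ x).open_source.mem_nhds (mem_chart_source ℂ x)] with y hy hys hne
  have han : AnalyticAt ℂ (α.coeff x) (chartAt ℂ x y) := hy fun h =>
    hne ((chartAt ℂ x).injOn hys (mem_chart_source ℂ x) h)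
  have hψ : AnalyticAt ℂ (fun w => chartAt ℂ x ((chartAt ℂ y).symm w)) (chartAt ℂ y y) := by
    refine ContDiffAt.analyticAt ?_
    refine contMDiffAt_iff_contDiffAt.1 (ContMDiffAt.comp (g := chartAt ℂ x) (chartAt ℂ y y)
      (I' := 𝓘(ℂ, ℂ)) ?_ ?_)
    · rw [(chartAt ℂ y).left_inv (mem_chart_source ℂ y)]
      exact contMDiffAt_of_mem_maximalAtlas (IsManifold.chart_mem_maximalAtlas _) hys
    · exact contMDiffAt_symm_of_mem_maximalAtlas (IsManifold.chart_mem_maximalAtlas _)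
        (mem_chart_target ℂ y)
  have hc : AnalyticAt ℂ (α.coeff y) (chartAt ℂ y y) := by
    have h2 : AnalyticAt ℂ (fun w => deriv (fun w => chartAt ℂ x ((chartAt ℂ y).symm w)) w •
        α.coeff x (chartAt ℂ x ((chartAt ℂ y).symm w))) (chartAt ℂ y y) := by
      refine hψ.deriv.smul (AnalyticAt.comp_of_eq han hψ ?_)
      rw [(chartAt ℂ y).left_inv (mem_chart_source ℂ y)]
    refine h2.congr ?_
    have hcs := (chartAt ℂ y).continuousAt_symm (mem_chart_target ℂ y)
    rw [ContinuousAt, (chartAt ℂ y).left_inv (mem_chart_source ℂ y)] at hcs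
    filter_upwards [(chartAt ℂ y).open_target.mem_nhds (mem_chart_target ℂ y),
      hcs ((chartAt ℂ x).open_source.mem_nhds hys)] with w hw hwx
    exact (α.coeff_eq_deriv_smul hw hwx).symm
  exact not_lt.2 hc.meromorphicOrderAt_nonneg

theorem finite_setOf_isPole [CompleteSpace V] [CompactSpace X] (α : MeromorphicOneForm X V) :
    {a : X | α.IsPole a}.Finite := by
  obtain ⟨t, -, ht⟩ := isCompact_univ.elim_nhds_subcover
    (fun x => {y | y ≠ x → ¬ α.IsPole y}) (fun x _ => α.eventually_not_isPole x)
  refine t.finite_toSet.subset fun a ha => ?_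
  obtain ⟨x, hx, hax⟩ := Set.mem_iUnion₂.1 (ht (Set.mem_univ a))
  by_contra h
  exact hax (fun e => h (e ▸ hx)) ha

end MeromorphicOneForm

end OneForm

/-! ### The distribution of the system in local coordinates -/

section PartialDerivative

variable {EN : Type*} [NormedAddCommGroup EN] [NormedSpace ℂ EN] {HN : Type*} [TopologicalSpace HN]
  {J : ModelWithCorners ℂ EN HN} {N : Type*} [TopologicalSpace N] [ChartedSpace HN N]
  {E : Type*} [NormedAddCommGroup E] [NormedSpace ℂ E]
  {M : Type*} [TopologicalSpace M] [ChartedSpace E M]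
  {V : Type*} [NormedAddCommGroup V] [NormedSpace ℂ V]

/-- The derivative of a function on a manifold at a point is its derivative in the preferred
coordinates at that point. -/
theorem mfderiv_eq_fderiv_chartAt {f : M → V} {m : M}
    (hf : MDifferentiableAt 𝓘(ℂ, E) 𝓘(ℂ, V) f m) :
    (mfderiv 𝓘(ℂ, E) 𝓘(ℂ, V) f m : E →L[ℂ] V) =
      fderiv ℂ (fun e => f ((chartAt E m).symm e)) (chartAt E m m) := by
  have h : (mfderiv 𝓘(ℂ, E) 𝓘(ℂ, V) f m : E →L[ℂ] V) =
      fderivWithin ℂ (writtenInExtChartAt 𝓘(ℂ, E) 𝓘(ℂ, V) m f)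
      (Set.range 𝓘(ℂ, E)) (extChartAt 𝓘(ℂ, E) m m) := if_pos hf
  rw [h, modelWithCornersSelf_coe, Set.range_id, fderivWithin_univ]
  rfl

/-- The partial derivative with respect to the second variable, at `(x, m)`. -/
def partialDeriv (f : N × M → V) (m : M) (x : N) : E →L[ℂ] V :=
  mfderiv 𝓘(ℂ, E) 𝓘(ℂ, V) (fun h => f (x, h)) m

/-- The partial derivative of an analytic function, at a fixed point of the second factor, is
analytic in the first variable. -/
theorem ContMDiffAt.partialDeriv [IsManifold J ω N] [IsManifold 𝓘(ℂ, E) ω M] {f : N × M → V} {x₀ : N} {m : M}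
    (hf : ContMDiffAt (J.prod 𝓘(ℂ, E)) 𝓘(ℂ, V) ω f (x₀, m)) :
    ContMDiffAt J 𝓘(ℂ, E →L[ℂ] V) ω
      (_root_.partialDeriv f m : N → E →L[ℂ] V) x₀ := by
  have hF : ContMDiffAt (J.prod 𝓘(ℂ, E)) 𝓘(ℂ, V) ω
      (Function.uncurry fun (x : N) (e : E) => f (x, (chartAt E m).symm e))
      (x₀, chartAt E m m) := by
    refine ContMDiffAt.comp (g := f) (f := fun q : N × E => (q.1, (chartAt E m).symm q.2))
      (I' := J.prod 𝓘(ℂ, E)) (x₀, chartAt E m m) ?_ ?_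
    · simpa using hf
    · refine contMDiffAt_fst.prodMk (ContMDiffAt.comp (g := (chartAt E m).symm) (I' := 𝓘(ℂ, E))
        (x₀, chartAt E m m) ?_ contMDiffAt_snd)
      exact contMDiffAt_symm_of_mem_maximalAtlas (IsManifold.chart_mem_maximalAtlas _)
        (mem_chart_target E m)
  have h := ContMDiffAt.mfderiv (m := ω) (fun (x : N) (e : E) => f (x, (chartAt E m).symm e))
    (fun _ => chartAt E m m) hF contMDiffAt_const le_rfl
  have h2 : ContMDiffAt J 𝓘(ℂ, E →L[ℂ] V) ω
      (fun x => fderiv ℂ (fun e => f (x, (chartAt E m).symm e)) (chartAt E m m)) x₀ := by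
    refine h.congr_of_eventuallyEq (Filter.Eventually.of_forall fun x => ?_)
    have e := inTangentCoordinates_model_space (I := 𝓘(ℂ, E)) (I' := 𝓘(ℂ, V))
      (fun _ => chartAt E m m) (fun x => f (x, (chartAt E m).symm (chartAt E m m)))
      (fun x : N => (mfderiv 𝓘(ℂ, E) 𝓘(ℂ, V) (fun e => f (x, (chartAt E m).symm e))
        (chartAt E m m) : E →L[ℂ] V)) x₀
    exact mfderiv_eq_fderiv.symm.trans (congrFun e x).symm
  refine h2.congr_of_eventuallyEq ?_
  have h3 : ∀ᶠ q in 𝓝 (x₀, m), MDifferentiableAt (J.prod 𝓘(ℂ, E)) 𝓘(ℂ, V) f q := by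
    have : IsManifold (J.prod 𝓘(ℂ, E)) 1 (N × M) := IsManifold.of_le (n := ω) (by simp)
    have h4 := (contMDiffAt_iff_contMDiffAt_nhds (by simp)).1 (hf.of_le (m := 1) (by simp))
    filter_upwards [h4] with q hq using hq.mdifferentiableAt (by simp)
  have hc : ContinuousAt (fun x : N => (x, m)) x₀ := by fun_prop
  filter_upwards [hc.eventually h3] with x hx
  refine mfderiv_eq_fderiv_chartAt (f := fun h => f (x, h)) ?_
  exact MDifferentiableAt.comp (g := f) m hx (mdifferentiableAt_const.prodMk mdifferentiableAt_id)

end PartialDerivative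

section RightField

variable {E : Type*} [NormedAddCommGroup E] [NormedSpace ℂ E]
  {G : Type*} [TopologicalSpace G] [ChartedSpace E G] [Group G] [LieGroup 𝓘(ℂ, E) ω G]

/-- The value at `g` of the right-invariant field with value `v` at `1`, in the preferred coordinates
at `1`, as a linear function of `v`. -/
def rightFieldCoord (g : G) : E →L[ℂ] E :=
  mfderiv 𝓘(ℂ, E) 𝓘(ℂ, E) (fun h : G => chartAt E (1 : G) (h * g)) 1

theorem contMDiffAt_chartAt_one {g : G} (hg : g ∈ (chartAt E (1 : G)).source) :
    ContMDiffAt 𝓘(ℂ, E) 𝓘(ℂ, E) ω (chartAt E (1 : G)) g :=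
  contMDiffAt_of_mem_maximalAtlas (IsManifold.chart_mem_maximalAtlas _) hg

theorem mfderiv_chartAt_rightInvariantField {g : G} (hg : g ∈ (chartAt E (1 : G)).source) (v : E) :
    (mfderiv 𝓘(ℂ, E) 𝓘(ℂ, E) (chartAt E (1 : G)) g (rightInvariantField (G := G) v g) : E) =
      rightFieldCoord g v := by
  have h := mfderiv_comp (I' := 𝓘(ℂ, E)) (1 : G) (g := chartAt E (1 : G)) (f := fun h : G => h * g)
    (by rw [one_mul]; exact (contMDiffAt_chartAt_one hg).mdifferentiableAt (by simp))
    ((contMDiff_mul_right (I := 𝓘(ℂ, E)) (n := ω)).contMDiffAt.mdifferentiableAt (by simp))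
  rw [one_mul] at h
  exact (congrArg (fun L : E →L[ℂ] E => L v) h).symm

theorem rightFieldCoord_one : rightFieldCoord (1 : G) = ContinuousLinearMap.id ℂ E := by
  ext v
  have h : (fun h : G => chartAt E (1 : G) (h * 1)) = chartAt E (1 : G) := by ext; simp
  have h2 := mfderiv_chartAt_self (1 : G) v
  rw [← h] at h2
  exact h2

theorem contMDiffAt_rightFieldCoord {g : G} (hg : g ∈ (chartAt E (1 : G)).source) :
    ContMDiffAt 𝓘(ℂ, E) 𝓘(ℂ, E →L[ℂ] E) ω (rightFieldCoord (E := E) (G := G)) g := by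
  refine ContMDiffAt.partialDeriv (f := fun q : G × G => chartAt E (1 : G) (q.2 * q.1)) ?_
  refine ContMDiffAt.comp (g := chartAt E (1 : G)) (I' := 𝓘(ℂ, E)) (g, (1 : G)) ?_
    (contMDiffAt_snd.mul contMDiffAt_fst)
  exact contMDiffAt_chartAt_one (by rwa [one_mul])

end RightField

section ProductChart

variable {E : Type*} [NormedAddCommGroup E]
  {G : Type*} [TopologicalSpace G] [ChartedSpace E G] [Group G]
  {X : Type*} [TopologicalSpace X] [ChartedSpace ℂ X]

variable (G) in
/-- The product of the preferred coordinates at `x₀` and at `1`. -/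
def productChart (x₀ : X) : OpenPartialHomeomorph (X × G) (ℂ × E) :=
  (chartAt ℂ x₀).prod (chartAt E (1 : G))

theorem mem_productChart_source {x₀ : X} : (x₀, (1 : G)) ∈ (productChart (E := E) G x₀).source :=
  ⟨mem_chart_source ℂ x₀, mem_chart_source E (1 : G)⟩

end ProductChart

section Chart

open MeromorphicOneForm

variable {E : Type*} [NormedAddCommGroup E] [NormedSpace ℂ E]
  {G : Type*} [TopologicalSpace G] [ChartedSpace E G] [Group G] [LieGroup 𝓘(ℂ, E) ω G]
  {X : Type*} [TopologicalSpace X] [ChartedSpace ℂ X] [IsManifold 𝓘(ℂ, ℂ) ω X]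

/-- Near `x₀`, the field defining the distribution is, up to a factor, `ζ ^ k (∂_ζ - R)` with `ζ`
the single coordinate centred at `x₀`. -/
theorem MeromorphicOneForm.eventually_leadingCoeff_eq (α : MeromorphicOneForm X E) {x₀ : X}
    {A : ℂ → E} (hA0 : A (chartAt ℂ x₀ x₀) = α.leadingCoeff x₀)
    (hα : ∀ x, ¬ α.IsZero x)
    (hA : ∀ᶠ z in 𝓝[≠] (chartAt ℂ x₀ x₀),
      A z = (z - chartAt ℂ x₀ x₀) ^ α.poleOrder x₀ • α.coeff x₀ z) [CompleteSpace E] :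
    ∀ᶠ x in 𝓝 x₀, ∃ u : ℂ, u ≠ 0 ∧
      chartDeriv x₀ x (0 ^ α.poleOrder x) = u * (chartAt ℂ x₀ x - chartAt ℂ x₀ x₀) ^ α.poleOrder x₀ ∧
      α.leadingCoeff x = u • A (chartAt ℂ x₀ x) := by
  have h1 := (chartAt ℂ x₀).continuousAt (mem_chart_source ℂ x₀) |>.eventually
    (eventually_nhdsWithin_iff.1 hA)
  filter_upwards [h1, (chartAt ℂ x₀).open_source.mem_nhds (mem_chart_source ℂ x₀),
    α.eventually_not_isPole x₀] with x hx hxs hxp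
  by_cases hxx : x = x₀
  · subst hxx
    refine ⟨1, one_ne_zero, ?_, by rw [one_smul, hA0]⟩
    rw [sub_self, ContinuousLinearMap.apply_eq_mul_apply_one, chartDeriv_self, mul_one, one_mul]
  · have hne : chartAt ℂ x₀ x ≠ chartAt ℂ x₀ x₀ := fun h =>
      hxx ((chartAt ℂ x₀).injOn hxs (mem_chart_source ℂ x₀) h)
    have hz : (chartAt ℂ x₀ x - chartAt ℂ x₀ x₀) ^ α.poleOrder x₀ ≠ 0 :=
      pow_ne_zero _ (sub_ne_zero.2 hne)
    have hk : α.poleOrder x = 0 := by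
      by_contra h; exact hxp hxx ((α.isPole_iff (hα x)).2 h)
    refine ⟨chartDeriv x₀ x 1 / (chartAt ℂ x₀ x - chartAt ℂ x₀ x₀) ^ α.poleOrder x₀,
      div_ne_zero (chartDeriv_ne_zero hxs) hz, ?_, ?_⟩
    · rw [hk, pow_zero, div_mul_cancel₀ _ hz]
    · rw [hx hne, smul_smul, div_mul_cancel₀ _ hz, α.chartDeriv_smul_coeff hxs,
        α.leadingCoeff_of_not_isPole (hα x) (hxp hxx)]

theorem contMDiffOn_productChart (x₀ : X) :
    ContMDiffOn (𝓘(ℂ, ℂ).prod 𝓘(ℂ, E)) 𝓘(ℂ, ℂ × E) ω (productChart (E := E) G x₀)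
      (productChart (E := E) G x₀).source := by
  intro p hp
  refine ContMDiffAt.contMDiffWithinAt (ContMDiffAt.prodMk_space ?_ ?_)
  · exact ContMDiffAt.comp (g := chartAt ℂ x₀) (I' := 𝓘(ℂ, ℂ)) p
      (contMDiffAt_of_mem_maximalAtlas (IsManifold.chart_mem_maximalAtlas _) hp.1) contMDiffAt_fst
  · exact ContMDiffAt.comp (g := chartAt E (1 : G)) (I' := 𝓘(ℂ, E)) p
      (contMDiffAt_chartAt_one hp.2) contMDiffAt_snd

theorem contMDiffOn_productChart_symm (x₀ : X) :
    ContMDiffOn 𝓘(ℂ, ℂ × E) (𝓘(ℂ, ℂ).prod 𝓘(ℂ, E)) ω (productChart (E := E) G x₀).symm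
      (productChart (E := E) G x₀).target := by
  intro p hp
  refine ContMDiffAt.contMDiffWithinAt (ContMDiffAt.prodMk ?_ ?_)
  · exact ContMDiffAt.comp (g := (chartAt ℂ x₀).symm) (I' := 𝓘(ℂ, ℂ)) p
      (contMDiffAt_symm_of_mem_maximalAtlas (IsManifold.chart_mem_maximalAtlas _) hp.1)
      contDiff_fst.contMDiff.contMDiffAt
  · exact ContMDiffAt.comp (g := (chartAt E (1 : G)).symm) (I' := 𝓘(ℂ, E)) p
      (contMDiffAt_symm_of_mem_maximalAtlas (IsManifold.chart_mem_maximalAtlas _) hp.2)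
      contDiff_snd.contMDiff.contMDiffAt

theorem mfderiv_productChart {x₀ : X} {p : X × G} (hp : p ∈ (productChart (E := E) G x₀).source)
    (a : ℂ) (w : E) :
    (mfderiv (𝓘(ℂ, ℂ).prod 𝓘(ℂ, E)) 𝓘(ℂ, ℂ × E) (productChart (E := E) G x₀) p
      ((a, w) : ℂ × E) : ℂ × E) =
      (chartDeriv x₀ p.1 a, (mfderiv 𝓘(ℂ, E) 𝓘(ℂ, E) (chartAt E (1 : G)) p.2 w : E)) := by
  have h1 : HasMFDerivAt (𝓘(ℂ, ℂ).prod 𝓘(ℂ, E)) 𝓘(ℂ, ℂ) (fun q : X × G => chartAt ℂ x₀ q.1) p _ :=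
    HasMFDerivAt.comp (g := chartAt ℂ x₀) p
    (mdifferentiableAt_atlas (I := 𝓘(ℂ, ℂ)) (chart_mem_atlas ℂ x₀) hp.1).hasMFDerivAt
    (hasMFDerivAt_fst (I := 𝓘(ℂ, ℂ)) (I' := 𝓘(ℂ, E)) p)
  have h2 : HasMFDerivAt (𝓘(ℂ, ℂ).prod 𝓘(ℂ, E)) 𝓘(ℂ, E)
      (fun q : X × G => chartAt E (1 : G) q.2) p _ :=
    HasMFDerivAt.comp (g := chartAt E (1 : G)) p
    (mdifferentiableAt_atlas (I := 𝓘(ℂ, E)) (chart_mem_atlas E (1 : G)) hp.2).hasMFDerivAt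
    (hasMFDerivAt_snd (I := 𝓘(ℂ, ℂ)) (I' := 𝓘(ℂ, E)) p)
  have h3 := HasMFDerivAt.mfderiv (I' := 𝓘(ℂ, ℂ × E)) ⟨h1.1.prodMk h2.1, h1.2.prodMk h2.2⟩
  exact congrArg (fun L : ℂ × E →L[ℂ] ℂ × E => L (a, w)) h3

/-- In product coordinates near `(x₀, 1)`, the distribution of the system is spanned by an analytic
vector field without zeros. -/
theorem exists_analytic_systemField [CompleteSpace E] (α : MeromorphicOneForm X E)
    (hα : ∀ x, ¬ α.IsZero x) (x₀ : X) :
    ∃ Y : ℂ × E → E, AnalyticAt ℂ Y (productChart (E := E) G x₀ (x₀, 1)) ∧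
      Y (productChart (E := E) G x₀ (x₀, 1)) ≠ 0 ∧
      ∀ᶠ p in 𝓝 (x₀, (1 : G)), ∃ u : ℂ, u ≠ 0 ∧
        (mfderiv (𝓘(ℂ, ℂ).prod 𝓘(ℂ, E)) 𝓘(ℂ, ℂ × E) (productChart (E := E) G x₀) p
          (systemField α p) : ℂ × E) =
        u • ((chartAt ℂ x₀ p.1 - chartAt ℂ x₀ x₀) ^ α.poleOrder x₀,
          Y (productChart (E := E) G x₀ p)) := by
  obtain ⟨A, hA, hA0, hne, hev, -⟩ := α.exists_analytic_leadingCoeff (hα x₀)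
  refine ⟨fun q => -(rightFieldCoord ((chartAt E (1 : G)).symm q.2) (A q.1)), ?_, ?_, ?_⟩
  · refine AnalyticAt.neg (ContDiffAt.analyticAt (contMDiffAt_iff_contDiffAt.1 ?_))
    refine ContMDiffAt.clm_apply (I := 𝓘(ℂ, ℂ × E)) ?_ ?_
    · refine ContMDiffAt.comp (g := rightFieldCoord (E := E) (G := G)) (I' := 𝓘(ℂ, E)) _
        (contMDiffAt_rightFieldCoord ?_) ?_
      · exact (chartAt E (1 : G)).map_target (mem_chart_target E 1)
      · refine ContMDiffAt.comp (g := (chartAt E (1 : G)).symm) (I' := 𝓘(ℂ, E)) _ ?_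
          contDiff_snd.contMDiff.contMDiffAt
        exact contMDiffAt_symm_of_mem_maximalAtlas (IsManifold.chart_mem_maximalAtlas _)
          (mem_chart_target E 1)
    · exact (hA.contDiffAt.comp (g := A) (productChart (E := E) G x₀ (x₀, 1))
        contDiff_fst.contDiffAt).contMDiffAt
  · change -(rightFieldCoord ((chartAt E (1 : G)).symm (chartAt E (1 : G) 1))
      (A (chartAt ℂ x₀ x₀))) ≠ 0
    rw [(chartAt E (1 : G)).left_inv (mem_chart_source E 1), rightFieldCoord_one, hA0]
    exact neg_ne_zero.2 hne
  · filter_upwards [(productChart (E := E) G x₀).open_source.mem_nhds mem_productChart_source,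
      (continuous_fst.tendsto (x₀, (1 : G))).eventually
        (α.eventually_leadingCoeff_eq hA0 hα hev)] with p hp ⟨u, hu, h1, h2⟩
    refine ⟨u, hu, ?_⟩
    have h3 := mfderiv_productChart hp (0 ^ α.poleOrder p.1)
      (-(rightInvariantField (G := G) (α.leadingCoeff p.1) p.2 : E))
    refine h3.trans ?_
    have h4 : (mfderiv 𝓘(ℂ, E) 𝓘(ℂ, E) (chartAt E (1 : G)) p.2
        (-(rightInvariantField (G := G) (α.leadingCoeff p.1) p.2 : E)) : E) =
        -rightFieldCoord p.2 (α.leadingCoeff p.1) := by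
      rw [← mfderiv_chartAt_rightInvariantField hp.2]
      exact map_neg (mfderiv 𝓘(ℂ, E) 𝓘(ℂ, E) (chartAt E (1 : G)) p.2) _
    have h5 : (chartAt E (1 : G)).symm (productChart (E := E) G x₀ p).2 = p.2 :=
      (chartAt E (1 : G)).left_inv hp.2
    rw [h4, h1, h2, map_smul, h5, Prod.smul_mk, smul_eq_mul, smul_neg]
    rfl

end Chart

/-! ### Foliated charts of the system -/

section RestrOpen

variable {E : Type*} [NormedAddCommGroup E] [NormedSpace ℂ E]
  {M : Type*} [TopologicalSpace M] [ChartedSpace (ModelProd ℂ E) M]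
  {F : ∀ p : M, Submodule ℂ (TangentSpace (𝓘(ℂ, ℂ).prod 𝓘(ℂ, E)) p)}

theorem IsFoliatedChart.restrOpen {β : OpenPartialHomeomorph M (ℂ × E)} (hβ : IsFoliatedChart F β)
    {s : Set M} (hs : IsOpen s) : IsFoliatedChart F (β.restrOpen s hs) where
  contMDiffOn := hβ.contMDiffOn.mono fun _ h => h.1
  contMDiffOn_symm := hβ.contMDiffOn_symm.mono fun _ h => h.1
  mem_iff p hp := hβ.mem_iff p hp.1

/-- A flow box for a coordinate expression of a vector field spanning `F` gives a foliated chart. -/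
theorem isFoliatedChart_trans {χ : OpenPartialHomeomorph M (ℂ × E)}
    (hχ : ContMDiffOn (𝓘(ℂ, ℂ).prod 𝓘(ℂ, E)) 𝓘(ℂ, ℂ × E) ω χ χ.source)
    (hχs : ContMDiffOn 𝓘(ℂ, ℂ × E) (𝓘(ℂ, ℂ).prod 𝓘(ℂ, E)) ω χ.symm χ.target)
    {Θ : OpenPartialHomeomorph (ℂ × E) (ℂ × E)} (hΘ : ContDiffOn ℂ ω Θ Θ.source)
    (hΘs : ContDiffOn ℂ ω Θ.symm Θ.target)
    {V : ℂ × E → ℂ × E} (hV : ∀ q ∈ Θ.source, fderiv ℂ Θ q (V q) = (1, 0))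
    {Y : ∀ p : M, TangentSpace (𝓘(ℂ, ℂ).prod 𝓘(ℂ, E)) p}
    (hF : ∀ p, F p = Submodule.span ℂ {Y p})
    (hY : ∀ p ∈ χ.source, χ p ∈ Θ.source → ∃ u : ℂ, u ≠ 0 ∧
      (mfderiv (𝓘(ℂ, ℂ).prod 𝓘(ℂ, E)) 𝓘(ℂ, ℂ × E) χ p (Y p) : ℂ × E) = u • V (χ p)) :
    IsFoliatedChart F (χ.trans Θ) := by
  have h1 : ContMDiffOn (𝓘(ℂ, ℂ).prod 𝓘(ℂ, E)) 𝓘(ℂ, ℂ × E) ω (χ.trans Θ) (χ.trans Θ).source := by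
    rw [OpenPartialHomeomorph.trans_source]
    exact hΘ.contMDiffOn.comp (hχ.mono Set.inter_subset_left) Set.inter_subset_right
  have h2 : ContMDiffOn 𝓘(ℂ, ℂ × E) (𝓘(ℂ, ℂ).prod 𝓘(ℂ, E)) ω (χ.trans Θ).symm
      (χ.trans Θ).target := by
    rw [OpenPartialHomeomorph.trans_target]
    exact hχs.comp (hΘs.contMDiffOn.mono Set.inter_subset_left) Set.inter_subset_right
  refine ⟨h1, h2, fun p hp ζ => ?_⟩
  have hinj := OpenPartialHomeomorph.MDifferentiable.mfderiv_injective
    (e := χ.trans Θ) ⟨h1.mdifferentiableOn (by simp), h2.mdifferentiableOn (by simp)⟩ hp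
  let L : TangentSpace (𝓘(ℂ, ℂ).prod 𝓘(ℂ, E)) p →L[ℂ] ℂ × E :=
    mfderiv (𝓘(ℂ, ℂ).prod 𝓘(ℂ, E)) 𝓘(ℂ, ℂ × E) (χ.trans Θ) p
  change ζ ∈ F p ↔ (L ζ).2 = 0
  rw [OpenPartialHomeomorph.trans_source] at hp
  obtain ⟨u, hu, hYp⟩ := hY p hp.1 hp.2
  have hc := mfderiv_comp (I' := 𝓘(ℂ, ℂ × E)) p (g := Θ) (f := χ)
    ((hΘ.contMDiffOn.contMDiffAt (Θ.open_source.mem_nhds hp.2)).mdifferentiableAt (by simp))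
    ((hχ.contMDiffAt (χ.open_source.mem_nhds hp.1)).mdifferentiableAt (by simp))
  rw [mfderiv_eq_fderiv] at hc
  have hL : L (Y p) = (u, 0) := by
    have h3 : L (Y p) = fderiv ℂ Θ (χ p) (u • V (χ p)) := by
      rw [← hYp]
      exact congrArg (fun L : ℂ × E →L[ℂ] ℂ × E => L (Y p)) hc
    rw [h3, map_smul, hV _ hp.2, Prod.smul_mk, smul_eq_mul, mul_one, smul_zero]
  rw [hF, Submodule.mem_span_singleton]
  constructor
  · rintro ⟨a, rfl⟩
    rw [map_smul, hL, Prod.smul_mk, smul_zero]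
  · intro h
    refine ⟨(L ζ).1 / u, hinj ?_⟩
    change L (((L ζ).1 / u) • Y p) = L ζ
    rw [map_smul, hL, Prod.smul_mk, smul_zero, smul_eq_mul, div_mul_cancel₀ _ hu]
    exact Prod.ext rfl h.symm

end RestrOpen

/-- A curve is injective near a point at which its velocity does not vanish. -/
theorem HasStrictDerivAt.exists_injOn {E : Type*} [NormedAddCommGroup E] [NormedSpace ℂ E]
    {f : ℂ → E} {v : E} {c : ℂ} (hf : HasStrictDerivAt f v c) (hv : v ≠ 0) :
    ∃ O : Set ℂ, IsOpen O ∧ c ∈ O ∧ Set.InjOn f O := by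
  obtain ⟨l, hl⟩ := SeparatingDual.exists_eq_one (R := ℂ) hv
  have h1 : HasStrictDerivAt (fun z => l (f z)) 1 c := by
    have := (l.hasStrictFDerivAt (x := f c)).comp_hasStrictDerivAt c hf
    rwa [hl] at this
  have h2 := h1.hasStrictFDerivAt_equiv one_ne_zero
  obtain ⟨O, hO, ho, hc⟩ := mem_nhds_iff.1 h2.eventually_left_inverse
  refine ⟨O, ho, hc, fun z hz w hw h => ?_⟩
  have e1 := hO hz
  have e2 := hO hw
  rw [Set.mem_ofPred_eq] at e1 e2
  rw [← e1, ← e2, h]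

section System

variable {E : Type*} [NormedAddCommGroup E] [NormedSpace ℂ E] [FiniteDimensional ℂ E]
  [CompleteSpace E]
  {G : Type*} [TopologicalSpace G] [ChartedSpace E G] [Group G] [LieGroup 𝓘(ℂ, E) ω G]
  {X : Type*} [TopologicalSpace X] [ChartedSpace ℂ X] [IsManifold 𝓘(ℂ, ℂ) ω X]

/-- The distribution of the system has foliated charts near the identity section, which is
transverse to it. -/
theorem exists_isFoliatedChart (α : MeromorphicOneForm X E) (hα : ∀ x, ¬ α.IsZero x) (x₀ : X) :
    ∃ β : OpenPartialHomeomorph (X × G) (ℂ × E),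
      IsFoliatedChart (systemDistribution (G := G) α) β ∧ (x₀, (1 : G)) ∈ β.source ∧
      Set.InjOn (fun p => (β p).2) (Set.range (fun x : X => (x, (1 : G))) ∩ β.source) := by
  obtain ⟨Y, hY, hY0, hev⟩ := exists_analytic_systemField (G := G) α hα x₀
  set χ := productChart (E := E) G x₀ with hχ
  have hs : (x₀, (1 : G)) ∈ χ.source := mem_productChart_source
  set V : ℂ × E → ℂ × E := fun q => ((q.1 - chartAt ℂ x₀ x₀) ^ α.poleOrder x₀, Y q) with hVdef
  have hV : AnalyticAt ℂ V (χ (x₀, 1)) :=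
    (((analyticAt_fst).sub analyticAt_const).pow _).prod hY
  have hV0 : V (χ (x₀, 1)) ≠ 0 := fun h => hY0 (congrArg Prod.snd h)
  have hU : {q | ∃ u : ℂ, u ≠ 0 ∧ (mfderiv (𝓘(ℂ, ℂ).prod 𝓘(ℂ, E)) 𝓘(ℂ, ℂ × E) χ (χ.symm q)
      (systemField α (χ.symm q)) : ℂ × E) = u • V (χ (χ.symm q))} ∈ 𝓝 (χ (x₀, 1)) := by
    have hc := χ.continuousAt_symm (χ.map_source hs)
    rw [ContinuousAt, χ.left_inv hs] at hc
    exact hc.eventually hev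
  obtain ⟨Θ, hw, hΘU, hΘ, hΘs, hΘV⟩ := exists_flowBox hV hV0 hU
  have hβ : IsFoliatedChart (systemDistribution (G := G) α) (χ.trans Θ) := by
    refine isFoliatedChart_trans (contMDiffOn_productChart x₀) (contMDiffOn_productChart_symm x₀)
      hΘ hΘs hΘV (fun _ => rfl) fun p hp hpΘ => ?_
    have := hΘU hpΘ
    rw [Set.mem_ofPred_eq, χ.left_inv hp] at this
    exact this
  -- the identity section is transverse to the plaques, hence meets each of them once near `x₀`
  have hdΘ : HasStrictFDerivAt Θ (fderiv ℂ Θ (χ (x₀, 1))) (χ (x₀, 1)) :=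
    (hΘ.contDiffAt (Θ.open_source.mem_nhds hw)).hasStrictFDerivAt (by simp)
  have hg : HasStrictDerivAt (fun z => (Θ (z, chartAt E (1 : G) 1)).2)
      (fderiv ℂ Θ (χ (x₀, 1)) (1, 0)).2 (chartAt ℂ x₀ x₀) := by
    have h1 : HasStrictDerivAt (fun z : ℂ => (z, chartAt E (1 : G) 1)) ((1 : ℂ), (0 : E))
      (chartAt ℂ x₀ x₀) := (hasStrictDerivAt_id _).prodMk (hasStrictDerivAt_const _ _)
    have h2 := (hasStrictFDerivAt_snd (𝕜 := ℂ)).comp_hasStrictDerivAt (chartAt ℂ x₀ x₀)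
      (hdΘ.comp_hasStrictDerivAt (chartAt ℂ x₀ x₀) h1)
    exact h2
  have hg0 : (fderiv ℂ Θ (χ (x₀, 1)) (1, 0)).2 ≠ 0 := by
    intro h
    have hinj : Function.Injective (fderiv ℂ Θ (χ (x₀, 1))) := by
      have := OpenPartialHomeomorph.MDifferentiable.mfderiv_injective (I := 𝓘(ℂ, ℂ × E))
        (I' := 𝓘(ℂ, ℂ × E)) (e := Θ) ⟨hΘ.contMDiffOn.mdifferentiableOn (by simp),
          hΘs.contMDiffOn.mdifferentiableOn (by simp)⟩ hw
      rwa [mfderiv_eq_fderiv] at this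
    have h3 : fderiv ℂ Θ (χ (x₀, 1)) ((1, 0) - (fderiv ℂ Θ (χ (x₀, 1)) (1, 0)).1 •
        V (χ (x₀, 1))) = fderiv ℂ Θ (χ (x₀, 1)) 0 := by
      rw [map_sub, map_smul, hΘV _ hw, map_zero]
      exact Prod.ext (by simp) (by simpa using h)
    have h4 := sub_eq_zero.1 (hinj h3)
    have h5 := congrArg Prod.snd h4
    have h6 : (fderiv ℂ Θ (χ (x₀, 1)) (1, 0)).1 = 0 :=
      (smul_eq_zero.1 (show _ • Y (χ (x₀, 1)) = 0 from h5.symm)).resolve_right hY0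
    rw [h6, zero_smul] at h4
    exact one_ne_zero (congrArg Prod.fst h4)
  obtain ⟨O, hO, hcO, hinjO⟩ := hg.exists_injOn hg0
  have hS : IsOpen (((chartAt ℂ x₀).source ∩ chartAt ℂ x₀ ⁻¹' O) ×ˢ (Set.univ : Set G)) :=
    ((chartAt ℂ x₀).isOpen_inter_preimage hO).prod isOpen_univ
  refine ⟨(χ.trans Θ).restrOpen _ hS, hβ.restrOpen hS,
    ⟨?_, ⟨mem_chart_source ℂ x₀, hcO⟩, Set.mem_univ _⟩, ?_⟩
  · rw [OpenPartialHomeomorph.trans_source]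
    exact ⟨hs, hw⟩
  · rintro _ ⟨⟨x, rfl⟩, -, ⟨hx, hxO⟩, -⟩ _ ⟨⟨y, rfl⟩, -, ⟨hy, hyO⟩, -⟩ h
    exact congrArg (fun x => (x, (1 : G)))
      ((chartAt ℂ x₀).injOn hx hy (hinjO hxO hyO h))

/-- A Lie group is Hausdorff, being a topological group in which points are closed. -/
theorem t2Space_of_lieGroup (E : Type*) [NormedAddCommGroup E] [NormedSpace ℂ E]
    (G : Type*) [TopologicalSpace G] [ChartedSpace E G] [Group G] [LieGroup 𝓘(ℂ, E) ω G] :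
    T2Space G := by
  have := topologicalGroup_of_lieGroup 𝓘(ℂ, E) ω (G := G)
  have : T1Space G := ChartedSpace.t1Space E G
  infer_instance

/-- The distribution of the system has a good relation of leaves near the identity section, whose
points lie on different leaves; every leaf meets a tube `X × B` around this section, with `B`
connected. -/
theorem exists_leafRelation_system [T2Space X] [CompactSpace X] [Nonempty X]
    (α : MeromorphicOneForm X E) (hα : ∀ x, ¬ α.IsZero x) :
    ∃ (D : LeafRelation (systemDistribution (G := G) α)) (B : Set G), IsPreconnected B ∧ 1 ∈ B ∧
      Set.univ ×ˢ B ⊆ D.carrier ∧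
      (∀ p ∈ D.carrier, ∃ a ∈ (Set.univ : Set X) ×ˢ B, D.rel p a) ∧
      ∀ x y : X, D.rel (x, 1) (y, 1) → x = y := by
  have := t2Space_of_lieGroup E G
  have := ChartedSpace.locallyCompactSpace E G
  have := ChartedSpace.locallyCompactSpace ℂ X
  have hK : IsCompact (Set.range fun x : X => (x, (1 : G))) :=
    isCompact_range (by fun_prop)
  obtain ⟨D, A, ⟨B, hB, h1B, rfl⟩, -, -, hA, hrel, hinj⟩ := exists_leafRelation
    (F := systemDistribution (G := G) α) hK (Set.range_nonempty _)
    (by rintro _ ⟨x, rfl⟩; exact exists_isFoliatedChart α hα x)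
    (P := fun A => ∃ B : Set G, IsPreconnected B ∧ 1 ∈ B ∧ A = Set.univ ×ˢ B) (by
      intro U hU hKU
      obtain ⟨u, v, -, hv, hu1, hv1, huv⟩ := generalized_tube_lemma
        (isCompact_univ (X := X)) (isCompact_singleton (x := (1 : G))) hU (by
          rintro ⟨x, g⟩ ⟨-, rfl⟩; exact hKU ⟨x, rfl⟩)
      -- a small coordinate ball at `1`
      have h1v : v ∈ 𝓝 (1 : G) := hv.mem_nhds (hv1 rfl)
      obtain ⟨r, hr, hball⟩ := Metric.mem_nhds_iff.1 (Filter.inter_mem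
        ((chartAt E (1 : G)).open_target.mem_nhds (mem_chart_target E (1 : G)))
        ((chartAt E (1 : G)).continuousAt_symm (mem_chart_target E (1 : G)) (by
          rwa [(chartAt E (1 : G)).left_inv (mem_chart_source E (1 : G))])))
      set B := (chartAt E (1 : G)).symm '' Metric.ball (chartAt E (1 : G) 1) r with hBdef
      have hBo : IsOpen B := (chartAt E (1 : G)).symm.isOpen_image_of_subset_source
        Metric.isOpen_ball fun e he => (hball he).1
      have h1B : (1 : G) ∈ B := ⟨_, Metric.mem_ball_self hr,
        (chartAt E (1 : G)).left_inv (mem_chart_source E (1 : G))⟩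
      have hBc : IsPreconnected B := by
        have := NormedSpace.restrictScalars ℝ ℂ E
        refine (Metric.isPreconnected_ball).image _ ?_
        exact (chartAt E (1 : G)).continuousOn_symm.mono fun e he => (hball he).1
      refine ⟨Set.univ ×ˢ B, ⟨B, hBc, h1B, rfl⟩, isOpen_univ.prod hBo, ?_, ?_⟩
      · rintro _ ⟨x, rfl⟩; exact ⟨Set.mem_univ _, h1B⟩
      · rintro ⟨x, g⟩ ⟨-, ⟨e, he, rfl⟩⟩
        exact huv ⟨hu1 (Set.mem_univ x), (hball he).2⟩)
  refine ⟨D, B, hB, h1B, hA, hrel, fun x y h => ?_⟩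
  exact congrArg Prod.fst (hinj _ ⟨x, rfl⟩ _ ⟨y, rfl⟩ h)

end System

/-! ### Brackets of related vector fields -/

section Related

variable {E : Type*} [NormedAddCommGroup E] [NormedSpace ℂ E]
  {E' : Type*} [NormedAddCommGroup E'] [NormedSpace ℂ E']

theorem fderiv_lieBracket_eq_of_related {f : E → E'} {x : E} (hf : ContDiffAt ℂ ω f x)
    {V W : E → E} {V' W' : E' → E'} (hV : DifferentiableAt ℂ V x) (hW : DifferentiableAt ℂ W x)
    (hV' : DifferentiableAt ℂ V' (f x)) (hW' : DifferentiableAt ℂ W' (f x))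
    (hVV' : ∀ᶠ y in 𝓝 x, fderiv ℂ f y (V y) = V' (f y))
    (hWW' : ∀ᶠ y in 𝓝 x, fderiv ℂ f y (W y) = W' (f y)) :
    fderiv ℂ f x (lieBracket ℂ V W x) = lieBracket ℂ V' W' (f x) := by
  have hd := hf.differentiableAt (by simp)
  rw [fderiv_apply_lieBracket_of_isSymmSndFDerivAt (hf.of_le (by simp))
    (hf.isSymmSndFDerivAt (by simp)) hW hV, Filter.EventuallyEq.fderiv_eq hVV',
    Filter.EventuallyEq.fderiv_eq hWW', lieBracket, ← hVV'.self_of_nhds, ← hWW'.self_of_nhds]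
  have h1 := fderiv_comp x hW' hd
  have h2 := fderiv_comp x hV' hd
  change fderiv ℂ (W' ∘ f) x (V x) - fderiv ℂ (V' ∘ f) x (W x) = _
  rw [h1, h2]
  rfl

variable {M : Type*} [TopologicalSpace M] [ChartedSpace E M]

/-- A vector field in the preferred coordinates at `x`. -/
def coordField (x : M) (V : ∀ y : M, TangentSpace 𝓘(ℂ, E) y) (e : E) : E :=
  mfderiv 𝓘(ℂ, E) 𝓘(ℂ, E) (chartAt E x) ((chartAt E x).symm e) (V ((chartAt E x).symm e))

variable [IsManifold 𝓘(ℂ, E) ω M]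

theorem mpullbackWithin_extChartAt_symm_eq {x : M} {e : E} (he : e ∈ (chartAt E x).target)
    (V : ∀ y : M, TangentSpace 𝓘(ℂ, E) y) :
    (mpullbackWithin 𝓘(ℂ, E) 𝓘(ℂ, E) (extChartAt 𝓘(ℂ, E) x).symm V (Set.range 𝓘(ℂ, E)) e : E) =
      coordField x V e := by
  have : IsManifold 𝓘(ℂ, E) 1 M := IsManifold.of_le (n := ω) (by simp)
  have he' : e ∈ (extChartAt 𝓘(ℂ, E) x).target := by simpa [extChartAt] using he
  have h1 := mfderiv_extChartAt_comp_mfderivWithin_extChartAt_symm (I := 𝓘(ℂ, E)) he'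
  have h2 := mfderivWithin_extChartAt_symm_comp_mfderiv_extChartAt (I := 𝓘(ℂ, E)) he'
  have h3 := ContinuousLinearMap.inverse_eq h2 h1
  rw [mpullbackWithin_apply, h3]
  rfl

theorem differentiableAt_coordField [CompleteSpace E] {x : M}
    {V : ∀ y : M, TangentSpace 𝓘(ℂ, E) y}
    (hV : MDifferentiableAt 𝓘(ℂ, E) 𝓘(ℂ, E).tangent (fun y => (⟨y, V y⟩ : TangentBundle 𝓘(ℂ, E) M))
      x) : DifferentiableAt ℂ (coordField x V) (chartAt E x x) := by
  have : IsManifold 𝓘(ℂ, E) 2 M := IsManifold.of_le (n := ω) (by simp)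
  let P : E → E := mpullbackWithin 𝓘(ℂ, E) 𝓘(ℂ, E) (extChartAt 𝓘(ℂ, E) x).symm V
    (Set.range 𝓘(ℂ, E))
  have h : DifferentiableWithinAt ℂ P ((extChartAt 𝓘(ℂ, E) x).symm ⁻¹' Set.univ ∩
      Set.range 𝓘(ℂ, E)) (chartAt E x x) :=
    MDifferentiableWithinAt.differentiableWithinAt_mpullbackWithin_vectorField
      (mdifferentiableWithinAt_univ.2 hV)
  rw [Set.preimage_univ, Set.univ_inter, modelWithCornersSelf_coe, Set.range_id,
    differentiableWithinAt_univ] at h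
  refine DifferentiableAt.congr_of_eventuallyEq h ?_
  filter_upwards [(chartAt E x).open_target.mem_nhds (mem_chart_target E x)] with e he
  exact (mpullbackWithin_extChartAt_symm_eq he V).symm

theorem mlieBracket_eq_lieBracket_coordField {x : M} (V W : ∀ y : M, TangentSpace 𝓘(ℂ, E) y) :
    (mlieBracket 𝓘(ℂ, E) V W x : E) =
      lieBracket ℂ (coordField x V) (coordField x W) (chartAt E x x) := by
  have : IsManifold 𝓘(ℂ, E) 1 M := IsManifold.of_le (n := ω) (by simp)
  let P : (∀ y : M, TangentSpace 𝓘(ℂ, E) y) → E → E := fun V =>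
    mpullbackWithin 𝓘(ℂ, E) 𝓘(ℂ, E) (extChartAt 𝓘(ℂ, E) x).symm V (Set.range 𝓘(ℂ, E))
  have hc : ∀ V, P V =ᶠ[𝓝 (chartAt E x x)] coordField x V := by
    intro V
    filter_upwards [(chartAt E x).open_target.mem_nhds (mem_chart_target E x)] with e he
    exact mpullbackWithin_extChartAt_symm_eq he V
  let L : E →L[ℂ] E := mfderiv 𝓘(ℂ, E) 𝓘(ℂ, E) (extChartAt 𝓘(ℂ, E) x) x
  have h1 : (mlieBracket 𝓘(ℂ, E) V W x : E) = L.inverse (lieBracketWithin ℂ (P V) (P W)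
      ((extChartAt 𝓘(ℂ, E) x).symm ⁻¹' Set.univ ∩ Set.range 𝓘(ℂ, E)) (chartAt E x x)) := rfl
  have h2 : L = ContinuousLinearMap.id ℂ E := mfderiv_extChartAt_self
  have h3 : Set.range 𝓘(ℂ, E) = Set.univ := by rw [modelWithCornersSelf_coe, Set.range_id]
  rw [h1, h2, ContinuousLinearMap.inverse_id, Set.preimage_univ, Set.univ_inter, h3,
    lieBracketWithin_univ]
  exact (hc V).lieBracket_vectorField_eq (hc W)

variable {M' : Type*} [TopologicalSpace M'] [ChartedSpace E' M'] [IsManifold 𝓘(ℂ, E') ω M']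

/-- An analytic map sends the bracket of two vector fields to the bracket of two vector fields to
which they are related. -/
theorem mfderiv_mlieBracket_eq_of_related [CompleteSpace E] [CompleteSpace E'] {f : M → M'} {x : M}
    (hf : ContMDiffAt 𝓘(ℂ, E) 𝓘(ℂ, E') ω f x)
    {V W : ∀ y : M, TangentSpace 𝓘(ℂ, E) y} {V' W' : ∀ y : M', TangentSpace 𝓘(ℂ, E') y}
    (hV : MDifferentiableAt 𝓘(ℂ, E) 𝓘(ℂ, E).tangent (fun y => (⟨y, V y⟩ : TangentBundle 𝓘(ℂ, E) M))
      x)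
    (hW : MDifferentiableAt 𝓘(ℂ, E) 𝓘(ℂ, E).tangent (fun y => (⟨y, W y⟩ : TangentBundle 𝓘(ℂ, E) M))
      x)
    (hV' : MDifferentiableAt 𝓘(ℂ, E') 𝓘(ℂ, E').tangent
      (fun y => (⟨y, V' y⟩ : TangentBundle 𝓘(ℂ, E') M')) (f x))
    (hW' : MDifferentiableAt 𝓘(ℂ, E') 𝓘(ℂ, E').tangent
      (fun y => (⟨y, W' y⟩ : TangentBundle 𝓘(ℂ, E') M')) (f x))
    (hVV' : ∀ᶠ y in 𝓝 x, mfderiv 𝓘(ℂ, E) 𝓘(ℂ, E') f y (V y) = V' (f y))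
    (hWW' : ∀ᶠ y in 𝓝 x, mfderiv 𝓘(ℂ, E) 𝓘(ℂ, E') f y (W y) = W' (f y)) :
    mfderiv 𝓘(ℂ, E) 𝓘(ℂ, E') f x (mlieBracket 𝓘(ℂ, E) V W x) =
      mlieBracket 𝓘(ℂ, E') V' W' (f x) := by
  set κ := chartAt E x with hκ
  set κ' := chartAt E' (f x) with hκ'
  set F : E → E' := fun e => κ' (f (κ.symm e)) with hFdef
  have hx : κ.symm (κ x) = x := κ.left_inv (mem_chart_source E x)
  have hFx : F (κ x) = κ' (f x) := by rw [hFdef]; simp only [hx]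
  have hκs : ContMDiffAt 𝓘(ℂ, E) 𝓘(ℂ, E) ω κ.symm (κ x) :=
    contMDiffAt_symm_of_mem_maximalAtlas (IsManifold.chart_mem_maximalAtlas _)
      (mem_chart_target E x)
  have hκ's : ContMDiffAt 𝓘(ℂ, E') 𝓘(ℂ, E') ω κ' (f x) :=
    contMDiffAt_of_mem_maximalAtlas (IsManifold.chart_mem_maximalAtlas _) (mem_chart_source E' _)
  have hfκ : ContMDiffAt 𝓘(ℂ, E) 𝓘(ℂ, E') ω (fun e => f (κ.symm e)) (κ x) :=
    ContMDiffAt.comp (g := f) (κ x) (by rwa [hx]) hκs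
  have hF : ContDiffAt ℂ ω F (κ x) :=
    contMDiffAt_iff_contDiffAt.1 (ContMDiffAt.comp (g := κ') (I' := 𝓘(ℂ, E')) (κ x)
      (by rwa [hx]) hfκ)
  -- the derivative of `f`, read in the coordinates
  have hev : ∀ᶠ e in 𝓝 (κ x), ∀ v : TangentSpace 𝓘(ℂ, E) (κ.symm e),
      fderiv ℂ F e (mfderiv 𝓘(ℂ, E) 𝓘(ℂ, E) κ (κ.symm e) v : E) =
      (mfderiv 𝓘(ℂ, E') 𝓘(ℂ, E') κ' (f (κ.symm e))
        (mfderiv 𝓘(ℂ, E) 𝓘(ℂ, E') f (κ.symm e) v) : E') := by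
    have h1 : ∀ᶠ y in 𝓝 x, ContMDiffAt 𝓘(ℂ, E) 𝓘(ℂ, E') ω f y :=
      (contMDiffAt_iff_contMDiffAt_nhds (by simp)).1 hf
    have h2 : Filter.Tendsto κ.symm (𝓝 (κ x)) (𝓝 x) := by
      have := hκs.continuousAt
      rwa [ContinuousAt, hx] at this
    filter_upwards [h2.eventually h1, κ.open_target.mem_nhds (mem_chart_target E x),
      h2.eventually (hf.continuousAt (κ'.open_source.mem_nhds (mem_chart_source E' (f x))))]
      with e he het hes v
    have hdκ' : MDifferentiableAt 𝓘(ℂ, E') 𝓘(ℂ, E') κ' (f (κ.symm e)) :=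
      mdifferentiableAt_atlas (chart_mem_atlas E' _) hes
    have hdκ : MDifferentiableAt 𝓘(ℂ, E) 𝓘(ℂ, E) κ (κ.symm e) :=
      mdifferentiableAt_atlas (chart_mem_atlas E _) (κ.map_target het)
    have hdf := he.mdifferentiableAt (by simp)
    have hdF : MDifferentiableAt 𝓘(ℂ, E) 𝓘(ℂ, E') F (κ (κ.symm e)) := by
      rw [κ.right_inv het]
      refine MDifferentiableAt.comp (g := κ') (I' := 𝓘(ℂ, E')) e hdκ' ?_
      exact MDifferentiableAt.comp (g := f) e hdf
        (mdifferentiableAt_atlas_symm (chart_mem_atlas E _) het)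
    have c1 := mfderiv_comp (I' := 𝓘(ℂ, E)) (κ.symm e) (g := F) (f := κ) hdF hdκ
    have c2 := mfderiv_comp (I' := 𝓘(ℂ, E')) (κ.symm e) (g := κ') (f := f) hdκ' hdf
    have hE : F ∘ κ =ᶠ[𝓝 (κ.symm e)] κ' ∘ f := by
      filter_upwards [κ.open_source.mem_nhds (κ.map_target het)] with y hy
      simp only [hFdef, Function.comp_apply, κ.left_inv hy]
    rw [hE.mfderiv_eq, c2, mfderiv_eq_fderiv] at c1
    rw [κ.right_inv het] at c1
    exact (congrArg (fun L : E →L[ℂ] E' => L v) c1).symm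
  have hrel : ∀ {V : ∀ y : M, TangentSpace 𝓘(ℂ, E) y} {V' : ∀ y : M', TangentSpace 𝓘(ℂ, E') y},
      (∀ᶠ y in 𝓝 x, mfderiv 𝓘(ℂ, E) 𝓘(ℂ, E') f y (V y) = V' (f y)) →
      ∀ᶠ e in 𝓝 (κ x), fderiv ℂ F e (coordField x V e) = coordField (f x) V' (F e) := by
    intro V V' h
    have h2 : Filter.Tendsto κ.symm (𝓝 (κ x)) (𝓝 x) := by
      have := hκs.continuousAt
      rwa [ContinuousAt, hx] at this
    filter_upwards [hev, h2.eventually h,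
      h2.eventually (hf.continuousAt (κ'.open_source.mem_nhds (mem_chart_source E' (f x))))]
      with e he hr hes
    have h3 : κ'.symm (F e) = f (κ.symm e) := κ'.left_inv hes
    rw [coordField, coordField, he, hr, ← hκ', h3]
  have key := fderiv_lieBracket_eq_of_related hF (differentiableAt_coordField hV)
    (differentiableAt_coordField hW)
    (by rw [hFx]; exact differentiableAt_coordField hV')
    (by rw [hFx]; exact differentiableAt_coordField hW') (hrel hVV') (hrel hWW')
  rw [hFx, hκ', ← mlieBracket_eq_lieBracket_coordField, hκ,
    ← mlieBracket_eq_lieBracket_coordField] at key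
  have h4 := hev.self_of_nhds
  rw [hx] at h4
  have h5 := h4 (mlieBracket 𝓘(ℂ, E) V W x)
  rw [mfderiv_chartAt_self, mfderiv_chartAt_self] at h5
  exact h5.symm.trans key

end Related

/-! ### Right translations and the action of the Lie algebra -/

section Translation

variable {E : Type*} [NormedAddCommGroup E] [NormedSpace ℂ E]
  {G : Type*} [TopologicalSpace G] [ChartedSpace E G] [Group G] [LieGroup 𝓘(ℂ, E) ω G]
  {X : Type*} [TopologicalSpace X] [ChartedSpace ℂ X]

theorem mdifferentiableAt_mul_const (g k : G) :
    MDifferentiableAt 𝓘(ℂ, E) 𝓘(ℂ, E) (fun k : G => k * g) k :=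
  (contMDiff_mul_right (I := 𝓘(ℂ, E)) (n := ω)).contMDiffAt.mdifferentiableAt (by simp)

theorem mdifferentiableAt_const_mul (g k : G) :
    MDifferentiableAt 𝓘(ℂ, E) 𝓘(ℂ, E) (fun k : G => g * k) k :=
  (contMDiff_mul_left (I := 𝓘(ℂ, E)) (n := ω)).contMDiffAt.mdifferentiableAt (by simp)

theorem mfderiv_mul_right_rightInvariantField (v : E) (g h : G) :
    (mfderiv 𝓘(ℂ, E) 𝓘(ℂ, E) (fun k : G => k * h) g (rightInvariantField (G := G) v g) : E) =
      (rightInvariantField (G := G) v (g * h) : E) := by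
  have hc := mfderiv_comp (I' := 𝓘(ℂ, E)) (1 : G) (g := fun k : G => k * h) (f := fun k : G => k * g)
    (mdifferentiableAt_mul_const h _) (mdifferentiableAt_mul_const g _)
  have he : (fun k : G => k * h) ∘ (fun k : G => k * g) = fun k : G => k * (g * h) := by
    ext k; simp [mul_assoc]
  rw [he, one_mul] at hc
  exact (congrArg (fun L : E →L[ℂ] E => L v) hc).symm

/-- The action of `h` on `X × G` by right translation of the second factor. -/
def rightTranslation (h : G) (p : X × G) : X × G := (p.1, p.2 * h)

theorem contMDiff_rightTranslation (h : G) :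
    ContMDiff (𝓘(ℂ, ℂ).prod 𝓘(ℂ, E)) (𝓘(ℂ, ℂ).prod 𝓘(ℂ, E)) ω
      (rightTranslation (X := X) h) :=
  contMDiff_fst.prodMk ((contMDiff_mul_right (I := 𝓘(ℂ, E)) (n := ω)).comp contMDiff_snd)

theorem mfderiv_rightTranslation (h : G) (p : X × G) (a : ℂ) (w : E) :
    (mfderiv (𝓘(ℂ, ℂ).prod 𝓘(ℂ, E)) (𝓘(ℂ, ℂ).prod 𝓘(ℂ, E)) (rightTranslation h) p
      ((a, w) : ℂ × E) : ℂ × E) =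
      (a, (mfderiv 𝓘(ℂ, E) 𝓘(ℂ, E) (fun k : G => k * h) p.2 w : E)) := by
  have h2 : HasMFDerivAt (𝓘(ℂ, ℂ).prod 𝓘(ℂ, E)) 𝓘(ℂ, E) (fun q : X × G => q.2 * h) p _ :=
    HasMFDerivAt.comp (g := fun k : G => k * h) p
      (mdifferentiableAt_mul_const h p.2).hasMFDerivAt
      (hasMFDerivAt_snd (I := 𝓘(ℂ, ℂ)) (I' := 𝓘(ℂ, E)) p)
  have h3 := HasMFDerivAt.mfderiv
    ((hasMFDerivAt_fst (I := 𝓘(ℂ, ℂ)) (I' := 𝓘(ℂ, E)) p).prodMk h2)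
  exact congrArg (fun L : ℂ × E →L[ℂ] ℂ × E => L (a, w)) h3

/-- The distribution of the system is invariant under right translations. -/
theorem mfderiv_rightTranslation_mem (α : MeromorphicOneForm X E) (h : G) {p : X × G}
    {ζ : TangentSpace (𝓘(ℂ, ℂ).prod 𝓘(ℂ, E)) p} (hζ : ζ ∈ systemDistribution α p) :
    mfderiv (𝓘(ℂ, ℂ).prod 𝓘(ℂ, E)) (𝓘(ℂ, ℂ).prod 𝓘(ℂ, E)) (rightTranslation h) p ζ ∈
      systemDistribution α (rightTranslation h p) := by
  obtain ⟨c, rfl⟩ := Submodule.mem_span_singleton.1 hζ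
  refine Submodule.mem_span_singleton.2 ⟨c, ?_⟩
  rw [map_smul]
  congr 1
  let R : E := rightInvariantField (G := G) (α.leadingCoeff p.1) p.2
  have h1 := mfderiv_rightTranslation h p (0 ^ α.poleOrder p.1) (-R)
  let L : E →L[ℂ] E := mfderiv 𝓘(ℂ, E) 𝓘(ℂ, E) (fun k : G => k * h) p.2
  have h2 : L (-R) = -(rightInvariantField (G := G) (α.leadingCoeff p.1) (p.2 * h) : E) := by
    rw [map_neg]
    exact congrArg Neg.neg (mfderiv_mul_right_rightInvariantField (α.leadingCoeff p.1) p.2 h)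
  exact (h1.trans (congrArg (fun w : E => ((0 : ℂ) ^ α.poleOrder p.1, w)) h2)).symm

/-- The left-invariant vector field on the second factor generated by `v`. -/
def verticalField (v : E) (p : X × G) : TangentSpace (𝓘(ℂ, ℂ).prod 𝓘(ℂ, E)) p :=
  (((0 : ℂ), (mulInvariantVectorField (I := 𝓘(ℂ, E)) (G := G) v p.2 : E)) : ℂ × E)

/-- The derivative of a map along the left-invariant fields, in terms of right translations. -/
theorem mfderiv_comp_rightTranslation {E' : Type*} [NormedAddCommGroup E'] [NormedSpace ℂ E']
    {M' : Type*} [TopologicalSpace M'] [ChartedSpace E' M'] {f : X × G → M'} {p : X × G}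
    (hf : MDifferentiableAt (𝓘(ℂ, ℂ).prod 𝓘(ℂ, E)) 𝓘(ℂ, E') f p) (v : E) :
    (mfderiv 𝓘(ℂ, E) 𝓘(ℂ, E') (fun h : G => f (rightTranslation h p)) (1 : G) v : E') =
      (mfderiv (𝓘(ℂ, ℂ).prod 𝓘(ℂ, E)) 𝓘(ℂ, E') f p
        (verticalField v p) : E') := by
  have h1 : HasMFDerivAt 𝓘(ℂ, E) (𝓘(ℂ, ℂ).prod 𝓘(ℂ, E)) (fun h : G => rightTranslation h p) 1 _ :=
    (hasMFDerivAt_const p.1 (1 : G)).prodMk (mdifferentiableAt_const_mul p.2 1).hasMFDerivAt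
  have hp : rightTranslation 1 p = p := by simp [rightTranslation]
  have h2 := mfderiv_comp (I' := 𝓘(ℂ, ℂ).prod 𝓘(ℂ, E)) (1 : G) (g := f)
    (f := fun h : G => rightTranslation h p) (by rwa [hp]) h1.mdifferentiableAt
  rw [hp, h1.mfderiv] at h2
  exact congrArg (fun L : E →L[ℂ] E' => L v) h2

end Translation

namespace LeafRelation

section LocallyConstant

variable {E : Type*} [NormedAddCommGroup E] [NormedSpace ℂ E]
  {M : Type*} [TopologicalSpace M] [ChartedSpace (ModelProd ℂ E) M]
  {F : ∀ p : M, Submodule ℂ (TangentSpace (𝓘(ℂ, ℂ).prod 𝓘(ℂ, E)) p)} (D : LeafRelation F)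

/-- A property of pairs of points which is locally constant along the leaves holds for any two
points of the same leaf. -/
theorem of_rel_of_eventually {P : M → M → Prop} {i : D.index}
    (hP : ∀ p ∈ D.dom i, ∀ᶠ q in 𝓝 p, (D.β i q).2 = (D.β i p).2 → P p q)
    (htrans : ∀ p q r, P p q → P q r → P p r) (hsymm : ∀ p q, P p q → P q p)
    {p q : M} (hp : p ∈ D.dom i) (hq : q ∈ D.carrier) (h : D.rel p q) : P p q := by
  have hpc := D.dom_subset_carrier i hp
  refine (D.isPreconnected_leaf p hpc).induction₂ P (fun x hx => ?_)
    (fun x y z _ _ _ => htrans x y z) (fun x y _ _ => hsymm x y) ⟨hpc, D.refl hpc⟩ ⟨hq, h⟩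
  have hx1 := (D.rel_iff i p hp x hx.1).1 hx.2
  filter_upwards [nhdsWithin_le_nhds (hP x hx1.1), self_mem_nhdsWithin] with y hy hys
  have hy1 := (D.rel_iff i p hp y hys.1).1 hys.2
  exact hy (by rw [← hx1.2, ← hy1.2])

end LocallyConstant

variable {E : Type*} [NormedAddCommGroup E] [NormedSpace ℂ E]
  {G : Type*} [TopologicalSpace G] [ChartedSpace E G] [Group G] [LieGroup 𝓘(ℂ, E) ω G]
  {X : Type*} [TopologicalSpace X] [ChartedSpace ℂ X]
  {α : MeromorphicOneForm X E} (D : LeafRelation (systemDistribution (G := G) α))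

/-- Near a point, the derivative of the transverse coordinate along a left-invariant field only
depends on the plaque: right translations preserve the distribution. -/
theorem eventually_mfderiv_snd_eq {i : D.index} {p : X × G} (hp : p ∈ (D.β i).source) (v : E) :
    ∀ᶠ q in 𝓝 p, (D.β i q).2 = (D.β i p).2 →
      (mfderiv 𝓘(ℂ, E) 𝓘(ℂ, E) (fun h : G => (D.β i (rightTranslation h q)).2) 1 v : E) =
      (mfderiv 𝓘(ℂ, E) 𝓘(ℂ, E) (fun h : G => (D.β i (rightTranslation h p)).2) 1 v : E) := by
  have := topologicalGroup_of_lieGroup 𝓘(ℂ, E) ω (G := G)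
  have hc : Continuous fun z : (X × G) × G => rightTranslation z.2 z.1 := by
    unfold rightTranslation; fun_prop
  have h1 : ∀ᶠ z in 𝓝 (p, (1 : G)), rightTranslation z.2 z.1 ∈ (D.β i).source :=
    hc.continuousAt ((D.β i).open_source.mem_nhds (by simpa [rightTranslation] using hp))
  rw [nhds_prod_eq] at h1
  obtain ⟨P, hP, Q, hQ, hPQ⟩ := Filter.eventually_prod_iff.1 h1
  obtain ⟨r, hr, hb, hbP⟩ := (D.β i).exists_ball hp hP
  filter_upwards [(D.β i).open_source.mem_nhds hp,
    (D.β i).continuousAt hp (Metric.ball_mem_nhds _ hr)] with q hq hqr hqp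
  have he : (fun h : G => (D.β i (rightTranslation h q)).2) =ᶠ[𝓝 1]
      fun h : G => (D.β i (rightTranslation h p)).2 := by
    filter_upwards [hQ] with h hh
    refine (D.foliated i).eq_of_snd_eq hb (f := fun q => (D.β i (rightTranslation h q)).2)
      (fun z hz => ?_) hq hp hqr (Metric.mem_ball_self hr) hqp
    have hs := hPQ (hbP z hz) hh
    have hd := (D.foliated i).contMDiffAt_snd hs
    have hd2 := (contMDiff_rightTranslation (E := E) (X := X) h).contMDiffAt
      (x := (D.β i).symm z)
    refine ⟨MDifferentiableAt.comp (g := fun q => (D.β i q).2)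
      (I' := 𝓘(ℂ, ℂ).prod 𝓘(ℂ, E)) _ (hd.mdifferentiableAt (by simp))
      (hd2.mdifferentiableAt (by simp)), fun ζ hζ => ?_⟩
    have hcomp := mfderiv_comp (I' := 𝓘(ℂ, ℂ).prod 𝓘(ℂ, E)) ((D.β i).symm z)
      (g := fun q => (D.β i q).2) (f := rightTranslation h)
      (hd.mdifferentiableAt (by simp)) (hd2.mdifferentiableAt (by simp))
    refine (congrArg (fun L : ℂ × E →L[ℂ] E => L ζ) hcomp).trans ?_
    have h3 := (D.foliated i).mfderiv_snd hs
      (mfderiv (𝓘(ℂ, ℂ).prod 𝓘(ℂ, E)) (𝓘(ℂ, ℂ).prod 𝓘(ℂ, E)) (rightTranslation h) _ ζ)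
    rw [((D.foliated i).mem_iff _ hs _).1 (mfderiv_rightTranslation_mem α h hζ)] at h3
    exact h3
  exact congrArg (fun L : E →L[ℂ] E => L v) he.mfderiv_eq

/-- The projection of a left-invariant field is the same at all the points of a leaf. -/
theorem mfderiv_proj_eq_of_rel {p q : X × G} (hp : p ∈ D.carrier) (hq : q ∈ D.carrier)
    (h : D.rel p q) (v : E) :
    (mfderiv (𝓘(ℂ, ℂ).prod 𝓘(ℂ, E)) 𝓘(ℂ, E) D.proj p
      (verticalField v p) : E) =
    (mfderiv (𝓘(ℂ, ℂ).prod 𝓘(ℂ, E)) 𝓘(ℂ, E) D.proj q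
      (verticalField v q) : E) := by
  obtain ⟨i, hi⟩ := D.exists_mem_dom p hp
  have hqi := ((D.rel_iff i p hi q hq).1 h).1
  have hpq : D.proj p = D.proj q := (D.proj_eq_proj_iff hp hq).2 h
  have key := D.of_rel_of_eventually (i := i) (P := fun p q =>
    (mfderiv 𝓘(ℂ, E) 𝓘(ℂ, E) (fun h : G => (D.β i (rightTranslation h q)).2) 1 v : E) =
      (mfderiv 𝓘(ℂ, E) 𝓘(ℂ, E) (fun h : G => (D.β i (rightTranslation h p)).2) 1 v : E))
    (fun p hp => D.eventually_mfderiv_snd_eq (D.dom_subset_source i hp) v)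
    (fun _ _ _ h1 h2 => h2.trans h1) (fun _ _ => Eq.symm) hi hq h
  have hs : ∀ {p : X × G}, p ∈ D.dom i →
      (mfderiv 𝓘(ℂ, E) 𝓘(ℂ, E) (fun h : G => (D.β i (rightTranslation h p)).2) 1 v : E) =
      (mfderiv 𝓘(ℂ, E) 𝓘(ℂ, E) (D.leafChart i) (D.proj p)
      (mfderiv (𝓘(ℂ, ℂ).prod 𝓘(ℂ, E)) 𝓘(ℂ, E) D.proj p
        (verticalField v p)) : E) := by
    intro p hp
    rw [D.mfderiv_leafChart_comp_proj hp, ← (D.foliated i).mfderiv_snd (D.dom_subset_source i hp)]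
    exact mfderiv_comp_rightTranslation (((D.foliated i).contMDiffAt_snd
      (D.dom_subset_source i hp)).mdifferentiableAt (by simp)) v
  rw [hs hi, hs hqi, ← hpq] at key
  exact ((D.mfderiv_leafChart_bijective hi).1 key).symm

/-- The vector field on the space of leaves to which the left-invariant field on `G` generated by
`v` projects. -/
def action (v : E) (z : D.LeafSpace) : TangentSpace 𝓘(ℂ, E) z :=
  (mfderiv (𝓘(ℂ, ℂ).prod 𝓘(ℂ, E)) 𝓘(ℂ, E) D.proj (D.rep z) (verticalField v (D.rep z)) : E)

theorem mfderiv_proj_mulInvariantVectorField {p : X × G} (hp : p ∈ D.carrier)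
    (v : E) :
    mfderiv (𝓘(ℂ, ℂ).prod 𝓘(ℂ, E)) 𝓘(ℂ, E) D.proj p
      (verticalField v p) = D.action v (D.proj p) :=
  D.mfderiv_proj_eq_of_rel hp (D.rep_mem _)
    ((D.proj_eq_proj_iff hp (D.rep_mem _)).1 (D.proj_rep _).symm) v

end LeafRelation

section VectorFieldSmooth

variable {E : Type*} [NormedAddCommGroup E] [NormedSpace ℂ E]
  {M : Type*} [TopologicalSpace M] [ChartedSpace E M] [IsManifold 𝓘(ℂ, E) ω M]

/-- A vector field is analytic near a point if its components in the preferred coordinates are. -/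
theorem contMDiffAt_vectorField {z₀ : M} {V : ∀ z : M, TangentSpace 𝓘(ℂ, E) z} {W : M → E}
    (hW : ContMDiffAt 𝓘(ℂ, E) 𝓘(ℂ, E) ω W z₀)
    (h : ∀ᶠ z in 𝓝 z₀, (mfderiv 𝓘(ℂ, E) 𝓘(ℂ, E) (chartAt E z₀) z (V z) : E) = W z) :
    ContMDiffAt 𝓘(ℂ, E) 𝓘(ℂ, E).tangent ω (fun z => (⟨z, V z⟩ : TangentBundle 𝓘(ℂ, E) M)) z₀ := by
  have : IsManifold 𝓘(ℂ, E) 1 M := IsManifold.of_le (n := ω) (by simp)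
  refine (Bundle.contMDiffAt_section z₀).2 ?_
  refine hW.congr_of_eventuallyEq ?_
  filter_upwards [h, (chartAt E z₀).open_source.mem_nhds (mem_chart_source E z₀)] with z hz hzs
  rw [← hz]
  have h1 := TangentBundle.continuousLinearMapAt_trivializationAt (I := 𝓘(ℂ, E)) hzs
  have h2 : z ∈ (trivializationAt E (TangentSpace 𝓘(ℂ, E)) z₀).baseSet := by
    simpa using hzs
  have h3 := Bundle.Trivialization.continuousLinearMapAt_apply ℂ
    (trivializationAt E (TangentSpace 𝓘(ℂ, E)) z₀) (b := z)
  rw [Bundle.Trivialization.coe_linearMapAt_of_mem _ h2] at h3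
  exact (congrFun h3 (V z)).symm.trans (congrArg (fun L : E →L[ℂ] E => L (V z)) h1)

end VectorFieldSmooth

namespace LeafRelation

section Slice

variable {E : Type*} [NormedAddCommGroup E] [NormedSpace ℂ E]
  {G : Type*} [TopologicalSpace G] [ChartedSpace E G]
  {X : Type*} [TopologicalSpace X] [ChartedSpace ℂ X]
  {F : ∀ p : X × G, Submodule ℂ (TangentSpace (𝓘(ℂ, ℂ).prod 𝓘(ℂ, E)) p)} (D : LeafRelation F)

theorem mfderiv_proj_prodMk {p : X × G} (hp : p ∈ D.carrier) (w : E) :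
    (mfderiv 𝓘(ℂ, E) 𝓘(ℂ, E) (fun g : G => D.proj (p.1, g)) p.2 w : E) =
      (mfderiv (𝓘(ℂ, ℂ).prod 𝓘(ℂ, E)) 𝓘(ℂ, E) D.proj p (((0 : ℂ), w) : ℂ × E) : E) := by
  have h1 : HasMFDerivAt 𝓘(ℂ, E) (𝓘(ℂ, ℂ).prod 𝓘(ℂ, E)) (fun g : G => (p.1, g)) p.2 _ :=
    (hasMFDerivAt_const p.1 p.2).prodMk (hasMFDerivAt_id p.2)
  have h2 := mfderiv_comp (I' := 𝓘(ℂ, ℂ).prod 𝓘(ℂ, E)) p.2 (g := D.proj)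
    (f := fun g : G => (p.1, g)) ((D.contMDiffAt_proj hp).mdifferentiableAt (by simp))
    h1.mdifferentiableAt
  rw [h1.mfderiv] at h2
  exact congrArg (fun L : E →L[ℂ] E => L w) h2

end Slice

variable {E : Type*} [NormedAddCommGroup E] [NormedSpace ℂ E]
  {G : Type*} [TopologicalSpace G] [ChartedSpace E G] [Group G] [LieGroup 𝓘(ℂ, E) ω G]
  {X : Type*} [TopologicalSpace X] [ChartedSpace ℂ X]
  {α : MeromorphicOneForm X E} (D : LeafRelation (systemDistribution (G := G) α))

/-- The action of the Lie algebra, read in the coordinates at a point, depends analytically on the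
point. -/
theorem exists_contMDiffAt_action [IsManifold 𝓘(ℂ, ℂ) ω X] {p : X × G} (hp : p ∈ D.carrier) :
    ∃ B : D.LeafSpace → E →L[ℂ] E, ContMDiffAt 𝓘(ℂ, E) 𝓘(ℂ, E →L[ℂ] E) ω B (D.proj p) ∧
      ∀ᶠ z in 𝓝 (D.proj p), ∀ v : E,
        (mfderiv 𝓘(ℂ, E) 𝓘(ℂ, E) (chartAt E (D.proj p)) z (D.action v z) : E) = B z v := by
  obtain ⟨i, hi, hci⟩ := D.exists_chartAt_proj_eq hp
  obtain ⟨s, hs, hsp, hev⟩ := D.exists_section hp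
  refine ⟨partialDeriv (fun q : D.LeafSpace × G => (D.β i (rightTranslation q.2 (s q.1))).2) 1,
    ContMDiffAt.partialDeriv (J := 𝓘(ℂ, E)) ?_, ?_⟩
  · refine ContMDiffAt.comp (g := fun q => (D.β i q).2) (I' := 𝓘(ℂ, ℂ).prod 𝓘(ℂ, E))
      (D.proj p, (1 : G)) ?_ ?_
    · refine (D.foliated i).contMDiffAt_snd ?_
      simpa [rightTranslation, hsp] using D.dom_subset_source i hi
    · have h1 : ContMDiffAt (𝓘(ℂ, E).prod 𝓘(ℂ, E)) (𝓘(ℂ, ℂ).prod 𝓘(ℂ, E)) ω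
          (fun q : D.LeafSpace × G => s q.1) (D.proj p, (1 : G)) :=
        ContMDiffAt.comp (g := s) (I' := 𝓘(ℂ, E)) (D.proj p, (1 : G)) hs contMDiffAt_fst
      exact (contMDiffAt_fst.comp _ h1).prodMk ((contMDiffAt_snd.comp _ h1).mul contMDiffAt_snd)
  · have h1 : ∀ᶠ z in 𝓝 (D.proj p), s z ∈ D.dom i :=
      hs.continuousAt (by rw [hsp]; exact (D.isOpen_dom i).mem_nhds hi)
    filter_upwards [hev, h1] with z hz hzi v
    have h2 := D.mfderiv_leafChart_comp_proj hzi (verticalField v (s z))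
    rw [D.mfderiv_proj_mulInvariantVectorField hz.1, hz.2] at h2
    rw [hci, h2, ← (D.foliated i).mfderiv_snd (D.dom_subset_source i hzi)]
    exact (mfderiv_comp_rightTranslation (((D.foliated i).contMDiffAt_snd
      (D.dom_subset_source i hzi)).mdifferentiableAt (by simp)) v).symm

theorem contMDiff_action [IsManifold 𝓘(ℂ, ℂ) ω X] (v : E) :
    ContMDiff 𝓘(ℂ, E) 𝓘(ℂ, E).tangent ω
      (fun z => (⟨z, D.action v z⟩ : TangentBundle 𝓘(ℂ, E) D.LeafSpace)) := by
  intro z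
  obtain ⟨p, hp, rfl⟩ := D.exists_proj_eq z
  obtain ⟨B, hB, hev⟩ := D.exists_contMDiffAt_action hp
  exact contMDiffAt_vectorField (hB.clm_apply contMDiffAt_const)
    (hev.mono fun z hz => hz v)

/-- The fields `D.action v` depend linearly on `v`. -/
def actionLinear : GroupLieAlgebra 𝓘(ℂ, E) G →ₗ[ℂ] (∀ z : D.LeafSpace, TangentSpace 𝓘(ℂ, E) z) where
  toFun v := D.action (E := E) v
  map_add' v w := by
    funext z
    have h : verticalField (E := E) (v + w) (D.rep z) =
        verticalField (E := E) v (D.rep z) + verticalField (E := E) w (D.rep z) := by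
      have h1 := congrFun (mulInvariantVectorField_add v w) (D.rep z).2
      exact Prod.ext (add_zero (0 : ℂ)).symm h1
    exact (congrArg _ h).trans (map_add (mfderiv _ 𝓘(ℂ, E) D.proj (D.rep z)) _ _)
  map_smul' c v := by
    funext z
    have h : verticalField (E := E) (c • v) (D.rep z) =
        c • verticalField (E := E) v (D.rep z) := by
      have h1 := congrFun (mulInvariantVectorField_smul c v) (D.rep z).2
      exact Prod.ext (mul_zero c).symm h1
    exact (congrArg _ h).trans (map_smul (mfderiv _ 𝓘(ℂ, E) D.proj (D.rep z)) _ _)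

/-- The map from the Lie algebra to vector fields on the space of leaves is a homomorphism. -/
theorem action_lie [IsManifold 𝓘(ℂ, ℂ) ω X] [CompleteSpace E] (v w : GroupLieAlgebra 𝓘(ℂ, E) G)
    (z : D.LeafSpace) : D.action (E := E) (⁅v, w⁆ : GroupLieAlgebra 𝓘(ℂ, E) G) z =
      mlieBracket 𝓘(ℂ, E) (D.action (E := E) v) (D.action (E := E) w) z := by
  obtain ⟨p, hp, rfl⟩ := D.exists_proj_eq z
  set j : G → D.LeafSpace := fun g => D.proj (p.1, g) with hj
  have hjs : ContMDiffAt 𝓘(ℂ, E) 𝓘(ℂ, E) ω j p.2 :=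
    ContMDiffAt.comp (g := D.proj) (I' := 𝓘(ℂ, ℂ).prod 𝓘(ℂ, E)) p.2 (D.contMDiffAt_proj hp)
      (contMDiffAt_const.prodMk contMDiffAt_id)
  have hrel : ∀ v : E, ∀ᶠ g in 𝓝 p.2, mfderiv 𝓘(ℂ, E) 𝓘(ℂ, E) j g
      (mulInvariantVectorField (I := 𝓘(ℂ, E)) (G := G) v g) = D.action v (j g) := by
    intro v
    have hc : Continuous fun g : G => (p.1, g) := by fun_prop
    filter_upwards [hc.continuousAt (D.isOpen_carrier.mem_nhds hp)] with g hg
    have h1 := D.mfderiv_proj_prodMk (p := (p.1, g)) hg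
      (mulInvariantVectorField (I := 𝓘(ℂ, E)) (G := G) v g)
    exact h1.trans (D.mfderiv_proj_mulInvariantVectorField (p := (p.1, g)) hg v)
  have hd : ∀ v : E, MDifferentiableAt 𝓘(ℂ, E) 𝓘(ℂ, E).tangent
      (fun z => (⟨z, D.action v z⟩ : TangentBundle 𝓘(ℂ, E) D.LeafSpace)) (j p.2) :=
    fun v => (D.contMDiff_action v).contMDiffAt.mdifferentiableAt (by simp)
  have key := mfderiv_mlieBracket_eq_of_related hjs
    (mdifferentiableAt_mulInvariantVectorField v) (mdifferentiableAt_mulInvariantVectorField w)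
    (hd v) (hd w) (hrel v) (hrel w)
  have h3 := congrFun (mulInvariantVector_mlieBracket v w) p.2
  rw [← GroupLieAlgebra.bracket_def] at h3
  rw [← h3] at key
  exact ((hrel (⁅v, w⁆ : GroupLieAlgebra 𝓘(ℂ, E) G)).self_of_nhds).symm.trans key

end LeafRelation

/-! ### The poles along the leaves -/

section ODE

/-- A solution of a linear homogeneous equation which vanishes at a point vanishes near it. -/
theorem eventually_eq_zero_of_hasDerivAt_mul {f c : ℂ → ℂ} {t₀ : ℂ} (hf : AnalyticAt ℂ f t₀)
    (h0 : f t₀ = 0) (hc : ContinuousAt c t₀)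
    (hd : ∀ᶠ t in 𝓝 t₀, HasDerivAt f (c t * f t) t) : ∀ᶠ t in 𝓝 t₀, f t = 0 := by
  by_contra hne
  -- otherwise the order of vanishing of `f'` would be one less than that of `f`
  obtain ⟨n, g, hg, hg0, hfg⟩ := hf.exists_eventuallyEq_pow_smul_nonzero_iff.2 hne
  have hn : n ≠ 0 := by
    rintro rfl
    have := hfg.self_of_nhds
    rw [h0, pow_zero, one_smul] at this
    exact hg0 this.symm
  obtain ⟨m, rfl⟩ := Nat.exists_eq_succ_of_ne_zero hn
  have h1 : ∀ᶠ t in 𝓝[≠] t₀, ((m : ℂ) + 1) * g t + (t - t₀) * deriv g t =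
      c t * ((t - t₀) * g t) := by
    filter_upwards [nhdsWithin_le_nhds hd, nhdsWithin_le_nhds hfg.eventually_nhds,
      nhdsWithin_le_nhds hg.eventually_analyticAt, self_mem_nhdsWithin] with t ht hft hgt hne
    have h2 : HasDerivAt f (((m + 1 : ℕ) : ℂ) * (t - t₀) ^ m * 1 * g t +
        (t - t₀) ^ (m + 1) * deriv g t) t := by
      have := (((hasDerivAt_id t).sub_const t₀).pow (m + 1)).mul
        hgt.differentiableAt.hasDerivAt
      exact this.congr_of_eventuallyEq hft
    have h3 := ht.unique h2
    rw [hft.self_of_nhds, smul_eq_mul] at h3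
    have h4 : (t - t₀) ^ m ≠ 0 := pow_ne_zero _ (sub_ne_zero.2 hne)
    refine mul_left_cancel₀ h4 ?_
    push_cast at h3
    rw [pow_succ] at h3
    linear_combination -h3
  have h2 : Filter.Tendsto (fun t => ((m : ℂ) + 1) * g t + (t - t₀) * deriv g t) (𝓝 t₀)
      (𝓝 (((m : ℂ) + 1) * g t₀ + (t₀ - t₀) * deriv g t₀)) :=
    (continuousAt_const.mul hg.continuousAt).add
      ((continuousAt_id.sub continuousAt_const).mul hg.deriv.continuousAt)
  have h3 : Filter.Tendsto (fun t => c t * ((t - t₀) * g t)) (𝓝 t₀)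
      (𝓝 (c t₀ * ((t₀ - t₀) * g t₀))) :=
    hc.mul ((continuousAt_id.sub continuousAt_const).mul hg.continuousAt)
  have h4 := tendsto_nhds_unique_of_eventuallyEq (h2.mono_left nhdsWithin_le_nhds)
    (h3.mono_left nhdsWithin_le_nhds) h1
  rw [sub_self, zero_mul, zero_mul, mul_zero, add_zero] at h4
  exact mul_ne_zero (Nat.cast_add_one_ne_zero m) hg0 h4

/-- A curve tangent to a field whose first component vanishes on a hyperplane, and whose second
component does not vanish, stays in the hyperplane if it meets it. -/
theorem eventually_fst_eq_of_hasDerivAt_smul {E : Type*} [NormedAddCommGroup E] [NormedSpace ℂ E]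
    [CompleteSpace E]
    {w : ℂ → ℂ × E} {Y : ℂ × E → E} {t₀ c : ℂ} {k : ℕ} (hw : AnalyticAt ℂ w t₀)
    (hwc : (w t₀).1 = c) (hY : ContinuousAt Y (w t₀)) (hY0 : Y (w t₀) ≠ 0) (hk : k ≠ 0)
    (hd : ∀ᶠ t in 𝓝 t₀, ∃ μ : ℂ, HasDerivAt w (μ • (((w t).1 - c) ^ k, Y (w t))) t) :
    ∀ᶠ t in 𝓝 t₀, (w t).1 = c := by
  obtain ⟨l, hl⟩ := SeparatingDual.exists_eq_one (R := ℂ) hY0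
  have hm : ContinuousAt (fun t => l (Y (w t))) t₀ :=
    l.continuous.continuousAt.comp (ContinuousAt.comp (g := Y) hY hw.continuousAt)
  have hm0 : ∀ᶠ t in 𝓝 t₀, l (Y (w t)) ≠ 0 :=
    hm.eventually_ne (by rw [hl]; exact one_ne_zero)
  have hfst : AnalyticAt ℂ (fun t => (w t).1 - c) t₀ :=
    (analyticAt_fst.comp hw).sub analyticAt_const
  -- the factor of proportionality is recovered from the second component
  have key := eventually_eq_zero_of_hasDerivAt_mul hfst (sub_eq_zero.2 hwc)
    (c := fun t => l (deriv w t).2 / l (Y (w t)) * ((w t).1 - c) ^ (k - 1)) (by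
      refine ContinuousAt.mul (ContinuousAt.div ?_ hm (by rw [hl]; exact one_ne_zero))
        (hfst.continuousAt.pow _)
      exact l.continuous.continuousAt.comp (continuousAt_snd.comp hw.deriv.continuousAt)) (by
      filter_upwards [hd, hm0] with t ⟨μ, hμ⟩ ht
      have h1 : HasDerivAt (fun t => (w t).1 - c) (μ * ((w t).1 - c) ^ k) t := by
        have := (hasFDerivAt_fst (𝕜 := ℂ) (p := w t)).comp_hasDerivAt t hμ
        exact this.sub_const c
      convert h1 using 1
      rw [hμ.deriv, Prod.smul_mk, map_smul, smul_eq_mul, mul_div_cancel_right₀ _ ht, mul_assoc,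
        ← pow_succ, Nat.sub_add_cancel (Nat.one_le_iff_ne_zero.2 hk)])
  filter_upwards [key] with t ht using sub_eq_zero.1 ht

end ODE

namespace LeafRelation

variable {E : Type*} [NormedAddCommGroup E] [NormedSpace ℂ E] [CompleteSpace E]
  {G : Type*} [TopologicalSpace G] [ChartedSpace E G] [Group G] [LieGroup 𝓘(ℂ, E) ω G]
  {X : Type*} [TopologicalSpace X] [ChartedSpace ℂ X] [IsManifold 𝓘(ℂ, ℂ) ω X]
  {α : MeromorphicOneForm X E} (D : LeafRelation (systemDistribution (G := G) α))

/-- Near a point above a pole, the plaque through that point stays above the pole. -/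
theorem eventually_fst_eq (hα : ∀ x, ¬ α.IsZero x) {i : D.index} {p : X × G}
    (hp : p ∈ (D.β i).source) (ha : α.IsPole p.1) :
    ∀ᶠ q in 𝓝 p, (D.β i q).2 = (D.β i p).2 → q.1 = p.1 := by
  obtain ⟨a, g⟩ := p
  obtain ⟨Y, hY, hY0, hev⟩ := exists_analytic_systemField (G := G) α hα a
  set χ := productChart (E := E) G a with hχ
  set β := D.β i with hβ
  set t₀ := (β (a, g)).1 with ht₀
  set b := (β (a, g)).2 with hb
  set γ : ℂ → X × G := fun t => β.symm (t, b) with hγ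
  have hγ₀ : γ t₀ = (a, g) := β.left_inv hp
  have htgt : (t₀, b) ∈ β.target := β.map_source hp
  have hr₀ : rightTranslation g⁻¹ (γ t₀) = (a, 1) := by simp [hγ₀, rightTranslation]
  -- the plaque, translated so as to pass through `(a, 1)`, in the product coordinates there
  set H : X × G → ℂ × E := fun q => χ (rightTranslation g⁻¹ q) with hH
  set w : ℂ → ℂ × E := fun t => H (γ t) with hwdef
  have hwt₀ : w t₀ = χ (a, 1) := by simp only [hwdef, hH, hr₀]
  have hHs : ∀ q, rightTranslation g⁻¹ q ∈ χ.source →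
      ContMDiffAt (𝓘(ℂ, ℂ).prod 𝓘(ℂ, E)) 𝓘(ℂ, ℂ × E) ω H q := fun q hq =>
    ContMDiffAt.comp (g := χ) (I' := 𝓘(ℂ, ℂ).prod 𝓘(ℂ, E)) q
      ((contMDiffOn_productChart a).contMDiffAt (χ.open_source.mem_nhds hq))
      (contMDiff_rightTranslation g⁻¹).contMDiffAt
  have hγc : ContMDiffAt 𝓘(ℂ, ℂ) (𝓘(ℂ, ℂ).prod 𝓘(ℂ, E)) ω γ t₀ :=
    (D.foliated i).contMDiffAt_plaque htgt
  have hrc : Filter.Tendsto (fun t => rightTranslation g⁻¹ (γ t)) (𝓝 t₀) (𝓝 (a, 1)) := by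
    have h1 := ((contMDiff_rightTranslation (E := E) (X := X) g⁻¹).continuous.continuousAt
      (x := γ t₀)).comp hγc.continuousAt
    rw [← hr₀]
    exact h1
  have hws : AnalyticAt ℂ w t₀ := by
    refine ContDiffAt.analyticAt (contMDiffAt_iff_contDiffAt.1 ?_)
    refine ContMDiffAt.comp (g := H) (I' := 𝓘(ℂ, ℂ).prod 𝓘(ℂ, E)) t₀ (hHs _ ?_) hγc
    rw [hr₀]; exact mem_productChart_source
  have hd : ∀ᶠ t in 𝓝 t₀, ∃ μ : ℂ, HasDerivAt w
      (μ • (((w t).1 - chartAt ℂ a a) ^ α.poleOrder a, Y (w t))) t := by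
    have hc : Continuous fun t : ℂ => (t, b) := by fun_prop
    filter_upwards [hc.continuousAt (β.open_target.mem_nhds htgt), hrc.eventually hev,
      hrc.eventually (χ.open_source.mem_nhds mem_productChart_source)] with t ht ⟨u, hu, htu⟩ hts
    have h1 := (D.foliated i).hasDerivAt_comp_plaque ht (f := H)
      ((hHs _ hts).mdifferentiableAt (by simp))
    have h2 := mfderiv_rightTranslation_mem α g⁻¹ ((D.foliated i).mfderiv_plaque_mem ht)
    obtain ⟨lam, hlam⟩ := Submodule.mem_span_singleton.1 h2
    have h3 := mfderiv_comp (I' := 𝓘(ℂ, ℂ).prod 𝓘(ℂ, E)) (β.symm (t, b)) (g := χ)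
      (f := rightTranslation g⁻¹)
      (((contMDiffOn_productChart a).contMDiffAt (χ.open_source.mem_nhds hts)).mdifferentiableAt
        (by simp)) ((contMDiff_rightTranslation g⁻¹).contMDiffAt.mdifferentiableAt (by simp))
    refine ⟨lam * u, ?_⟩
    let L : ℂ × E →L[ℂ] ℂ × E :=
      mfderiv (𝓘(ℂ, ℂ).prod 𝓘(ℂ, E)) 𝓘(ℂ, ℂ × E) χ (rightTranslation g⁻¹ (γ t))
    let η : ℂ × E :=
      mfderiv 𝓘(ℂ, ℂ) (𝓘(ℂ, ℂ).prod 𝓘(ℂ, E)) (fun t => β.symm (t, b)) t (1 : ℂ)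
    let S : ℂ × E := systemField α (rightTranslation g⁻¹ (γ t))
    have h4 : (mfderiv (𝓘(ℂ, ℂ).prod 𝓘(ℂ, E)) 𝓘(ℂ, ℂ × E) H (β.symm (t, b)) η : ℂ × E) =
        L (lam • S) :=
      (congrArg (fun L : ℂ × E →L[ℂ] ℂ × E => L η) h3).trans (congrArg L hlam).symm
    refine h1.congr_deriv (h4.trans ?_)
    have h5 : L S = u • (((w t).1 - chartAt ℂ a a) ^ α.poleOrder a, Y (w t)) := htu
    rw [map_smul, h5, smul_smul]
  have key := eventually_fst_eq_of_hasDerivAt_smul hws (by rw [hwt₀]; rfl)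
    (by rw [hwt₀]; exact hY.continuousAt) (by rwa [hwt₀]) ((α.isPole_iff (hα a)).1 ha) hd
  have hβc : ContinuousAt (fun q => (β q).1) (a, g) :=
    continuous_fst.continuousAt.comp (β.continuousAt hp)
  filter_upwards [hβc.eventually key, β.open_source.mem_nhds hp,
    (continuous_fst.continuousAt (x := (a, g))) ((chartAt ℂ a).open_source.mem_nhds
      (mem_chart_source ℂ a))] with q hq hqs hqa hqb
  have hγq : γ (β q).1 = q := by
    simp only [hγ]
    rw [← hqb]
    exact β.left_inv hqs
  have h1 : chartAt ℂ a q.1 = chartAt ℂ a a := by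
    have : (w (β q).1).1 = chartAt ℂ a q.1 := by simp only [hwdef, hγq]; rfl
    rw [← this, hq]
  exact (chartAt ℂ a).injOn hqa (mem_chart_source ℂ a) h1

/-- A leaf with a point above a pole lies entirely above that pole. -/
theorem fst_eq_iff_of_rel [T1Space X] (hα : ∀ x, ¬ α.IsZero x) {a : X} (ha : α.IsPole a)
    {p q : X × G} (hp : p ∈ D.carrier) (hq : q ∈ D.carrier) (h : D.rel p q) :
    p.1 = a ↔ q.1 = a := by
  obtain ⟨i, hi⟩ := D.exists_mem_dom p hp
  refine D.of_rel_of_eventually (P := fun p q => p.1 = a ↔ q.1 = a) (i := i) (fun p hp => ?_)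
    (fun _ _ _ => Iff.trans) (fun _ _ => Iff.symm) hi hq h
  by_cases hpa : p.1 = a
  · subst hpa
    filter_upwards [D.eventually_fst_eq hα (D.dom_subset_source i hp) ha] with q hq hqp
    simp [hq hqp]
  · filter_upwards [continuous_fst.continuousAt (x := p) |>.eventually_ne hpa] with q hq _
    simp [hpa, hq]

end LeafRelation

/-! ### Left- and right-invariant fields -/

section AtOne

variable {E : Type*} [NormedAddCommGroup E] [NormedSpace ℂ E]
  {G : Type*} [TopologicalSpace G] [ChartedSpace E G] [Group G]

theorem mulInvariantVectorField_at_one (v : E) :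
    (mulInvariantVectorField (I := 𝓘(ℂ, E)) (G := G) v 1 : E) = v := by
  have h : mfderiv 𝓘(ℂ, E) 𝓘(ℂ, E) (fun k : G => 1 * k) 1 = mfderiv 𝓘(ℂ, E) 𝓘(ℂ, E) id (1 : G) :=
    Filter.EventuallyEq.mfderiv_eq (Filter.Eventually.of_forall fun k => one_mul k)
  rw [mfderiv_id] at h
  exact congrArg (fun L : E →L[ℂ] E => L v) h

theorem rightInvariantField_at_one (v : E) : (rightInvariantField (G := G) v 1 : E) = v := by
  have h : mfderiv 𝓘(ℂ, E) 𝓘(ℂ, E) (fun k : G => k * 1) 1 = mfderiv 𝓘(ℂ, E) 𝓘(ℂ, E) id (1 : G) :=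
    Filter.EventuallyEq.mfderiv_eq (Filter.Eventually.of_forall fun k => mul_one k)
  rw [mfderiv_id] at h
  exact congrArg (fun L : E →L[ℂ] E => L v) h

end AtOne

section Adjoint

variable {E : Type*} [NormedAddCommGroup E] [NormedSpace ℂ E]
  {G : Type*} [TopologicalSpace G] [ChartedSpace E G] [Group G] [LieGroup 𝓘(ℂ, E) ω G]

theorem mfderiv_inv_mul_mulInvariantVectorField (v : E) (g : G) :
    (mfderiv 𝓘(ℂ, E) 𝓘(ℂ, E) (fun k : G => g⁻¹ * k) g
      (mulInvariantVectorField (I := 𝓘(ℂ, E)) (G := G) v g) : E) = v := by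
  have h := mfderiv_comp (I' := 𝓘(ℂ, E)) (1 : G) (g := fun k : G => g⁻¹ * k)
    (f := fun k : G => g * k) (mdifferentiableAt_const_mul g⁻¹ _) (mdifferentiableAt_const_mul g _)
  have he : (fun k : G => g⁻¹ * k) ∘ (fun k : G => g * k) = id := by ext k; simp
  rw [he, mfderiv_id, mul_one] at h
  exact (congrArg (fun L : E →L[ℂ] E => L v) h).symm

theorem mulInvariantVectorField_injective {v w : E} {g : G}
    (h : (mulInvariantVectorField (I := 𝓘(ℂ, E)) (G := G) v g : E) =
      mulInvariantVectorField (I := 𝓘(ℂ, E)) (G := G) w g) : v = w := by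
  rw [← mfderiv_inv_mul_mulInvariantVectorField v g,
    ← mfderiv_inv_mul_mulInvariantVectorField w g]
  exact congrArg (mfderiv 𝓘(ℂ, E) 𝓘(ℂ, E) (fun k : G => g⁻¹ * k) g) h

/-- The adjoint action of `g⁻¹` on the Lie algebra. -/
def adInv (g : G) : E →L[ℂ] E := mfderiv 𝓘(ℂ, E) 𝓘(ℂ, E) (fun h : G => g⁻¹ * (h * g)) 1

theorem mulInvariantVectorField_adInv (v : E) (g : G) :
    (mulInvariantVectorField (I := 𝓘(ℂ, E)) (G := G) (adInv (E := E) g v) g : E) =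
      rightInvariantField (G := G) v g := by
  have h := mfderiv_comp (I' := 𝓘(ℂ, E)) (1 : G) (g := fun k : G => g * k)
    (f := fun h : G => g⁻¹ * (h * g)) (mdifferentiableAt_const_mul g _)
    ((mdifferentiableAt_const_mul g⁻¹ _).comp (1 : G) (mdifferentiableAt_mul_const g _))
  have he : (fun k : G => g * k) ∘ (fun h : G => g⁻¹ * (h * g)) = fun h : G => h * g := by
    ext k; simp
  have h1 : g⁻¹ * (1 * g) = 1 := by simp
  rw [he, h1] at h
  exact (congrArg (fun L : E →L[ℂ] E => L v) h).symm

theorem adInv_injective (g : G) : Function.Injective (adInv (E := E) g) := by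
  intro v w h
  have h1 : (rightInvariantField (G := G) v g : E) = rightInvariantField (G := G) w g := by
    rw [← mulInvariantVectorField_adInv, ← mulInvariantVectorField_adInv, h]
  have h2 := congrArg (mfderiv 𝓘(ℂ, E) 𝓘(ℂ, E) (fun k : G => k * g⁻¹) g : E →L[ℂ] E) h1
  have hv := mfderiv_mul_right_rightInvariantField v g g⁻¹
  have hw := mfderiv_mul_right_rightInvariantField w g g⁻¹
  rw [mul_inv_cancel, rightInvariantField_at_one] at hv hw
  exact hv.symm.trans (h2.trans hw)

theorem adInv_one (v : E) : adInv (1 : G) v = v := by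
  refine mulInvariantVectorField_injective (g := (1 : G)) ?_
  rw [mulInvariantVectorField_adInv, rightInvariantField_at_one, mulInvariantVectorField_at_one]

theorem contMDiffAt_adInv (g : G) :
    ContMDiffAt 𝓘(ℂ, E) 𝓘(ℂ, E →L[ℂ] E) ω (adInv (E := E) (G := G)) g := by
  have h : (partialDeriv (fun q : G × G => chartAt E (1 : G) (q.1⁻¹ * (q.2 * q.1))) 1 :
      G → E →L[ℂ] E) = adInv (E := E) (G := G) := by
    funext g
    ext v
    have h1 : g⁻¹ * (1 * g) = 1 := by simp
    have hc := mfderiv_comp (I' := 𝓘(ℂ, E)) (1 : G) (g := chartAt E (1 : G))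
      (f := fun h : G => g⁻¹ * (h * g))
      (by rw [h1]; exact (contMDiffAt_chartAt_one (mem_chart_source E 1)).mdifferentiableAt
            (by simp))
      ((mdifferentiableAt_const_mul g⁻¹ _).comp (1 : G) (mdifferentiableAt_mul_const g _))
    rw [h1] at hc
    exact (congrArg (fun L : E →L[ℂ] E => L v) hc).trans (mfderiv_chartAt_self (1 : G) _)
  rw [← h]
  refine ContMDiffAt.partialDeriv (J := 𝓘(ℂ, E)) ?_
  refine ContMDiffAt.comp (g := chartAt E (1 : G)) (I' := 𝓘(ℂ, E)) (g, (1 : G)) ?_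
    (contMDiffAt_fst.inv.mul (contMDiffAt_snd.mul contMDiffAt_fst))
  refine contMDiffAt_chartAt_one ?_
  simp

end Adjoint

/-! ### Kernel and image of the infinitesimal action -/

namespace LeafRelation

variable {E : Type*} [NormedAddCommGroup E] [NormedSpace ℂ E]
  {G : Type*} [TopologicalSpace G] [ChartedSpace E G] [Group G] [LieGroup 𝓘(ℂ, E) ω G]
  {X : Type*} [TopologicalSpace X] [ChartedSpace ℂ X]
  {α : MeromorphicOneForm X E} (D : LeafRelation (systemDistribution (G := G) α))

/-- The equation of the system: the horizontal field `z ^ k ∂_z` and the vertical field generated by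
the leading coefficient have the same projection. -/
theorem mfderiv_proj_horizontal {p : X × G} (hp : p ∈ D.carrier) :
    (mfderiv (𝓘(ℂ, ℂ).prod 𝓘(ℂ, E)) 𝓘(ℂ, E) D.proj p ((0 ^ α.poleOrder p.1, 0) : ℂ × E) : E) =
      D.action (adInv p.2 (α.leadingCoeff p.1)) (D.proj p) := by
  have h1 := (D.mfderiv_proj_eq_zero_iff hp _).2 (Submodule.mem_span_singleton_self (systemField α p))
  let L : ℂ × E →L[ℂ] E := mfderiv (𝓘(ℂ, ℂ).prod 𝓘(ℂ, E)) 𝓘(ℂ, E) D.proj p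
  let S : ℂ × E := systemField α p
  let W : ℂ × E := verticalField (adInv (E := E) p.2 (α.leadingCoeff p.1)) p
  have h2 : L S = 0 := h1
  have h3 : S = (0 ^ α.poleOrder p.1, 0) - W := by
    refine Prod.ext (sub_zero ((0 : ℂ) ^ α.poleOrder p.1)).symm ?_
    have h := mulInvariantVectorField_adInv (α.leadingCoeff p.1) p.2
    exact (congrArg Neg.neg h.symm).trans (zero_sub _).symm
  rw [h3, map_sub, sub_eq_zero] at h2
  exact h2.trans (D.mfderiv_proj_mulInvariantVectorField hp _)

theorem action_eq_zero_iff {p : X × G} (hp : p ∈ D.carrier) (v : E) :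
    D.action v (D.proj p) = 0 ↔ verticalField v p ∈ systemDistribution α p := by
  rw [← D.mfderiv_proj_mulInvariantVectorField hp, D.mfderiv_proj_eq_zero_iff hp]

theorem eq_zero_of_action_eq_zero {p : X × G} (hp : p ∈ D.carrier) (hk : α.poleOrder p.1 = 0)
    {v : E} (hv : D.action v (D.proj p) = 0) : v = 0 := by
  obtain ⟨c, hc⟩ := Submodule.mem_span_singleton.1 ((D.action_eq_zero_iff hp v).1 hv)
  have h1 : c * 0 ^ α.poleOrder p.1 = 0 := congrArg (fun w : ℂ × E => w.1) hc
  rw [hk, pow_zero, mul_one] at h1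
  rw [h1, zero_smul] at hc
  have h2 : (0 : E) = mulInvariantVectorField (I := 𝓘(ℂ, E)) (G := G) v p.2 :=
    congrArg (fun w : ℂ × E => w.2) hc
  rw [← mfderiv_inv_mul_mulInvariantVectorField v p.2, ← h2]
  exact map_zero (mfderiv 𝓘(ℂ, E) 𝓘(ℂ, E) (fun k : G => p.2⁻¹ * k) p.2)

/-- The infinitesimal action fails to be an isomorphism exactly above the poles. -/
theorem action_bijective_iff [FiniteDimensional ℂ E] (hα : ∀ x, ¬ α.IsZero x) {p : X × G}
    (hp : p ∈ D.carrier) :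
    Function.Bijective (fun v : E => (D.action v (D.proj p) : E)) ↔ ¬ α.IsPole p.1 := by
  let L : E →ₗ[ℂ] E := (LinearMap.proj (D.proj p)) ∘ₗ D.actionLinear
  have hL : ∀ v, L v = D.action v (D.proj p) := fun _ => rfl
  rw [α.isPole_iff (hα p.1), not_not]
  change Function.Bijective L ↔ _
  constructor
  · intro h
    by_contra hk
    have h1 := D.mfderiv_proj_horizontal hp
    rw [zero_pow hk] at h1
    have h2 : L (adInv p.2 (α.leadingCoeff p.1)) = L 0 := by
      rw [map_zero, hL, ← h1]
      exact map_zero (mfderiv (𝓘(ℂ, ℂ).prod 𝓘(ℂ, E)) 𝓘(ℂ, E) D.proj p)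
    have h3 := h.1 h2
    rw [← map_zero (adInv (E := E) p.2)] at h3
    exact α.leadingCoeff_ne_zero (hα p.1) (adInv_injective _ h3)
  · intro hk
    have hinj : Function.Injective L := (injective_iff_map_eq_zero L).2 fun v hv =>
      D.eq_zero_of_action_eq_zero hp hk hv
    exact ⟨hinj, LinearMap.injective_iff_surjective.1 hinj⟩

end LeafRelation

/-! ### The curve and the singular hypersurfaces -/

namespace LeafRelation

section Curve

variable {E : Type*} [NormedAddCommGroup E] [NormedSpace ℂ E]
  {G : Type*} [TopologicalSpace G] [ChartedSpace E G] [Group G]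
  {X : Type*} [TopologicalSpace X] [ChartedSpace ℂ X]
  {F : ∀ p : X × G, Submodule ℂ (TangentSpace (𝓘(ℂ, ℂ).prod 𝓘(ℂ, E)) p)} (D : LeafRelation F)

/-- The image of the identity section in the space of leaves. -/
def curve (x : X) : D.LeafSpace := D.proj (x, 1)

theorem contMDiff_curve (h1 : ∀ x : X, (x, (1 : G)) ∈ D.carrier) :
    ContMDiff 𝓘(ℂ, ℂ) 𝓘(ℂ, E) ω D.curve := fun x =>
  ContMDiffAt.comp (g := D.proj) (I' := 𝓘(ℂ, ℂ).prod 𝓘(ℂ, E)) x (D.contMDiffAt_proj (h1 x))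
    (contMDiffAt_id.prodMk contMDiffAt_const)

theorem mfderiv_curve {x : X} (h1 : (x, (1 : G)) ∈ D.carrier) (ξ : ℂ) :
    (mfderiv 𝓘(ℂ, ℂ) 𝓘(ℂ, E) D.curve x ξ : E) =
      (mfderiv (𝓘(ℂ, ℂ).prod 𝓘(ℂ, E)) 𝓘(ℂ, E) D.proj (x, 1) ((ξ, 0) : ℂ × E) : E) := by
  have h2 : HasMFDerivAt 𝓘(ℂ, ℂ) (𝓘(ℂ, ℂ).prod 𝓘(ℂ, E)) (fun x : X => (x, (1 : G))) x _ :=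
    (hasMFDerivAt_id x).prodMk (hasMFDerivAt_const (1 : G) x)
  have h3 := mfderiv_comp (I' := 𝓘(ℂ, ℂ).prod 𝓘(ℂ, E)) x (g := D.proj)
    (f := fun x : X => (x, (1 : G))) ((D.contMDiffAt_proj h1).mdifferentiableAt (by simp))
    h2.mdifferentiableAt
  rw [h2.mfderiv] at h3
  exact congrArg (fun L : ℂ →L[ℂ] E => L ξ) h3

theorem isEmbedding_curve [CompactSpace X] (h1 : ∀ x : X, (x, (1 : G)) ∈ D.carrier)
    (hinj : ∀ x y : X, D.rel (x, 1) (y, 1) → x = y) : Topology.IsEmbedding D.curve := by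
  refine ((D.contMDiff_curve h1).continuous.isClosedEmbedding fun x y h => ?_).isEmbedding
  exact hinj x y ((D.proj_eq_proj_iff (h1 x) (h1 y)).1 h)

/-- The leaves above a point of the Riemann surface. -/
def leavesOver (a : X) : Set D.LeafSpace := D.proj '' {p | p ∈ D.carrier ∧ p.1 = a}

end Curve

section Immersion

variable {E : Type*} [NormedAddCommGroup E] [NormedSpace ℂ E]
  {G : Type*} [TopologicalSpace G] [ChartedSpace E G] [Group G]
  {X : Type*} [TopologicalSpace X] [ChartedSpace ℂ X]
  {α : MeromorphicOneForm X E} (D : LeafRelation (systemDistribution (G := G) α))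

theorem mfderiv_curve_injective (hα : ∀ x, ¬ α.IsZero x) {x : X} (h1 : (x, (1 : G)) ∈ D.carrier) :
    Function.Injective (mfderiv 𝓘(ℂ, ℂ) 𝓘(ℂ, E) D.curve x) := by
  let L : ℂ →L[ℂ] E := mfderiv 𝓘(ℂ, ℂ) 𝓘(ℂ, E) D.curve x
  change Function.Injective L
  refine (injective_iff_map_eq_zero L).2 fun ξ hξ => ?_
  have h2 : (mfderiv (𝓘(ℂ, ℂ).prod 𝓘(ℂ, E)) 𝓘(ℂ, E) D.proj (x, 1) ((ξ, 0) : ℂ × E) : E) = 0 :=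
    (D.mfderiv_curve h1 ξ).symm.trans hξ
  obtain ⟨c, hc⟩ := Submodule.mem_span_singleton.1 ((D.mfderiv_proj_eq_zero_iff h1 _).1 h2)
  let R : E := rightInvariantField (G := G) (α.leadingCoeff x) 1
  have hR : R = α.leadingCoeff x := rightInvariantField_at_one (G := G) _
  have h3 : c • -R = 0 := congrArg (fun w : ℂ × E => w.2) hc
  have h4 : c * 0 ^ α.poleOrder x = ξ := congrArg (fun w : ℂ × E => w.1) hc
  rw [hR, smul_neg, neg_eq_zero, smul_eq_zero] at h3
  rw [← h4, h3.resolve_right (α.leadingCoeff_ne_zero (hα x)), zero_mul]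

end Immersion

variable {E : Type*} [NormedAddCommGroup E] [NormedSpace ℂ E]
  {G : Type*} [TopologicalSpace G] [ChartedSpace E G] [Group G] [LieGroup 𝓘(ℂ, E) ω G]
  {X : Type*} [TopologicalSpace X] [ChartedSpace ℂ X]
  {α : MeromorphicOneForm X E} (D : LeafRelation (systemDistribution (G := G) α))

/-- The form is recovered from the velocity of the curve through the infinitesimal action. -/
theorem mfderiv_curve_eq_action [CompleteSpace E] [IsManifold 𝓘(ℂ, ℂ) ω X]
    (hα : ∀ x, ¬ α.IsZero x) {x : X} (h1 : (x, (1 : G)) ∈ D.carrier) (hx : ¬ α.IsPole x) (ξ : ℂ) :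
    (mfderiv 𝓘(ℂ, ℂ) 𝓘(ℂ, E) D.curve x ξ : E) = D.action (α.form x ξ) (D.curve x) := by
  have hk : α.poleOrder x = 0 := by
    by_contra h; exact hx ((α.isPole_iff (hα x)).2 h)
  have h2 := D.mfderiv_proj_horizontal h1
  simp only [hk, pow_zero, adInv_one] at h2
  rw [α.leadingCoeff_of_not_isPole (hα x) hx] at h2
  have h3 : (α.form x ξ : E) = ξ • α.value x := α.form_apply x ξ
  let L : ℂ →L[ℂ] E := mfderiv 𝓘(ℂ, ℂ) 𝓘(ℂ, E) D.curve x
  let A : E →ₗ[ℂ] E := (LinearMap.proj (D.curve x)) ∘ₗ D.actionLinear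
  have h4 : L 1 = A (α.value x) := (D.mfderiv_curve h1 1).trans h2
  have h5 : L ξ = A (α.form x ξ) := by
    rw [h3, map_smul, ← h4, ← map_smul, smul_eq_mul, mul_one]
  exact h5

section Hypersurface

variable [CompleteSpace E] [IsManifold 𝓘(ℂ, ℂ) ω X] [T1Space X]

theorem proj_mem_leavesOver_iff (hα : ∀ x, ¬ α.IsZero x) {a : X} (ha : α.IsPole a) {p : X × G}
    (hp : p ∈ D.carrier) : D.proj p ∈ D.leavesOver a ↔ p.1 = a := by
  constructor
  · rintro ⟨q, ⟨hq, rfl⟩, h⟩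
    exact (D.fst_eq_iff_of_rel hα ha hq hp ((D.proj_eq_proj_iff hq hp).1 h)).1 rfl
  · exact fun h => ⟨p, ⟨hp, h⟩, rfl⟩

theorem isClosed_leavesOver (hα : ∀ x, ¬ α.IsZero x) {a : X} (ha : α.IsPole a) :
    IsClosed (D.leavesOver a) := by
  have h : (D.leavesOver a)ᶜ = D.proj '' (D.carrier ∩ Prod.fst ⁻¹' {a}ᶜ) := by
    ext z
    obtain ⟨p, hp, rfl⟩ := D.exists_proj_eq z
    rw [Set.mem_compl_iff, D.proj_mem_leavesOver_iff hα ha hp]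
    constructor
    · exact fun h => ⟨p, ⟨hp, h⟩, rfl⟩
    · rintro ⟨q, ⟨hq, hqa⟩, h⟩ hpa
      exact hqa ((D.fst_eq_iff_of_rel hα ha hq hp ((D.proj_eq_proj_iff hq hp).1 h)).2 hpa)
  rw [← isOpen_compl_iff, h]
  exact D.isOpen_image_proj
    (D.isOpen_carrier.inter (isOpen_compl_singleton.preimage continuous_fst)) Set.inter_subset_left

theorem isConnected_leavesOver (hα : ∀ x, ¬ α.IsZero x) {a : X} (ha : α.IsPole a) {B : Set G}
    (hB : IsPreconnected B) (h1B : 1 ∈ B) (hBD : Set.univ ×ˢ B ⊆ D.carrier)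
    (hrel : ∀ p ∈ D.carrier, ∃ q ∈ (Set.univ : Set X) ×ˢ B, D.rel p q) :
    IsConnected (D.leavesOver a) := by
  have h : D.leavesOver a = D.proj '' ({a} ×ˢ B) := by
    ext z
    constructor
    · rintro ⟨p, ⟨hp, hpa⟩, rfl⟩
      obtain ⟨q, hq, hpq⟩ := hrel p hp
      have hqa := (D.fst_eq_iff_of_rel hα ha hp (hBD hq) hpq).1 hpa
      exact ⟨q, ⟨hqa, hq.2⟩, ((D.proj_eq_proj_iff hp (hBD hq)).2 hpq).symm⟩
    · rintro ⟨p, ⟨hpa, hpB⟩, rfl⟩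
      exact ⟨p, ⟨hBD ⟨Set.mem_univ _, hpB⟩, hpa⟩, rfl⟩
  rw [h]
  have hc : IsConnected (({a} : Set X) ×ˢ B) :=
    ⟨⟨(a, 1), rfl, h1B⟩, isPreconnected_singleton.prod hB⟩
  refine hc.image _ ?_
  exact D.continuousOn_proj.mono fun p hp => hBD ⟨Set.mem_univ _, hp.2⟩

theorem curve_preimage_leavesOver (hα : ∀ x, ¬ α.IsZero x) {a : X} (ha : α.IsPole a)
    (h1 : ∀ x : X, (x, (1 : G)) ∈ D.carrier) : D.curve ⁻¹' D.leavesOver a = {a} := by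
  ext x
  exact D.proj_mem_leavesOver_iff hα ha (h1 x)

theorem disjoint_leavesOver (hα : ∀ x, ¬ α.IsZero x) {a b : X} (ha : α.IsPole a)
    (hab : a ≠ b) : Disjoint (D.leavesOver a) (D.leavesOver b) := by
  refine Set.disjoint_left.2 ?_
  rintro z hz ⟨p, ⟨hp, hpb⟩, rfl⟩
  exact hab (((D.proj_mem_leavesOver_iff hα ha hp).1 hz).symm.trans hpb)

/-- A local equation of the hypersurface of leaves above a pole: the local coordinate at the pole,
composed with a local section. -/
theorem exists_equation_leavesOver (hα : ∀ x, ¬ α.IsZero x) {p : X × G} (hp : p ∈ D.carrier)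
    (ha : α.IsPole p.1) {s : D.LeafSpace → X × G}
    (hs : ContMDiffAt 𝓘(ℂ, E) (𝓘(ℂ, ℂ).prod 𝓘(ℂ, E)) ω s (D.proj p)) (hsp : s (D.proj p) = p)
    (hps : ∀ᶠ z in 𝓝 (D.proj p), s z ∈ D.carrier ∧ D.proj (s z) = z)
    {f : D.LeafSpace → ℂ} (hf : f = fun z => chartAt ℂ p.1 (s z).1 - chartAt ℂ p.1 p.1) :
    ContMDiffAt 𝓘(ℂ, E) 𝓘(ℂ, ℂ) ω f (D.proj p) ∧
      (∀ (ξ : ℂ) (w : E), (mfderiv 𝓘(ℂ, E) 𝓘(ℂ, ℂ) f (D.proj p)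
        (mfderiv (𝓘(ℂ, ℂ).prod 𝓘(ℂ, E)) 𝓘(ℂ, E) D.proj p ((ξ, w) : ℂ × E)) : ℂ) = ξ) ∧
      ∀ᶠ z in 𝓝 (D.proj p), z ∈ D.leavesOver p.1 ↔ f z = 0 := by
  have hchart : ContMDiffAt (𝓘(ℂ, ℂ).prod 𝓘(ℂ, E)) 𝓘(ℂ, ℂ) ω
      (fun q : X × G => chartAt ℂ p.1 q.1 - chartAt ℂ p.1 p.1) p :=
    (ContMDiffAt.comp (g := chartAt ℂ p.1) (I' := 𝓘(ℂ, ℂ)) p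
      (contMDiffAt_of_mem_maximalAtlas (IsManifold.chart_mem_maximalAtlas _)
        (mem_chart_source ℂ p.1)) contMDiffAt_fst).sub contMDiffAt_const
  have hfs : ContMDiffAt 𝓘(ℂ, E) 𝓘(ℂ, ℂ) ω f (D.proj p) := by
    rw [hf]
    exact ContMDiffAt.comp (g := fun q : X × G => chartAt ℂ p.1 q.1 - chartAt ℂ p.1 p.1)
      (I' := 𝓘(ℂ, ℂ).prod 𝓘(ℂ, E)) (D.proj p) (by rwa [hsp]) hs
  refine ⟨hfs, fun ξ w => ?_, ?_⟩
  · -- `s` composed with the projection moves points along leaves, hence it changes tangent vectors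
    -- by elements of the distribution, whose first component vanishes above a pole
    let P : ℂ × E →L[ℂ] E := mfderiv (𝓘(ℂ, ℂ).prod 𝓘(ℂ, E)) 𝓘(ℂ, E) D.proj p
    let S : E →L[ℂ] ℂ × E := mfderiv 𝓘(ℂ, E) (𝓘(ℂ, ℂ).prod 𝓘(ℂ, E)) s (D.proj p)
    have hPS : ∀ e, P (S e) = e := by
      have hc := mfderiv_comp (I' := 𝓘(ℂ, ℂ).prod 𝓘(ℂ, E)) (D.proj p) (g := D.proj) (f := s)
        ((D.contMDiffAt_proj (hsp.symm ▸ hp)).mdifferentiableAt (by simp))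
        (hs.mdifferentiableAt (by simp))
      have he : D.proj ∘ s =ᶠ[𝓝 (D.proj p)] id := hps.mono fun z hz => hz.2
      rw [he.mfderiv_eq, mfderiv_id, hsp] at hc
      exact fun e => (congrArg (fun L : E →L[ℂ] E => L e) hc).symm
    have hker : P (S (P (ξ, w)) - (ξ, w)) = 0 := by rw [map_sub, hPS, sub_self]
    obtain ⟨c, hc⟩ := Submodule.mem_span_singleton.1 ((D.mfderiv_proj_eq_zero_iff hp _).1 hker)
    have h1 : c * 0 ^ α.poleOrder p.1 = (S (P (ξ, w)) - (ξ, w)).1 :=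
      congrArg (fun w : ℂ × E => w.1) hc
    rw [zero_pow ((α.isPole_iff (hα _)).1 ha), mul_zero, Prod.fst_sub] at h1
    have h2 : (S (P (ξ, w))).1 = ξ := (sub_eq_zero.1 h1.symm)
    have h3 : HasMFDerivAt (𝓘(ℂ, ℂ).prod 𝓘(ℂ, E)) 𝓘(ℂ, ℂ)
        (fun q : X × G => chartAt ℂ p.1 q.1) p _ :=
      HasMFDerivAt.comp (g := chartAt ℂ p.1) p
      (mdifferentiableAt_atlas (I := 𝓘(ℂ, ℂ)) (chart_mem_atlas ℂ p.1)
        (mem_chart_source ℂ p.1)).hasMFDerivAt (hasMFDerivAt_fst (I := 𝓘(ℂ, ℂ)) (I' := 𝓘(ℂ, E)) p)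
    have h4 := mfderiv_comp (I' := 𝓘(ℂ, ℂ).prod 𝓘(ℂ, E)) (D.proj p)
      (g := fun q : X × G => chartAt ℂ p.1 q.1) (f := s)
      (by rw [hsp]; exact h3.mdifferentiableAt) (hs.mdifferentiableAt (by simp))
    rw [hsp, h3.mfderiv] at h4
    have h5 : (mfderiv 𝓘(ℂ, E) 𝓘(ℂ, ℂ) f (D.proj p) : E →L[ℂ] ℂ) =
        mfderiv 𝓘(ℂ, E) 𝓘(ℂ, ℂ) (fun z => chartAt ℂ p.1 (s z).1) (D.proj p) := by
      have h6 : MDifferentiableAt 𝓘(ℂ, E) 𝓘(ℂ, ℂ) (fun z => chartAt ℂ p.1 (s z).1) (D.proj p) :=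
        MDifferentiableAt.comp (I' := 𝓘(ℂ, ℂ).prod 𝓘(ℂ, E)) (D.proj p)
          (g := fun q : X × G => chartAt ℂ p.1 q.1)
          (by rw [hsp]; exact h3.mdifferentiableAt) (hs.mdifferentiableAt (by simp))
      rw [hf]
      exact (h6.hasMFDerivAt.sub (hasMFDerivAt_const (chartAt ℂ p.1 p.1) (D.proj p))).mfderiv.trans
        (sub_zero (_ : E →L[ℂ] ℂ))
    refine (congrArg (fun L : E →L[ℂ] ℂ => L (P (ξ, w))) (h5.trans h4)).trans ?_
    change MeromorphicOneForm.chartDeriv p.1 p.1 (S (P (ξ, w))).1 = ξ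
    rw [h2, ContinuousLinearMap.apply_eq_mul_apply_one, MeromorphicOneForm.chartDeriv_self, mul_one]
  · have hs1 : ∀ᶠ z in 𝓝 (D.proj p), (s z).1 ∈ (chartAt ℂ p.1).source := by
      have h1 : ContinuousAt (fun z => (s z).1) (D.proj p) :=
        continuous_fst.continuousAt.comp hs.continuousAt
      refine h1 ((chartAt ℂ p.1).open_source.mem_nhds ?_)
      simp only [hsp, mem_chart_source]
    filter_upwards [hps, hs1] with z hz hzs
    rw [← hz.2, D.proj_mem_leavesOver_iff hα ha hz.1, hz.2, hf]
    simp only [sub_eq_zero]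
    exact ⟨fun h => by rw [h], fun h => (chartAt ℂ p.1).injOn hzs (mem_chart_source ℂ p.1) h⟩

end Hypersurface

end LeafRelation

/-! ### The determinant of the infinitesimal action -/

section Determinant

variable {E : Type*} [NormedAddCommGroup E] [NormedSpace ℂ E]
  {Z : Type*} [TopologicalSpace Z] [ChartedSpace E Z] {J : Type*} [Fintype J] [DecidableEq J]

theorem contMDiffAt_basis_det [FiniteDimensional ℂ E] (e : Module.Basis J ℂ E) {m : J → Z → E} {z : Z}
    (hm : ∀ j, ContMDiffAt 𝓘(ℂ, E) 𝓘(ℂ, E) ω (m j) z) :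
    ContMDiffAt 𝓘(ℂ, E) 𝓘(ℂ, ℂ) ω (fun w => e.det fun j => m j w) z := by
  have h : ∀ i j, ContMDiffAt 𝓘(ℂ, E) 𝓘(ℂ, ℂ) ω (fun w => e.coord i (m j w)) z := fun i j =>
    ((LinearMap.toContinuousLinearMap (e.coord i)).contMDiff.contMDiffAt).comp z (hm j)
  simp only [Module.Basis.det_apply, Matrix.det_apply, Module.Basis.toMatrix_apply]
  refine ContMDiffAt.sum fun σ _ => ?_
  have hp : ContMDiffAt 𝓘(ℂ, E) 𝓘(ℂ, ℂ) ω (fun w => ∏ i, e.repr (m i w) (σ i)) z :=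
    contMDiffAt_finsetProd fun i _ => h (σ i) i
  rcases Int.units_eq_one_or (Equiv.Perm.sign σ) with hσ | hσ
  · simpa [hσ] using hp
  · simpa [hσ] using hp.neg

/-- Replacing a vector of a basis by `y` multiplies the determinant of the images under a linear map
by the corresponding coordinate of `y`. -/
theorem det_update_apply (b e : Module.Basis J ℂ E) (B : E →ₗ[ℂ] E) (y : E) (j₀ : J) :
    e.det (Function.update (fun j => B (b j)) j₀ (B y)) =
      b.repr y j₀ * e.det fun j => B (b j) := by
  have h1 : B y = ∑ j, b.repr y j • B (b j) := by
    calc B y = B (∑ j, b.repr y j • b j) := by rw [b.sum_repr]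
      _ = _ := by simp only [map_sum, map_smul]
  rw [h1, AlternatingMap.map_update_sum]
  rw [Finset.sum_eq_single j₀]
  · rw [AlternatingMap.map_update_smul, Function.update_eq_self, smul_eq_mul]
  · intro j _ hj
    rw [AlternatingMap.map_update_smul, AlternatingMap.map_update_self _ _ hj.symm, smul_zero]
  · simp

/-- A family of linear maps which, after multiplication of a vector `C` by a function, sends the
vector `y` to that multiple, has determinant the function times a unit. -/
theorem exists_det_eq_mul [FiniteDimensional ℂ E] {B : Z → E →L[ℂ] E} {C y : Z → E} {F : Z → ℂ} {z : Z}
    (hB : ContMDiffAt 𝓘(ℂ, E) 𝓘(ℂ, E →L[ℂ] E) ω B z) (hC : ContMDiffAt 𝓘(ℂ, E) 𝓘(ℂ, E) ω C z)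
    (hy : ContMDiffAt 𝓘(ℂ, E) 𝓘(ℂ, E) ω y z) (hy0 : y z ≠ 0) (hF : F z = 0)
    (hFC : ∀ᶠ w in 𝓝 z, F w • C w = B w (y w)) (hspan : ∀ x : E, ∃ (a : ℂ) (v : E),
      x = a • C z + B z v) (b e : Module.Basis J ℂ E) :
    ∃ u : Z → ℂ, ContMDiffAt 𝓘(ℂ, E) 𝓘(ℂ, ℂ) ω u z ∧ u z ≠ 0 ∧
      ∀ᶠ w in 𝓝 z, e.det (fun j => B w (b j)) = F w * u w := by
  obtain ⟨j₀, hj₀⟩ : ∃ j, b.repr (y z) j ≠ 0 := by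
    by_contra! h
    exact hy0 (b.repr.map_eq_zero_iff.1 (Finsupp.ext h))
  have hcoord : ContMDiffAt 𝓘(ℂ, E) 𝓘(ℂ, ℂ) ω (fun w => b.repr (y w) j₀) z :=
    ((LinearMap.toContinuousLinearMap (b.coord j₀)).contMDiff.contMDiffAt).comp z hy
  have hdet : ContMDiffAt 𝓘(ℂ, E) 𝓘(ℂ, ℂ) ω
      (fun w => e.det (Function.update (fun j => B w (b j)) j₀ (C w))) z := by
    have h : ∀ w, Function.update (fun j => B w (b j)) j₀ (C w) =
        fun j => if j = j₀ then C w else B w (b j) := by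
      intro w; ext j
      by_cases hj : j = j₀
      · subst hj; simp
      · simp [hj]
    simp only [h]
    refine contMDiffAt_basis_det e fun j => ?_
    by_cases hj : j = j₀
    · simpa [hj] using hC
    · simpa [hj] using hB.clm_apply contMDiffAt_const
  refine ⟨fun w => e.det (Function.update (fun j => B w (b j)) j₀ (C w)) / b.repr (y w) j₀,
    hdet.div₀ hcoord hj₀, div_ne_zero ?_ hj₀, ?_⟩
  · -- `C z` and the `B z (b j)` with `j ≠ j₀` span: `B z` kills `y z`
    have hBy : B z (y z) = 0 := by rw [← hFC.self_of_nhds, hF, zero_smul]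
    set m := Function.update (fun j => B z (b j)) j₀ (C z) with hm
    have hC' : C z ∈ Submodule.span ℂ (Set.range m) := Submodule.subset_span ⟨j₀, by simp [hm]⟩
    have hB' : ∀ j, j ≠ j₀ → B z (b j) ∈ Submodule.span ℂ (Set.range m) := fun j hj =>
      Submodule.subset_span ⟨j, by simp [hm, hj]⟩
    have hB₀ : B z (b j₀) ∈ Submodule.span ℂ (Set.range m) := by
      have h1 : B z (y z) = b.repr (y z) j₀ • B z (b j₀) +
          ∑ j ∈ Finset.univ.erase j₀, b.repr (y z) j • B z (b j) := by
        rw [Finset.add_sum_erase Finset.univ (fun j => b.repr (y z) j • B z (b j))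
          (Finset.mem_univ j₀)]
        calc B z (y z) = B z (∑ j, b.repr (y z) j • b j) := by rw [b.sum_repr]
          _ = _ := by simp only [map_sum, map_smul]
      have h2 : b.repr (y z) j₀ • B z (b j₀) ∈ Submodule.span ℂ (Set.range m) := by
        rw [hBy] at h1
        rw [eq_neg_of_add_eq_zero_left h1.symm]
        exact Submodule.neg_mem _ (Submodule.sum_mem _ fun j hj =>
          Submodule.smul_mem _ _ (hB' j (Finset.ne_of_mem_erase hj)))
      exact (Submodule.smul_mem_iff _ hj₀).1 h2
    have htop : ⊤ ≤ Submodule.span ℂ (Set.range m) := by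
      intro x _
      obtain ⟨a, v, rfl⟩ := hspan x
      refine Submodule.add_mem _ (Submodule.smul_mem _ _ hC') ?_
      rw [← b.sum_repr v, map_sum]
      refine Submodule.sum_mem _ fun j _ => ?_
      rw [map_smul]
      refine Submodule.smul_mem _ _ ?_
      by_cases hj : j = j₀
      · rwa [hj]
      · exact hB' j hj
    have hli := linearIndependent_of_top_le_span_of_card_eq_finrank htop
      (Module.finrank_eq_card_basis e).symm
    exact ((Module.Basis.is_basis_iff_det e).1 ⟨hli, top_le_iff.1 htop⟩).ne_zero
  · filter_upwards [hFC, hcoord.continuousAt.eventually_ne hj₀] with w hw hwj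
    have h1 := det_update_apply b e (B w : E →ₗ[ℂ] E) (y w) j₀
    simp only [ContinuousLinearMap.coe_coe] at h1
    rw [← hw, AlternatingMap.map_update_smul, smul_eq_mul] at h1
    rw [mul_div_assoc', h1, mul_div_cancel_left₀ _ hwj]

end Determinant

namespace LeafRelation

variable {E : Type*} [NormedAddCommGroup E] [NormedSpace ℂ E]
  {G : Type*} [TopologicalSpace G] [ChartedSpace E G] [Group G]
  {X : Type*} [TopologicalSpace X] [ChartedSpace ℂ X] [IsManifold 𝓘(ℂ, ℂ) ω X]
  {α : MeromorphicOneForm X E} (D : LeafRelation (systemDistribution (G := G) α))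

open MeromorphicOneForm

/-- The projection of the coordinate field `∂_ζ`, along a local section and in coordinates, depends
analytically on the leaf. -/
theorem exists_contMDiffAt_horizontal {p : X × G} (hp : p ∈ D.carrier)
    {s : D.LeafSpace → X × G}
    (hs : ContMDiffAt 𝓘(ℂ, E) (𝓘(ℂ, ℂ).prod 𝓘(ℂ, E)) ω s (D.proj p)) (hsp : s (D.proj p) = p) :
    ∃ C : D.LeafSpace → E, ContMDiffAt 𝓘(ℂ, E) 𝓘(ℂ, E) ω C (D.proj p) ∧
      ∀ᶠ z in 𝓝 (D.proj p), ∀ ξ : ℂ,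
        (mfderiv 𝓘(ℂ, E) 𝓘(ℂ, E) (chartAt E (D.proj p)) (D.proj (s z))
          (mfderiv (𝓘(ℂ, ℂ).prod 𝓘(ℂ, E)) 𝓘(ℂ, E) D.proj (s z) ((ξ, 0) : ℂ × E)) : E) =
          chartDeriv p.1 (s z).1 ξ • C z := by
  obtain ⟨i, hi, hci⟩ := D.exists_chartAt_proj_eq hp
  set κ := chartAt ℂ p.1 with hκ
  -- move the first component along the coordinate
  set Ψ : D.LeafSpace × ℂ → X × G := fun q => (κ.symm (κ (s q.1).1 + q.2), (s q.1).2) with hΨ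
  have hsrc : p.1 ∈ κ.source := mem_chart_source ℂ p.1
  have hκs : ∀ {y : X}, y ∈ κ.source → ContMDiffAt 𝓘(ℂ, ℂ) 𝓘(ℂ, ℂ) ω κ y := fun hy =>
    contMDiffAt_of_mem_maximalAtlas (IsManifold.chart_mem_maximalAtlas _) hy
  have hκt : ∀ {t : ℂ}, t ∈ κ.target → ContMDiffAt 𝓘(ℂ, ℂ) 𝓘(ℂ, ℂ) ω κ.symm t := fun ht =>
    contMDiffAt_symm_of_mem_maximalAtlas (IsManifold.chart_mem_maximalAtlas _) ht
  have hΨs : ContMDiffAt (𝓘(ℂ, E).prod 𝓘(ℂ, ℂ)) (𝓘(ℂ, ℂ).prod 𝓘(ℂ, E)) ω Ψ (D.proj p, 0) := by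
    have h1 : ContMDiffAt (𝓘(ℂ, E).prod 𝓘(ℂ, ℂ)) (𝓘(ℂ, ℂ).prod 𝓘(ℂ, E)) ω
        (fun q : D.LeafSpace × ℂ => s q.1) (D.proj p, (0 : ℂ)) :=
      ContMDiffAt.comp (g := s) (I' := 𝓘(ℂ, E)) (D.proj p, (0 : ℂ)) hs contMDiffAt_fst
    have h2 : ContMDiffAt (𝓘(ℂ, E).prod 𝓘(ℂ, ℂ)) 𝓘(ℂ, ℂ) ω
        (fun q : D.LeafSpace × ℂ => κ (s q.1).1 + q.2) (D.proj p, (0 : ℂ)) := by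
      refine ContMDiffAt.add ?_ contMDiffAt_snd
      refine ContMDiffAt.comp (g := κ) (I' := 𝓘(ℂ, ℂ)) (D.proj p, (0 : ℂ)) (hκs ?_)
        (contMDiffAt_fst.comp _ h1)
      simpa only [hsp] using hsrc
    refine ContMDiffAt.prodMk (ContMDiffAt.comp (g := κ.symm) (I' := 𝓘(ℂ, ℂ)) _ (hκt ?_) h2)
      (contMDiffAt_snd.comp _ h1)
    simpa only [hsp, add_zero] using κ.map_source hsrc
  have hΨp : Ψ (D.proj p, 0) = p := by
    simp only [hΨ, hsp, add_zero, κ.left_inv hsrc]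
  have hβ : ContMDiffAt (𝓘(ℂ, E).prod 𝓘(ℂ, ℂ)) 𝓘(ℂ, E) ω (fun q => (D.β i (Ψ q)).2)
      (D.proj p, (0 : ℂ)) := by
    refine ContMDiffAt.comp (g := fun q => (D.β i q).2) (I' := 𝓘(ℂ, ℂ).prod 𝓘(ℂ, E)) _ ?_ hΨs
    rw [hΨp]
    exact (D.foliated i).contMDiffAt_snd (D.dom_subset_source i hi)
  have hC : ContMDiffAt 𝓘(ℂ, E) 𝓘(ℂ, ℂ →L[ℂ] E) ω
      (partialDeriv (fun q => (D.β i (Ψ q)).2) (0 : ℂ) : D.LeafSpace → ℂ →L[ℂ] E) (D.proj p) :=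
    ContMDiffAt.partialDeriv (J := 𝓘(ℂ, E)) hβ
  refine ⟨fun z => partialDeriv (fun q => (D.β i (Ψ q)).2) (0 : ℂ) z (1 : ℂ),
    hC.clm_apply contMDiffAt_const, ?_⟩
  have h1 : ∀ᶠ z in 𝓝 (D.proj p), s z ∈ D.dom i :=
    hs.continuousAt (by rw [hsp]; exact (D.isOpen_dom i).mem_nhds hi)
  have h2 : ∀ᶠ z in 𝓝 (D.proj p), (s z).1 ∈ κ.source := by
    have h3 : ContinuousAt (fun z => (s z).1) (D.proj p) :=
      continuous_fst.continuousAt.comp hs.continuousAt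
    refine h3 (κ.open_source.mem_nhds ?_)
    simpa only [hsp] using hsrc
  filter_upwards [h1, h2] with z hzi hzs ξ
  rw [hci]
  refine (D.mfderiv_leafChart_comp_proj hzi _).trans ?_
  refine ((D.foliated i).mfderiv_snd (D.dom_subset_source i hzi) _).symm.trans ?_
  -- the velocity of `t ↦ Ψ (z, t)` at `0`
  have hz0 : κ (s z).1 + 0 ∈ κ.target := by rw [add_zero]; exact κ.map_source hzs
  have h3 : HasMFDerivAt 𝓘(ℂ, ℂ) 𝓘(ℂ, ℂ) (fun t : ℂ => κ (s z).1 + t) (0 : ℂ)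
      (ContinuousLinearMap.id ℂ ℂ) :=
    ((hasFDerivAt_id (𝕜 := ℂ) (0 : ℂ)).const_add (κ (s z).1)).hasMFDerivAt
  have h4 : HasMFDerivAt 𝓘(ℂ, ℂ) 𝓘(ℂ, ℂ) (fun t : ℂ => κ.symm (κ (s z).1 + t)) (0 : ℂ) _ :=
    HasMFDerivAt.comp (g := κ.symm) (0 : ℂ)
      ((hκt hz0).mdifferentiableAt (by simp)).hasMFDerivAt h3
  have h5 : HasMFDerivAt 𝓘(ℂ, ℂ) (𝓘(ℂ, ℂ).prod 𝓘(ℂ, E)) (fun t : ℂ => Ψ (z, t)) (0 : ℂ) _ :=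
    h4.prodMk (hasMFDerivAt_const (s z).2 (0 : ℂ))
  have hΨz : Ψ (z, 0) = s z := by simp only [hΨ, add_zero, κ.left_inv hzs]
  have h6 := mfderiv_comp (I' := 𝓘(ℂ, ℂ).prod 𝓘(ℂ, E)) (0 : ℂ) (g := fun q => (D.β i q).2)
    (f := fun t : ℂ => Ψ (z, t)) (by
      rw [hΨz]
      exact ((D.foliated i).contMDiffAt_snd (D.dom_subset_source i hzi)).mdifferentiableAt
        (by simp)) h5.mdifferentiableAt
  rw [h5.mfderiv, hΨz] at h6
  let L : ℂ × E →L[ℂ] E := mfderiv (𝓘(ℂ, ℂ).prod 𝓘(ℂ, E)) 𝓘(ℂ, E) (fun q => (D.β i q).2) (s z)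
  have h7 : (partialDeriv (fun q => (D.β i (Ψ q)).2) (0 : ℂ) z (1 : ℂ) : E) =
      L (chartSymmDeriv p.1 (κ (s z).1) 1, 0) := by
    have h8 := congrArg (fun L : ℂ →L[ℂ] E => L 1) h6
    refine h8.trans ?_
    change L (chartSymmDeriv p.1 (κ (s z).1 + 0) 1, 0) = _
    rw [add_zero]
  change L (ξ, 0) = _
  rw [h7, ← map_smul, Prod.smul_mk, smul_zero, smul_eq_mul,
    ContinuousLinearMap.apply_eq_mul_apply_one, mul_assoc, chartDeriv_mul_chartSymmDeriv hzs,
    mul_one]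

end LeafRelation

namespace LeafRelation

variable {E : Type*} [NormedAddCommGroup E] [NormedSpace ℂ E] [FiniteDimensional ℂ E]
  [CompleteSpace E]
  {G : Type*} [TopologicalSpace G] [ChartedSpace E G] [Group G] [LieGroup 𝓘(ℂ, E) ω G]
  {X : Type*} [TopologicalSpace X] [ChartedSpace ℂ X] [IsManifold 𝓘(ℂ, ℂ) ω X]
  {α : MeromorphicOneForm X E} (D : LeafRelation (systemDistribution (G := G) α))

open MeromorphicOneForm

/-- Above a pole, the determinant of the infinitesimal action vanishes to the order of the pole: the
equation of the system exhibits a nowhere zero vector `y` whose image is `ζ ^ k` times the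
projection of `∂_ζ`, and the latter completes the image of the action to the whole space. -/
theorem exists_det_action_eq (hα : ∀ x, ¬ α.IsZero x) {p : X × G} (hp : p ∈ D.carrier)
    (ha : α.IsPole p.1) {s : D.LeafSpace → X × G}
    (hs : ContMDiffAt 𝓘(ℂ, E) (𝓘(ℂ, ℂ).prod 𝓘(ℂ, E)) ω s (D.proj p)) (hsp : s (D.proj p) = p)
    (hps : ∀ᶠ z in 𝓝 (D.proj p), s z ∈ D.carrier ∧ D.proj (s z) = z)
    {J : Type*} [Fintype J] [DecidableEq J] (b e : Module.Basis J ℂ E) :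
    ∃ u : D.LeafSpace → ℂ, ContMDiffAt 𝓘(ℂ, E) 𝓘(ℂ, ℂ) ω u (D.proj p) ∧ u (D.proj p) ≠ 0 ∧
      ∀ᶠ w in 𝓝 (D.proj p), e.det (fun j => (mfderiv 𝓘(ℂ, E) 𝓘(ℂ, E) (chartAt E (D.proj p)) w
        (D.action (b j) w) : E)) =
        (chartAt ℂ p.1 (s w).1 - chartAt ℂ p.1 p.1) ^ α.poleOrder p.1 * u w := by
  obtain ⟨A, hA, hAc, hA0, hAe, hAk⟩ := α.exists_analytic_leadingCoeff (hα p.1)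
  obtain ⟨B, hB, hBe⟩ := D.exists_contMDiffAt_action hp
  obtain ⟨C, hC, hCe⟩ := D.exists_contMDiffAt_horizontal hp hs hsp
  have hk : α.poleOrder p.1 ≠ 0 := hAk.1 ha
  have hκ : ContMDiffAt 𝓘(ℂ, E) 𝓘(ℂ, ℂ) ω (fun w => chartAt ℂ p.1 (s w).1) (D.proj p) := by
    refine ContMDiffAt.comp (g := chartAt ℂ p.1) (I' := 𝓘(ℂ, ℂ)) (D.proj p) ?_
      (contMDiffAt_fst.comp _ hs)
    refine contMDiffAt_of_mem_maximalAtlas (IsManifold.chart_mem_maximalAtlas _) ?_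
    simp only [hsp, mem_chart_source]
  have hy : ContMDiffAt 𝓘(ℂ, E) 𝓘(ℂ, E) ω
      (fun w => adInv (E := E) (s w).2 (A (chartAt ℂ p.1 (s w).1))) (D.proj p) := by
    have h1 : ContMDiffAt 𝓘(ℂ, E) 𝓘(ℂ, E →L[ℂ] E) ω (fun w => adInv (E := E) (s w).2)
        (D.proj p) :=
      ContMDiffAt.comp (g := adInv (E := E) (G := G)) (I' := 𝓘(ℂ, E)) (D.proj p)
        (contMDiffAt_adInv _) (contMDiffAt_snd.comp _ hs)
    refine h1.clm_apply ?_
    refine ContMDiffAt.comp (g := A) (I' := 𝓘(ℂ, ℂ)) (D.proj p) ?_ hκ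
    rw [hsp]
    exact hA.contDiffAt.contMDiffAt
  have hbe : ∃ u : D.LeafSpace → ℂ, ContMDiffAt 𝓘(ℂ, E) 𝓘(ℂ, ℂ) ω u (D.proj p) ∧
      u (D.proj p) ≠ 0 ∧ ∀ᶠ w in 𝓝 (D.proj p), e.det (fun j => B w (b j)) =
        (chartAt ℂ p.1 (s w).1 - chartAt ℂ p.1 p.1) ^ α.poleOrder p.1 * u w := by
    refine exists_det_eq_mul hB hC hy ?_ ?_ ?_ ?_ b e
    · rw [hsp, hAc]
      exact fun h => hA0 (adInv_injective _ (h.trans (map_zero (adInv (E := E) p.2)).symm))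
    · rw [hsp, sub_self, zero_pow hk]
    · have hs1 : Filter.Tendsto (fun w => (s w).1) (𝓝 (D.proj p)) (𝓝 p.1) := by
        have h1 : ContinuousAt (fun w => (s w).1) (D.proj p) :=
          continuous_fst.continuousAt.comp hs.continuousAt
        have h2 := h1.tendsto
        rwa [hsp] at h2
      filter_upwards [hps, hBe, hCe, hs1.eventually (α.eventually_leadingCoeff_eq hAc hα hAe)]
        with w hw hBw hCw huw
      -- divide the equation of the system, read at `s w`, by the unit `u`
      obtain ⟨u, hu, hu1, hu2⟩ := huw
      have h1 := D.mfderiv_proj_horizontal hw.1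
      let K : E →L[ℂ] E := mfderiv 𝓘(ℂ, E) 𝓘(ℂ, E) (chartAt E (D.proj p)) (D.proj (s w))
      have h2 := (hCw _).symm.trans (congrArg K h1)
      have h3 : ∀ z, z = w → ∀ v : E, (mfderiv 𝓘(ℂ, E) 𝓘(ℂ, E) (chartAt E (D.proj p)) z
          (D.action v z) : E) = B w v := by
        rintro z rfl v
        exact hBw v
      have h4 := h2.trans (h3 _ hw.2 _)
      rw [hu1, hu2, map_smul, map_smul, mul_smul] at h4
      exact smul_right_injective E hu h4
    · intro x
      obtain ⟨ζ, hζ⟩ := D.mfderiv_proj_surjective hp x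
      let L : ℂ × E →L[ℂ] E := mfderiv (𝓘(ℂ, ℂ).prod 𝓘(ℂ, E)) 𝓘(ℂ, E) D.proj p
      let Z : ℂ × E := ζ
      have hL : L Z = x := hζ
      obtain ⟨v, hv⟩ : ∃ v : E,
          (mulInvariantVectorField (I := 𝓘(ℂ, E)) (G := G) v p.2 : E) = Z.2 := by
        let T : E →L[ℂ] E := mfderiv 𝓘(ℂ, E) 𝓘(ℂ, E) (fun k : G => p.2 * k) 1
        have hT : Function.Injective T.toLinearMap := fun v w h =>
          mulInvariantVectorField_injective (g := p.2) h
        exact LinearMap.injective_iff_surjective.1 hT Z.2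
      refine ⟨Z.1, v, ?_⟩
      have h1 : ∀ η : E, (mfderiv 𝓘(ℂ, E) 𝓘(ℂ, E) (chartAt E (D.proj p)) (D.proj p) η : E) = η :=
        fun η => mfderiv_chartAt_self (D.proj p) η
      have h2 := hCe.self_of_nhds Z.1
      rw [hsp, ContinuousLinearMap.apply_eq_mul_apply_one, chartDeriv_self, mul_one] at h2
      have h2' : L (Z.1, 0) = Z.1 • C (D.proj p) := (h1 _).symm.trans h2
      have h3 : L (0, Z.2) = B (D.proj p) v := by
        rw [← hv]
        exact (D.mfderiv_proj_mulInvariantVectorField hp v).trans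
          ((h1 _).symm.trans (hBe.self_of_nhds v))
      rw [← h2', ← h3, ← map_add, Prod.mk_add_mk, add_zero, zero_add, ← hL]
      rfl
  obtain ⟨u, hu, hu0, hue⟩ := hbe
  refine ⟨u, hu, hu0, ?_⟩
  filter_upwards [hue, hBe] with w hw hBw
  rw [← hw]
  exact congrArg e.det (funext fun j => hBw (b j))

end LeafRelation

/-! ### The twistor space of a system -/

theorem MeromorphicOneForm.exists_not_isPole {X : Type*} [TopologicalSpace X] [ChartedSpace ℂ X]
    [IsManifold 𝓘(ℂ, ℂ) ω X] [Nonempty X] {V : Type*} [NormedAddCommGroup V] [NormedSpace ℂ V]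
    [CompleteSpace V] (α : MeromorphicOneForm X V) : ∃ x, ¬ α.IsPole x := by
  obtain ⟨x₀⟩ := ‹Nonempty X›
  set κ := chartAt ℂ x₀
  have hx₀ : x₀ ∈ κ.source := mem_chart_source ℂ x₀
  have h1 : ∀ᶠ z in 𝓝 (κ x₀), κ.symm z ≠ x₀ → ¬ α.IsPole (κ.symm z) := by
    have h2 := κ.continuousAt_symm (κ.map_source hx₀)
    rw [ContinuousAt, κ.left_inv hx₀] at h2
    exact h2.eventually (α.eventually_not_isPole x₀)
  have h2 := (h1.and (κ.open_target.mem_nhds (κ.map_source hx₀)))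
  obtain ⟨z, ⟨hz1, hzt⟩, hz⟩ := ((h2.filter_mono nhdsWithin_le_nhds).and
    (self_mem_nhdsWithin : {κ x₀}ᶜ ∈ 𝓝[≠] (κ x₀))).exists
  refine ⟨κ.symm z, hz1 fun h => hz ?_⟩
  rw [Set.mem_singleton_iff, ← h, κ.right_inv hzt]

theorem TwistorSpace.maurerCartan_φAt_apply {E : Type*} [NormedAddCommGroup E] [NormedSpace ℂ E]
    {𝔤 : Type*} [LieRing 𝔤] [LieAlgebra ℂ 𝔤] {X : Type*} [TopologicalSpace X] [ChartedSpace ℂ X]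
    (T : TwistorSpace E 𝔤 X) {z : T.Z} (h : Function.Bijective (T.φAt z)) (v : 𝔤) :
    T.maurerCartan z (T.φAt z v) = v := by
  rw [maurerCartan, dif_pos h]
  exact (LinearEquiv.ofBijective (T.φAt z) h).symm_apply_apply v

namespace LeafRelation

section

variable {E : Type uE} [NormedAddCommGroup E] [NormedSpace ℂ E] [FiniteDimensional ℂ E]
  [CompleteSpace E]
  {G : Type uG} [TopologicalSpace G] [ChartedSpace E G] [Group G] [LieGroup 𝓘(ℂ, E) ω G]
  {X : Type uX} [TopologicalSpace X] [CompactSpace X] [Nonempty X]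
  [ChartedSpace ℂ X] [IsManifold 𝓘(ℂ, ℂ) ω X]
  {α : MeromorphicOneForm X E} (D : LeafRelation (systemDistribution (G := G) α))

/-- The space of leaves of the distribution of a system, as a twistor space. -/
def twistorSpace (hα : ∀ x, ¬ α.IsZero x) (h1 : ∀ x : X, (x, (1 : G)) ∈ D.carrier)
    (hinj : ∀ x y : X, D.rel (x, 1) (y, 1) → x = y) :
    TwistorSpace.{uE, uX, uE, max uG uX} E (GroupLieAlgebra 𝓘(ℂ, E) G) X :=
  haveI : SecondCountableTopology E :=
    haveI := FiniteDimensional.proper ℂ E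
    secondCountable_of_proper
  { Z := D.LeafSpace
    secondCountable := D.secondCountableTopology_leafSpace
    φ := D.actionLinear
    holomorphic_φ := D.contMDiff_action
    map_lie := D.action_lie
    ι := D.curve
    holomorphic_ι := D.contMDiff_curve h1
    embedding_ι := D.isEmbedding_curve h1 hinj
    immersion_ι := fun x => D.mfderiv_curve_injective hα (h1 x)
    exists_bijective := by
      obtain ⟨x, hx⟩ := α.exists_not_isPole
      exact ⟨x, (D.action_bijective_iff hα (h1 x)).2 hx⟩ }

variable (hα : ∀ x, ¬ α.IsZero x) (h1 : ∀ x : X, (x, (1 : G)) ∈ D.carrier)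
  (hinj : ∀ x y : X, D.rel (x, 1) (y, 1) → x = y)

theorem proj_mem_singularSet_iff {p : X × G} (hp : p ∈ D.carrier) :
    D.proj p ∈ (D.twistorSpace hα h1 hinj).singularSet ↔ α.IsPole p.1 :=
  (not_congr (D.action_bijective_iff hα hp)).trans not_not

theorem isTwistorSpaceFor_twistorSpace : (D.twistorSpace hα h1 hinj).IsTwistorSpaceFor α := by
  refine ⟨fun x => D.proj_mem_singularSet_iff hα h1 hinj (h1 x), fun x hx ξ => ?_⟩
  have hx' : ¬ α.IsPole x := fun h => hx ((D.proj_mem_singularSet_iff hα h1 hinj (h1 x)).2 h)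
  have hb : Function.Bijective ((D.twistorSpace hα h1 hinj).φAt (D.curve x)) := not_not.1 hx
  exact (congrArg ((D.twistorSpace hα h1 hinj).maurerCartan (D.curve x))
    (D.mfderiv_curve_eq_action hα (h1 x) hx' ξ)).trans
    (TwistorSpace.maurerCartan_φAt_apply _ hb (α.form x ξ))

theorem isRegularFor_twistorSpace [T1Space X] {B : Set G} (hB : IsPreconnected B) (h1B : 1 ∈ B)
    (hBD : Set.univ ×ˢ B ⊆ D.carrier)
    (hrel : ∀ p ∈ D.carrier, ∃ q ∈ (Set.univ : Set X) ×ˢ B, D.rel p q) :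
    (D.twistorSpace hα h1 hinj).IsRegularFor α := by
  refine ⟨α.finite_setOf_isPole, D.leavesOver, ?_, ?_, fun a ha => ⟨?_, ?_, ?_, ?_, ?_⟩⟩
  · refine Set.ext fun z => ?_
    obtain ⟨p, hp, rfl⟩ := D.exists_proj_eq z
    refine (D.proj_mem_singularSet_iff hα h1 hinj hp).trans (Iff.trans ?_ Set.mem_iUnion₂.symm)
    constructor
    · exact fun h => ⟨p.1, h, (D.proj_mem_leavesOver_iff hα h hp).2 rfl⟩
    · rintro ⟨a, ha, h⟩
      rwa [← (D.proj_mem_leavesOver_iff hα ha hp).1 h] at ha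
  · exact fun a ha b _ hab => D.disjoint_leavesOver hα ha hab
  · exact D.isClosed_leavesOver hα ha
  · exact D.isConnected_leavesOver hα ha hB h1B hBD hrel
  · exact D.curve_preimage_leavesOver hα ha h1
  · obtain ⟨s, hs, hsp, hps⟩ := D.exists_section (h1 a)
    obtain ⟨h2, h3, h4⟩ := D.exists_equation_leavesOver hα (h1 a) ha hs hsp hps rfl
    let L : E →L[ℂ] ℂ := mfderiv 𝓘(ℂ, E) 𝓘(ℂ, ℂ)
      (fun z => chartAt ℂ a (s z).1 - chartAt ℂ a a) (D.curve a)
    have h5 : L (mfderiv 𝓘(ℂ, ℂ) 𝓘(ℂ, E) D.curve a (1 : ℂ)) = 1 :=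
      (congrArg L (D.mfderiv_curve (h1 a) 1)).trans (h3 1 0)
    have h6 : L ≠ 0 := fun h => zero_ne_one (α := ℂ) (by rw [← h5, h]; rfl)
    exact ⟨_, ⟨h2, h6, h4⟩, (1 : ℂ), fun h => zero_ne_one (α := ℂ) (h.symm.trans h5)⟩
  · rintro z ⟨p, ⟨hp, rfl⟩, rfl⟩
    obtain ⟨s, hs, hsp, hps⟩ := D.exists_section hp
    obtain ⟨h2, h3, h4⟩ := D.exists_equation_leavesOver hα hp ha hs hsp hps rfl
    let L : E →L[ℂ] ℂ := mfderiv 𝓘(ℂ, E) 𝓘(ℂ, ℂ)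
      (fun z => chartAt ℂ p.1 (s z).1 - chartAt ℂ p.1 p.1) (D.proj p)
    have h5 : L (mfderiv (𝓘(ℂ, ℂ).prod 𝓘(ℂ, E)) 𝓘(ℂ, E) D.proj p ((1, 0) : ℂ × E)) = 1 := h3 1 0
    have h6 : L ≠ 0 := fun h => zero_ne_one (α := ℂ) (by rw [← h5, h]; rfl)
    exact ⟨_, ⟨h2, h6, h4⟩, fun b e => D.exists_det_action_eq hα hp ha hs hsp hps b e⟩

theorem isMinimalFor_twistorSpace : (D.twistorSpace hα h1 hinj).IsMinimalFor α := by
  refine ⟨D.carrier, D.proj, D.isOpen_carrier, h1, fun p hp =>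
    (D.contMDiffAt_proj hp).contMDiffWithinAt, ?_, fun p hp => ⟨D.mfderiv_proj_surjective hp, ?_⟩,
    fun z => ?_, fun x => rfl, fun v p hp => ?_⟩
  · exact Set.eq_univ_of_forall fun z => D.exists_proj_eq z
  · ext ζ
    exact D.mfderiv_proj_eq_zero_iff hp ζ
  · obtain ⟨p, hp, rfl⟩ := D.exists_proj_eq z
    have h2 : D.carrier ∩ D.proj ⁻¹' {D.proj p} = {q | q ∈ D.carrier ∧ D.rel p q} := by
      ext q
      refine and_congr_right fun hq => ?_
      exact eq_comm.trans (D.proj_eq_proj_iff hp hq)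
    refine ⟨⟨p, hp, rfl⟩, ?_⟩
    exact h2 ▸ D.isPreconnected_leaf p hp
  · exact D.mfderiv_proj_mulInvariantVectorField hp v

end

end LeafRelation

end

theorem proposition1
    {E : Type uE} [NormedAddCommGroup E] [NormedSpace ℂ E] [FiniteDimensional ℂ E] [CompleteSpace E]
    {G : Type uG} [TopologicalSpace G] [ChartedSpace E G] [Group G] [LieGroup 𝓘(ℂ, E) ω G]
    {X : Type uX} [TopologicalSpace X] [T2Space X] [CompactSpace X] [ConnectedSpace X]
    [ChartedSpace ℂ X] [IsManifold 𝓘(ℂ, ℂ) ω X]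
    (α : MeromorphicOneForm X E) (hα : ∀ x : X, ¬ α.IsZero x) :
    ∃ T : TwistorSpace.{uE, uX, uE, max uG uX} E (GroupLieAlgebra 𝓘(ℂ, E) G) X,
      T.IsTwistorSpaceFor α ∧ T.IsRegularFor α ∧ T.IsMinimalFor α := by
  obtain ⟨D, B, hB, h1B, hBD, hrel, hinj⟩ := exists_leafRelation_system (G := G) α hα
  have h1 : ∀ x : X, (x, (1 : G)) ∈ D.carrier := fun x => hBD ⟨Set.mem_univ _, h1B⟩
  exact ⟨D.twistorSpace hα h1 hinj, D.isTwistorSpaceFor_twistorSpace hα h1 hinj,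
    D.isRegularFor_twistorSpace hα h1 hinj hB h1B hBD hrel,
    D.isMinimalFor_twistorSpace hα h1 hinj⟩
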